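/- **Setting.** Let $(b_i)_{i\ge1},(h_i)_{i\ge1},(\sigma_{p,i})_{i\ge1},(\sigma_{f,i})_{i\ge1}$ be sequences of positive real numbers (known) and $\theta=(\theta_i)_{i\ge1}$ a sequence of real numbers (unknown). $N(\mu,\sigma)$ denotes the normal law with mean $\mu$ and *variance* $\sigma$; $\phi,\Phi$ are the standard normal density and distribution function. Put $\tilde b_i=b_i/(b_i+h_i)$ and $a_n=\log\log n$. For each $n$ the data $X=(X_1,\dots,X_n)$ have independent coordinates $X_i\sim N(\theta_i,\sigma_{p,i})$, and $\bar X=\frac1n\sum_{i\le n}X_i$. For $q\in\mathbb R^n$ the predictive loss is $$L_n(\theta,q)=\frac1n\sum_{i=1}^n \mathbb E_{Y_i\sim N(\theta_i,\sigma_{f,i})}\big[b_i(Y_i-q_i)^++h_i(q_i-Y_i)^+\big],$$ and the risk of a rule $\hat q=\hat q(X)$ is $R_n(\theta,\hat q)=\mathbb E[L_n(\theta,\hat q(X))]$. For $\tau\in[0,\infty]$ let $\alpha_i=\alpha_i(\tau)=\tau/(\tau+\sigma_{p,i})$ (with $\alpha_i(\infty)=1$). The class $\mathcal S^G=\{\hat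 q^G(\tau):\tau\in[0,\infty]\}$ consists of $$\hat q^G_i(\tau)=\alpha_i(\tau)X_i+(1-\alpha_i(\tau))\bar X+\sqrt{\sigma_{f,i}+\alpha_i(\tau)\sigma_{p,i}}\;\Phi^{-1}(\tilde b_i),\qquad i=1,\dots,n .$$ **Assumptions.** * A1: $0<\inf_i\tilde b_i\le\sup_i\tilde b_i<1$ and $\sup_i(b_i+h_i)<\infty$. * A2: $\limsup_{n\to\infty}\frac1n\sum_{i=1}^n|\theta_i|<\infty$. * A3: $\sup_i\sigma_{p,i}/\sigma_{f,i}<1/(4e)$, $\sup_i\sigma_{f,i}<\infty$ and $\inf_i\sigma_{p,i}>0$. **The risk estimate.** Let $G(w,\beta)=\phi(w)+w\Phi(w)-\beta w$, with $G'$ its derivative in $w$, let $H_k$ be the probabilists' Hermite polynomials, and $$c_i(\tau)=\sqrt{\frac{\sigma_{f,i}+\alpha_i\sigma_{p,i}}{\sigma_{f,i}+\alpha_i^2\sigma_{p,i}}}\;\Phi^{-1}(\tilde b_i),\qquad d_i(\tau)=-\frac{1-\alpha_i}{\sqrt{\sigma_{f,i}+\sigma_{p,i}\alpha_i^2}} .$$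 Fix numbers $\gamma(i)$ with $0<\gamma(i)<1/\sqrt{4e}-\sqrt{\sigma_{p,i}/\sigma_{f,i}}$ for all $i$ and $\inf_i\gamma(i)>0$; put $\lambda_n(i)=\gamma(i)\sqrt{2\log n}$ and $K_n(i)=1+\big\lceil e^2\big(\gamma(i)+\sqrt{2\sigma_{p,i}/\sigma_{f,i}}\big)^2(2\log n)\big\rceil$. With $s=\sqrt{2\sigma_{p,i}d_i(\tau)^2}$ let $$S_i(u)=G(0,\tilde b_i)+G'(0,\tilde b_i)\,u+\phi(0)\sum_{k=0}^{K_n(i)-2}\frac{(-1)^kH_k(0)}{(k+2)!}\,s^{k+2}H_{k+2}(u/s)$$ (where $s^{k}H_{k}(u/s)$ is read as $u^{k}$ if $s=0$), and let $\tilde S_i(u)=\max\{-n,\min\{S_i(u),n\}\}$. For $x,z\in\mathbb R$ put $U=c_i(\tau)+d_i(\tau)(x+\sqrt{\sigma_{p,i}}\,z)$, $V=c_i(\tau)+d_i(\tau)(x-\sqrt{\sigma_{p,i}}\,z)$, and let $\hat T_i(x,z,\tau)$ be $-\tilde b_iU$ if $V<-\lambda_n(i)$, $\tilde S_i(U)$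 if $|V|\le\lambda_n(i)$, and $(1-\tilde b_i)U$ if $V>\lambda_n(i)$. Put $\hat T_i(x,\tau)=\mathbb E_{Z\sim N(0,1)}\hat T_i(x,Z,\tau)$ and $$\mathrm{ARE}^G_n(\tau)=\frac1n\sum_{i=1}^n(b_i+h_i)\sqrt{\sigma_{f,i}+\sigma_{p,i}\alpha_i(\tau)^2}\;\hat T_i(X_i-\bar X,\tau).$$ **The grid.** Let $C_1,\dots,C_4$ be constants with $\sup_i(b_i+h_i)\le C_1$, $\sup_i\max\{\sigma_{p,i},\sigma_{p,i}^{-1}\}\le C_2$, $\sup_i(\sigma_{p,i}/\sigma_{f,i})\cdot\sup_i|\Phi^{-1}(\tilde b_i)|\le C_3$ and $\frac1n\sum_{i\le n}|\theta_i|\le C_4\sqrt{a_n}$ for all large $n$. Let $\delta_n=\{2C_1C_2(2\phi(0)+C_3+\sqrt{a_n}\,C_4+a_n)\}^{-1}$, and let $\Lambda_n\subset[0,\infty]$ be the set of all $\tau$ with $\tau/(\tau+1)\in\{(j-1)\delta_n:1\le j\le\lceil1/\delta_n\rceil\}$. Let $\hat\tau_n=\hat\tau^{\mathrm{ARE}^G}_n$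 be a measurable function of $X$ that minimizes $\mathrm{ARE}^G_n(\tau)$ over $\tau\in\Lambda_n$, and let $\tau_n^{\mathsf{GOR}}$ (the oracle) be a minimizer of $\tau\mapsto L_n(\theta,\hat q^G(\tau))$ over $[0,\infty]$. **Theorem.** Assume A1, A2 and A3. Then all the expectations below are finite, and the following hold. (A) Comparison with the oracle: I. $\lim_{n\to\infty}\Pr\{L_n(\theta,\hat q^G(\hat\tau^{\mathrm{ARE}^G}_n))\ge L_n(\theta,\hat q^G(\tau_n^{\mathsf{GOR}}))+\epsilon\}=0$ for every fixed $\epsilon>0$; II. $\lim_{n\to\infty}\big\{R_n(\theta,\hat q^G(\hat\tau^{\mathrm{ARE}^G}_n))-\mathbb E[L_n(\theta,\hat q^G(\tau_n^{\mathsf{GOR}}))]\big\}=0$. (B) For any estimates $\tilde\tau_n=\tilde\tau_n(X)\in[0,\infty]$ (measurable functions of the data): I. $\lim_{n\to\infty}\Pr\{L_n(\theta,\hat q^G(\hat\tau^{\mathrm{ARE}^G}_n))\ge L_n(\theta,\hat q^G(\tilde\tau_n))+\epsilon\}=0$ for every fixed $\epsilon>0$; II. $\limsup_{n\to\infty}\big\{R_n(\theta,\hat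 q^G(\hat\tau^{\mathrm{ARE}^G}_n))-R_n(\theta,\hat q^G(\tilde\tau_n))\big\}\le0$. -/

import Mathlib

open MeasureTheory ProbabilityTheory Filter Topology
open scoped ENNReal

namespace CheckLoss

/-- Standard normal density `φ`. -/
noncomputable def stdPDF (x : ℝ) : ℝ := gaussianPDFReal 0 1 x

/-- Standard normal distribution function `Φ`. -/
noncomputable def stdCDF (x : ℝ) : ℝ := cdf (gaussianReal 0 1) x

/-- Standard normal quantile `Φ⁻¹ p`; only used for `0 < p < 1`. -/
noncomputable def stdQuantile (p : ℝ) : ℝ := sInf {x : ℝ | p ≤ stdCDF x}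

/-- `G(w, β) = φ(w) + w Φ(w) - β w`. -/
noncomputable def G (w β : ℝ) : ℝ := stdPDF w + w * stdCDF w - β * w

/-- The derivative of `G(·, β)` at `0`, which is `Φ(0) - β`. -/
noncomputable def derivG0 (β : ℝ) : ℝ := deriv (fun w => G w β) 0

/-- The known constants of the model: the weights `b i`, `h i` of the check loss, and the past and
future variances `σp i`, `σf i`. Coordinates are numbered from `0`; the model of dimension `n` uses
the first `n` of them. -/
structure Model where
  b : ℕ → ℝ
  h : ℕ → ℝ
  σp : ℕ → ℝ
  σf : ℕ → ℝ

namespace Model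

variable (M : Model)

/-- The weights and the variances are positive numbers. -/
structure Positive : Prop where
  b_pos : ∀ i, 0 < M.b i
  h_pos : ∀ i, 0 < M.h i
  σp_pos : ∀ i, 0 < M.σp i
  σf_pos : ∀ i, 0 < M.σf i

/-- Critical ratio `b / (b + h)`. -/
noncomputable def ratio (i : ℕ) : ℝ := M.b i / (M.b i + M.h i)

/-- Bounded weights: `0 < inf ratio ≤ sup ratio < 1` and `sup (b + h) < ∞`. -/
def A1 : Prop :=
  (∃ l > 0, ∀ i, l ≤ M.ratio i) ∧ (∃ u < 1, ∀ i, M.ratio i ≤ u) ∧ ∃ C, ∀ i, M.b i + M.h i ≤ C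

/-- Sufficient historical data: `sup σp/σf < 1/(4e)`, `sup σf < ∞` and `inf σp > 0`. -/
def A3 : Prop :=
  (∃ r < 1 / (4 * Real.exp 1), ∀ i, M.σp i / M.σf i ≤ r) ∧
    (∃ C, ∀ i, M.σf i ≤ C) ∧ ∃ c > 0, ∀ i, c ≤ M.σp i

end Model

/-- Bounded parameters: `limsup (1/n) ∑_{i<n} |θ i| < ∞`. -/
def A2 (θ : ℕ → ℝ) : Prop :=
  IsBoundedUnder (· ≤ ·) atTop (fun n : ℕ => (1 / (n : ℝ)) * ∑ i : Fin n, |θ i|)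

namespace Model

variable (M : Model)

/-! ### Loss, data and risk -/

/-- Predictive check loss of coordinate `i`:
`E [b (Y - q)⁺ + h (q - Y)⁺]` for `Y ∼ N(t, σf i)`. -/
noncomputable def coordLoss (i : ℕ) (t q : ℝ) : ℝ :=
  ∫ y, (M.b i * max (y - q) 0 + M.h i * max (q - y) 0) ∂(gaussianReal t (M.σf i).toNNReal)

/-- `L_n(θ, q)`. -/
noncomputable def loss (n : ℕ) (θ : ℕ → ℝ) (q : Fin n → ℝ) : ℝ :=
  (1 / (n : ℝ)) * ∑ i : Fin n, M.coordLoss i (θ i) (q i)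

/-- The law of the past data `X = (X_i)_{i<n}`: independent `X_i ∼ N(θ i, σp i)`. -/
noncomputable def dataLaw (n : ℕ) (θ : ℕ → ℝ) : Measure (Fin n → ℝ) :=
  Measure.pi fun i : Fin n => gaussianReal (θ i) (M.σp i).toNNReal

/-- The predictive risk `R_n(θ, q̂) = E L_n(θ, q̂(X))` of a data-dependent prediction rule. -/
noncomputable def risk (n : ℕ) (θ : ℕ → ℝ) (q : (Fin n → ℝ) → (Fin n → ℝ)) : ℝ :=
  ∫ x, M.loss n θ (q x) ∂(M.dataLaw n θ)

/-! ### Shrinkage towards the grand mean -/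

/-- Shrinkage factor `α_i(τ) = τ / (τ + σp i)` for `τ ∈ [0, ∞]`, with `α_i(∞) = 1`. -/
noncomputable def shrink (i : ℕ) (τ : ℝ≥0∞) : ℝ :=
  if τ = ∞ then 1 else τ.toReal / (τ.toReal + M.σp i)

end Model

/-- The grand mean of the data. -/
noncomputable def grandMean {n : ℕ} (x : Fin n → ℝ) : ℝ := (1 / (n : ℝ)) * ∑ i, x i

namespace Model

variable (M : Model)

/-- The prediction `q̂^G(τ)` computed from the data `x`:
`α_i(τ) x_i + (1 - α_i(τ)) x̄ + √(σf + α_i(τ) σp) Φ⁻¹(b/(b+h))`. -/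
noncomputable def qG {n : ℕ} (τ : ℝ≥0∞) (x : Fin n → ℝ) (i : Fin n) : ℝ :=
  M.shrink i τ * x i + (1 - M.shrink i τ) * grandMean x
    + √(M.σf i + M.shrink i τ * M.σp i) * stdQuantile (M.ratio i)

/-! ### The asymptotic risk estimate -/

/-- `c_i(τ) = √((σf + α σp) / (σf + α² σp)) Φ⁻¹(b/(b+h))`. -/
noncomputable def coefC (i : ℕ) (τ : ℝ≥0∞) : ℝ :=
  √((M.σf i + M.shrink i τ * M.σp i) / (M.σf i + M.shrink i τ ^ 2 * M.σp i))
    * stdQuantile (M.ratio i)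

/-- `d_i(τ) = -(1 - α) / √(σf + α² σp)`. -/
noncomputable def coefD (i : ℕ) (τ : ℝ≥0∞) : ℝ :=
  -(1 - M.shrink i τ) / √(M.σf i + M.shrink i τ ^ 2 * M.σp i)

/-- Threshold `λ_n(i) = γ(i) √(2 log n)`. -/
noncomputable def threshold (γ : ℕ → ℝ) (n i : ℕ) : ℝ := γ i * √(2 * Real.log n)

/-- Order of truncation `K_n(i) = 1 + ⌈e² (γ(i) + √(2 σp/σf))² (2 log n)⌉`. -/
noncomputable def truncOrder (γ : ℕ → ℝ) (n i : ℕ) : ℕ :=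
  1 + ⌈Real.exp 1 ^ 2 * (γ i + √(2 * M.σp i / M.σf i)) ^ 2 * (2 * Real.log n)⌉₊

end Model

/-- The probabilists' Hermite polynomial `H_k` as a function on the reals. -/
noncomputable def hermiteEval (k : ℕ) (x : ℝ) : ℝ := Polynomial.aeval x (Polynomial.hermite k)

/-- `s ^ k H_k(u / s)`, which is a polynomial in `s` and `u`; its value at `s = 0` is `u ^ k`. -/
noncomputable def scaledHermite (k : ℕ) (s u : ℝ) : ℝ :=
  if s = 0 then u ^ k else s ^ k * hermiteEval k (u / s)

namespace Model

variable (M : Model)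

/-- `S_i(u)`: the unbiased estimate of the Taylor polynomial of `G(·, b/(b+h))` at `0` of order
`K_n(i)`. The sum runs over `0 ≤ k ≤ K_n(i) - 2`. -/
noncomputable def taylorEst (γ : ℕ → ℝ) (n i : ℕ) (τ : ℝ≥0∞) (u : ℝ) : ℝ :=
  G 0 (M.ratio i) + derivG0 (M.ratio i) * u
    + stdPDF 0 * ∑ k ∈ Finset.range (M.truncOrder γ n i - 1),
        ((-1) ^ k * hermiteEval k 0 / ((k + 2).factorial : ℝ))
          * scaledHermite (k + 2) (√(2 * M.σp i * M.coefD i τ ^ 2)) u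

/-- `S̃_i(u)`: the estimate `S_i(u)` truncated to `[-n, n]`. -/
noncomputable def truncTaylorEst (γ : ℕ → ℝ) (n i : ℕ) (τ : ℝ≥0∞) (u : ℝ) : ℝ :=
  max (-(n : ℝ)) (min (M.taylorEst γ n i τ u) n)

/-- `U_i(τ) = c_i(τ) + d_i(τ) (x + √σp z)`. -/
noncomputable def splitU (i : ℕ) (τ : ℝ≥0∞) (x z : ℝ) : ℝ :=
  M.coefC i τ + M.coefD i τ * (x + √(M.σp i) * z)

/-- `V_i(τ) = c_i(τ) + d_i(τ) (x - √σp z)`. -/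
noncomputable def splitV (i : ℕ) (τ : ℝ≥0∞) (x z : ℝ) : ℝ :=
  M.coefC i τ + M.coefD i τ * (x - √(M.σp i) * z)

/-- The randomized threshold estimate `T̂_i(x, z, τ)`. -/
noncomputable def randT (γ : ℕ → ℝ) (n i : ℕ) (τ : ℝ≥0∞) (x z : ℝ) : ℝ :=
  if M.splitV i τ x z < -threshold γ n i then -M.ratio i * M.splitU i τ x z
  else if M.splitV i τ x z ≤ threshold γ n i then M.truncTaylorEst γ n i τ (M.splitU i τ x z)
  else (1 - M.ratio i) * M.splitU i τ x z

/-- `T̂_i(x, τ)`: the average of `T̂_i(x, Z, τ)` over the added noise `Z ∼ N(0, 1)`. -/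
noncomputable def coordT (γ : ℕ → ℝ) (n i : ℕ) (τ : ℝ≥0∞) (x : ℝ) : ℝ :=
  ∫ z, M.randT γ n i τ x z ∂(gaussianReal 0 1)

/-- The asymptotic risk estimate for shrinkage towards the origin. -/
noncomputable def ARE (γ : ℕ → ℝ) (n : ℕ) (τ : ℝ≥0∞) (x : Fin n → ℝ) : ℝ :=
  (1 / (n : ℝ)) * ∑ i : Fin n, (M.b i + M.h i) * √(M.σf i + M.σp i * M.shrink i τ ^ 2)
    * M.coordT γ n i τ (x i)

/-- The asymptotic risk estimate for shrinkage towards the grand mean. -/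
noncomputable def AREG (γ : ℕ → ℝ) (n : ℕ) (τ : ℝ≥0∞) (x : Fin n → ℝ) : ℝ :=
  M.ARE γ n τ (fun i => x i - grandMean x)

/-- Admissible constants `γ(i)`: each is below `1/√(4e) - √(σp/σf)`, and they are bounded away
from `0`. -/
def AdmissibleGamma (γ : ℕ → ℝ) : Prop :=
  (∃ γ₀ > 0, ∀ i, γ₀ ≤ γ i) ∧
    ∀ i, γ i < 1 / √(4 * Real.exp 1) - √(M.σp i / M.σf i)

/-! ### The grid -/

/-- The constants entering the mesh of the grid bound the quantities that they have to bound. -/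
structure GridConstants (θ : ℕ → ℝ) (C₁ C₂ C₃ C₄ : ℝ) : Prop where
  weights : ∀ i, M.b i + M.h i ≤ C₁
  variances : ∀ i, max (M.σp i) (M.σp i)⁻¹ ≤ C₂
  quantiles : ∀ i j, M.σp i / M.σf i * |stdQuantile (M.ratio j)| ≤ C₃
  means : ∀ᶠ n : ℕ in atTop,
    (1 / (n : ℝ)) * ∑ i : Fin n, |θ i| ≤ C₄ * √(Real.log (Real.log n))

end Model

/-- `δ_n = 1 / (2 C₁ C₂ (2 φ(0) + C₃ + √a_n C₄ + a_n))` with `a_n = log log n`. -/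
noncomputable def mesh (C₁ C₂ C₃ C₄ : ℝ) (n : ℕ) : ℝ :=
  (2 * C₁ * C₂ * (2 * stdPDF 0 + C₃ + √(Real.log (Real.log n)) * C₄ + Real.log (Real.log n)))⁻¹

/-- The grid `Λ_n ⊆ [0, ∞]`: the points `τ` for which `τ/(τ+1)` is one of
`0, δ_n, 2 δ_n, …, (m - 1) δ_n`, where `m = ⌈1/δ_n⌉`. -/
noncomputable def grid (C₁ C₂ C₃ C₄ : ℝ) (n : ℕ) : Set ℝ≥0∞ :=
  {τ | ∃ j : ℕ, j < ⌈1 / mesh C₁ C₂ C₃ C₄ n⌉₊ ∧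
    τ = ENNReal.ofReal (j * mesh C₁ C₂ C₃ C₄ n) / ENNReal.ofReal (1 - j * mesh C₁ C₂ C₃ C₄ n)}

/-- `t` minimizes `f` over `s`. -/
def IsArgmin (f : ℝ≥0∞ → ℝ) (s : Set ℝ≥0∞) (t : ℝ≥0∞) : Prop := t ∈ s ∧ ∀ u ∈ s, f t ≤ f u

end CheckLoss

open CheckLoss

namespace CheckLoss

/-! ### The standard normal law -/

/-! Let `m` be the mean of the parameters. If the grand mean of the data is replaced by `m`, the
loss of coordinate `i` at a fixed `τ` has as expectation a known factor times `G w β`, where `w = c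
+ d (θ i - m)` and `β` is the critical ratio (`integral_coordLoss`). The average of these
expectations is a deterministic `target`, and the loss is within `O(n^(-1/2))` of it in `L¹`
(`integral_abs_loss_sub_target_le`). The core of the proof is that the risk estimate is within
`O((log n)^(-1/4))` of the same target (`integral_abs_AREG_sub_target_le`).

Consider first deviations from `m`. Adding independent noise splits an observation into independent
`U` and `V`, both of law `N(w, s²)` (`measurePreserving_rotation`). The variable `V` selects a
regime. If `V` is far from `0`, then `G` is nearly linear and a linear function of `U` serves;
otherwise the Taylor polynomial of `G` at `0` is estimated without bias by Hermite polynomials in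
`U`. With `S = √(2 σp/σf)`, that polynomial is accurate for `|w| ≤ (γ + S) √(2 log n)`, because its
order exceeds `e²` times the square of this radius. The bound on `γ` gives `e w² ≤ log n` there,
which keeps the second moment of the Hermite estimate at `O(log² n √n)`. For larger `|w|` the
probability of the middle regime outweighs the truncation level `n`, by the Gaussian tail. Uniformly
in `w`, the bias is `O(1/√log n)` and the mean squared error is `O(n/√log n)` (`abs_bias_le`,
`mse_le`, `coordT_moments`).

Centering at the grand mean of the data makes the summands dependent. The deviations are jointly
normal, with covariance matrix entrywise within `O(1/n)` of the nominal diagonal one. Given one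
deviation, another is normal, and its `χ²`-distance from its nominal law is `O(n^(-2))` on average.
Hence two centered functions with second moments at most `V` have a product with expectation `O((V +
1)/n)` (`abs_integral_mul_dev_le`), and the average of all of them has mean square `O((V + 1)/n)`
(`integral_sq_mean_dev_le`); for `V` of order `n/√log n` this tends to `0`.

The grid has `O(log log n)` points, so even the sum of the errors over the grid vanishes. The loss
is Lipschitz in `τ/(τ+1)` with a random constant of bounded mean, and the mesh tends to `0`. Thus
one random variable with vanishing mean bounds the excess loss over all competitors at once, the
oracle included (`exists_excess`). Markov's inequality and integration give all the claims. -/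

lemma stdPDF_eq (x : ℝ) : stdPDF x = (√(2 * Real.pi))⁻¹ * Real.exp (-x ^ 2 / 2) := by
  simp [stdPDF, gaussianPDFReal]

lemma stdPDF_pos (x : ℝ) : 0 < stdPDF x := gaussianPDFReal_pos _ _ _ (by simp)

lemma stdPDF_neg (x : ℝ) : stdPDF (-x) = stdPDF x := by simp [stdPDF_eq]

lemma stdPDF_zero_le : stdPDF 0 ≤ 1 / 2 := by
  rw [stdPDF_eq]
  have h : (2 : ℝ) ≤ √(2 * Real.pi) := by
    apply Real.le_sqrt_of_sq_le
    nlinarith [Real.pi_gt_three]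
  simp only [ne_eq, OfNat.ofNat_ne_zero, not_false_eq_true, zero_pow, neg_zero, zero_div,
    Real.exp_zero, mul_one]
  rw [inv_eq_one_div]
  gcongr

lemma stdPDF_le_exp (x : ℝ) : stdPDF x ≤ 1 / 2 * Real.exp (-x ^ 2 / 2) := by
  have h := stdPDF_zero_le
  rw [stdPDF_eq] at h ⊢
  simp only [ne_eq, OfNat.ofNat_ne_zero, not_false_eq_true, zero_pow, neg_zero, zero_div,
    Real.exp_zero, mul_one] at h
  gcongr

lemma stdPDF_le_half (x : ℝ) : stdPDF x ≤ 1 / 2 := by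
  refine (stdPDF_le_exp x).trans ?_
  have : Real.exp (-x ^ 2 / 2) ≤ 1 := Real.exp_le_one_iff.2 (by nlinarith [sq_nonneg x])
  linarith

lemma stdPDF_le_inv_sq (x : ℝ) (hx : x ≠ 0) : stdPDF x ≤ 1 / x ^ 2 := by
  refine (stdPDF_le_exp x).trans ?_
  have h1 : x ^ 2 / 2 ≤ Real.exp (x ^ 2 / 2) := by
    have := Real.add_one_le_exp (x ^ 2 / 2); linarith
  have hx2 : 0 < x ^ 2 := by positivity
  rw [neg_div, Real.exp_neg, le_div_iff₀ hx2]
  have := Real.exp_pos (x ^ 2 / 2)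
  rw [mul_assoc, inv_mul_eq_div, ← mul_div_assoc, div_le_iff₀ this]
  linarith

lemma hasDerivAt_stdPDF (x : ℝ) : HasDerivAt stdPDF (-x * stdPDF x) x := by
  have h : HasDerivAt (fun x : ℝ => (√(2 * Real.pi))⁻¹ * Real.exp (-x ^ 2 / 2))
      ((√(2 * Real.pi))⁻¹ * (Real.exp (-x ^ 2 / 2) * (-(2 * x) / 2))) x := by
    have h0 : HasDerivAt (fun x : ℝ => -x ^ 2 / 2) (-(2 * x) / 2) x := by
      simpa using ((hasDerivAt_pow 2 x).neg.div_const 2)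
    exact (h0.exp).const_mul _
  have e : stdPDF = fun x : ℝ => (√(2 * Real.pi))⁻¹ * Real.exp (-x ^ 2 / 2) :=
    funext stdPDF_eq
  rw [e]
  convert h using 1
  ring

lemma continuous_stdPDF : Continuous stdPDF :=
  continuous_iff_continuousAt.2 fun x => (hasDerivAt_stdPDF x).continuousAt

lemma integrable_stdPDF : Integrable stdPDF := integrable_gaussianPDFReal 0 1

lemma integral_gaussian_eq (f : ℝ → ℝ) :
    ∫ z, f z ∂(gaussianReal 0 1) = ∫ z, stdPDF z * f z := by
  rw [integral_gaussianReal_eq_integral_smul (by simp)]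
  rfl

lemma stdCDF_eq (x : ℝ) : stdCDF x = ∫ z in Set.Iic x, stdPDF z := by
  rw [stdCDF, cdf_eq_real, measureReal_def, gaussianReal_apply_eq_integral _ (by simp),
    ENNReal.toReal_ofReal (integral_nonneg fun z => gaussianPDFReal_nonneg _ _ z)]
  rfl

lemma stdCDF_nonneg (x : ℝ) : 0 ≤ stdCDF x := cdf_nonneg _ _

lemma stdCDF_le_one (x : ℝ) : stdCDF x ≤ 1 := cdf_le_one _ _

lemma hasDerivAt_stdCDF (x : ℝ) : HasDerivAt stdCDF (stdPDF x) x := by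
  have e : stdCDF = fun x => stdCDF 0 + ∫ z in (0 : ℝ)..x, stdPDF z := by
    funext x
    rw [stdCDF_eq, stdCDF_eq, ← intervalIntegral.integral_Iic_sub_Iic
      integrable_stdPDF.integrableOn integrable_stdPDF.integrableOn]
    ring
  rw [e]
  exact (continuous_stdPDF.integral_hasStrictDerivAt 0 x).hasDerivAt.const_add _

lemma stdCDF_neg (x : ℝ) : stdCDF (-x) = 1 - stdCDF x := by
  have h1 : stdCDF (-x) = ∫ z in Set.Ioi x, stdPDF z := by
    rw [stdCDF_eq, ← integral_comp_neg_Ioi]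
    simp [stdPDF_neg]
  have h2 : stdCDF x + ∫ z in Set.Ioi x, stdPDF z = 1 := by
    rw [stdCDF_eq, intervalIntegral.integral_Iic_add_Ioi integrable_stdPDF.integrableOn
      integrable_stdPDF.integrableOn]
    exact integral_gaussianPDFReal_eq_one 0 (by simp)
  linarith

lemma integrable_id_mul_stdPDF : Integrable fun z => z * stdPDF z := by
  have h := (memLp_id_gaussianReal (μ := 0) (v := 1) 1).integrable (by simp)
  have e : gaussianReal 0 1 = volume.withDensity (fun z => ENNReal.ofReal (stdPDF z)) := by
    rw [gaussianReal_of_var_ne_zero _ (by simp)]; rfl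
  rw [e, integrable_withDensity_iff_integrable_smul'] at h
  · refine h.congr (ae_of_all _ fun z => ?_)
    simp [(stdPDF_pos z).le, mul_comm]
  · exact continuous_stdPDF.measurable.ennreal_ofReal
  · simp

/-- The expected positive part `E (w - Z)⁺`, for standard normal `Z`. -/
noncomputable def gaussPos (w : ℝ) : ℝ := stdPDF w + w * stdCDF w

lemma G_eq (w β : ℝ) : G w β = gaussPos w - β * w := rfl

lemma hasDerivAt_gaussPos (w : ℝ) : HasDerivAt gaussPos (stdCDF w) w := by
  have h := (hasDerivAt_stdPDF w).add ((hasDerivAt_id' w).mul (hasDerivAt_stdCDF w))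
  have e : -w * stdPDF w + (1 * stdCDF w + w * stdPDF w) = stdCDF w := by ring
  rw [e] at h
  exact h

lemma hasDerivAt_G (w β : ℝ) : HasDerivAt (fun w => G w β) (stdCDF w - β) w := by
  have h := (hasDerivAt_gaussPos w).sub ((hasDerivAt_id' w).const_mul β)
  rw [mul_one] at h
  exact h

lemma derivG0_eq (β : ℝ) : derivG0 β = stdCDF 0 - β := (hasDerivAt_G 0 β).deriv

lemma gaussPos_neg (w : ℝ) : gaussPos (-w) = gaussPos w - w := by
  rw [gaussPos, gaussPos, stdPDF_neg, stdCDF_neg]; ring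

lemma tendsto_stdPDF_atBot : Tendsto stdPDF atBot (𝓝 0) := by
  have h1 : Tendsto (fun x : ℝ => x ^ 2) atBot atTop := by
    simpa [Function.comp_def] using (tendsto_pow_atTop two_ne_zero).comp (tendsto_abs_atBot_atTop (G := ℝ))
  refine squeeze_zero' (Eventually.of_forall fun x => (stdPDF_pos x).le) ?_
    (tendsto_const_nhds.div_atTop h1 : Tendsto (fun x : ℝ => 1 / x ^ 2) atBot (𝓝 0))
  filter_upwards [eventually_lt_atBot (0 : ℝ)] with x hx using stdPDF_le_inv_sq x hx.ne

lemma integral_pos_part (w : ℝ) : ∫ z, max (w - z) 0 ∂(gaussianReal 0 1) = gaussPos w := by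
  rw [integral_gaussian_eq]
  have e : (fun z => stdPDF z * max (w - z) 0)
      = (Set.Iic w).indicator fun z => w * stdPDF z - z * stdPDF z := by
    funext z
    by_cases h : z ≤ w
    · rw [Set.indicator_of_mem (Set.mem_Iic.2 h), max_eq_left (by linarith)]; ring
    · rw [Set.indicator_of_notMem (by simpa using h), max_eq_right (by linarith)]; ring
  rw [e, integral_indicator measurableSet_Iic, integral_sub
    (integrable_stdPDF.const_mul w).integrableOn integrable_id_mul_stdPDF.integrableOn,
    integral_const_mul, ← stdCDF_eq]
  -- `-z φ(z)` is the derivative of `φ`, so the remaining integral is `φ(w)`.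
  have h := integral_Iic_of_hasDerivAt_of_tendsto (a := w)
    (f := stdPDF) (f' := fun z => -z * stdPDF z) continuous_stdPDF.continuousWithinAt
    (fun z _ => hasDerivAt_stdPDF z)
    (by simpa using integrable_id_mul_stdPDF.neg.integrableOn) tendsto_stdPDF_atBot
  simp only [neg_mul, integral_neg, sub_zero] at h
  rw [gaussPos]
  linarith

lemma gaussPos_nonneg (w : ℝ) : 0 ≤ gaussPos w := by
  rw [← integral_pos_part]
  exact integral_nonneg fun z => le_max_right _ _

lemma gaussPos_le (w : ℝ) : gaussPos w ≤ max w 0 + stdPDF w := by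
  rw [gaussPos]
  rcases le_total 0 w with h | h
  · rw [max_eq_left h]; nlinarith [stdCDF_le_one w]
  · rw [max_eq_right h]; nlinarith [stdCDF_nonneg w]

lemma gaussPos_le_abs (w : ℝ) : gaussPos w ≤ |w| + 1 := by
  have h1 := gaussPos_le w
  have h2 := stdPDF_le_half w
  have h3 : max w 0 ≤ |w| := max_le (le_abs_self w) (abs_nonneg w)
  linarith

lemma abs_G_le (w β : ℝ) (h0 : 0 ≤ β) (h1 : β ≤ 1) : |G w β| ≤ |w| + 1 := by
  have ha := gaussPos_le_abs w
  have hb := gaussPos_nonneg w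
  have hc := gaussPos_nonneg (-w)
  have hd := gaussPos_le_abs (-w)
  rw [gaussPos_neg] at hc hd
  rw [abs_neg] at hd
  rw [G_eq, abs_le]
  have h2 := neg_abs_le w
  have h3 := le_abs_self w
  constructor <;> nlinarith

/-- Mills' inequality is the nonnegativity of `E (-t - Z)⁺ = φ(t) - t Φ(-t)`. -/
lemma stdCDF_neg_le (t : ℝ) (ht : 0 < t) : stdCDF (-t) ≤ stdPDF t / t := by
  have h := gaussPos_nonneg (-t)
  rw [gaussPos, stdPDF_neg] at h
  rw [le_div_iff₀ ht]
  linarith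

lemma gaussian_real_Iic (t : ℝ) : (gaussianReal 0 1).real (Set.Iic t) = stdCDF t :=
  (cdf_eq_real _ _).symm

lemma gaussian_real_Ici (t : ℝ) : (gaussianReal 0 1).real (Set.Ici t) = stdCDF (-t) := by
  have h := gaussianReal_map_neg (μ := 0) (v := 1)
  rw [neg_zero] at h
  rw [← gaussian_real_Iic, ← h, map_measureReal_apply measurable_neg measurableSet_Ici, h]
  congr 1
  ext x
  simp only [Set.mem_preimage, Set.mem_Ici, Set.mem_Iic]
  constructor <;> intro h <;> linarith

/-- The sharp tail. The factor `1/t` gained over the density matters at `t = √(2 log n)`, where it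
turns the bound `1/n` into `o(1/n)`. -/
lemma gaussian_abs_tail_mills (t : ℝ) (ht : 0 < t) :
    (gaussianReal 0 1).real {z | t ≤ |z|} ≤ 2 * (stdPDF t / t) := by
  have e : {z : ℝ | t ≤ |z|} = Set.Ici t ∪ Set.Iic (-t) := by
    ext z
    simp only [Set.mem_ofPred_eq, Set.mem_union, Set.mem_Ici, Set.mem_Iic, le_abs]
    constructor <;> rintro (h | h) <;> [left; right; left; right] <;> linarith
  rw [e]
  refine (measureReal_union_le _ _).trans ?_
  rw [gaussian_real_Iic, gaussian_real_Ici]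
  have := stdCDF_neg_le t ht
  linarith

lemma integrable_pow_gaussianReal (μ : ℝ) (v : NNReal) (k : ℕ) :
    Integrable (fun z : ℝ => z ^ k) (gaussianReal μ v) := by
  have h := (memLp_id_gaussianReal (μ := μ) (v := v) k).integrable_norm_pow'
  refine (integrable_norm_iff (by fun_prop)).1 ?_
  simpa using h

lemma integral_sq_gaussian : ∫ z, z ^ 2 ∂(gaussianReal 0 1) = 1 := by
  have h := variance_fun_id_gaussianReal (μ := 0) (v := 1)
  rw [variance_eq_integral (by fun_prop)] at h
  simpa using h

/-- Chebyshev's inequality, which suffices wherever only polynomial decay in `w` is needed. -/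
lemma gaussian_abs_tail_sq (t : ℝ) (ht : 0 < t) :
    (gaussianReal 0 1).real {z | t ≤ |z|} ≤ 1 / t ^ 2 := by
  have h := mul_meas_ge_le_integral_of_nonneg (μ := gaussianReal 0 1) (f := fun z : ℝ => z ^ 2)
    (ae_of_all _ fun z => sq_nonneg z) (integrable_pow_gaussianReal 0 1 2) (t ^ 2)
  rw [integral_sq_gaussian] at h
  have e : {z : ℝ | t ≤ |z|} = {z | t ^ 2 ≤ z ^ 2} := by
    ext z
    simp only [Set.mem_ofPred_eq]
    rw [sq_le_sq, abs_of_pos ht]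
  rw [e, le_div_iff₀ (by positivity), mul_comm]
  exact h

/-! ### Hermite polynomials -/

lemma derivative_hermite_succ (n : ℕ) :
    Polynomial.derivative (Polynomial.hermite (n + 1))
      = ((n : Polynomial ℤ) + 1) * Polynomial.hermite n := by
  induction n with
  | zero => simp
  | succ n ih =>
    rw [Polynomial.hermite_succ (n + 1), Polynomial.derivative_sub, Polynomial.derivative_mul, ih,
      Polynomial.derivative_mul, Polynomial.hermite_succ n]
    simp
    ring

lemma hermiteEval_zero (x : ℝ) : hermiteEval 0 x = 1 := by simp [hermiteEval]

lemma hermiteEval_one (x : ℝ) : hermiteEval 1 x = x := by simp [hermiteEval]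

lemma hermiteEval_add_two (k : ℕ) (x : ℝ) :
    hermiteEval (k + 2) x = x * hermiteEval (k + 1) x - (k + 1) * hermiteEval k x := by
  rw [hermiteEval, Polynomial.hermite_succ (k + 1), derivative_hermite_succ]
  simp [hermiteEval]

lemma hasDerivAt_hermiteEval_succ (k : ℕ) (x : ℝ) :
    HasDerivAt (hermiteEval (k + 1)) ((k + 1) * hermiteEval k x) x := by
  have h := (Polynomial.hermite (k + 1)).hasDerivAt_aeval x
  rw [derivative_hermite_succ] at h
  exact h.congr_deriv (by simp [hermiteEval])

lemma continuous_hermiteEval (k : ℕ) : Continuous (hermiteEval k) :=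
  Polynomial.continuous_aeval _

/-- At `0` the three-term recurrence couples only `k` and `k + 2`, with factor `k + 1`, and `(k +
1)² ≤ (k + 2)(k + 1)`. -/
lemma hermiteEval_zero_sq_le (k : ℕ) : hermiteEval k 0 ^ 2 ≤ (k.factorial : ℝ) := by
  induction k using Nat.twoStepInduction with
  | zero => simp [hermiteEval_zero]
  | one => simp [hermiteEval_one]
  | more k ih _ =>
    rw [hermiteEval_add_two, zero_mul, zero_sub, neg_sq, mul_pow, Nat.factorial_succ,
      Nat.factorial_succ]
    push_cast
    have hk : (0 : ℝ) ≤ k := Nat.cast_nonneg k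
    have hf : (0 : ℝ) ≤ (k.factorial : ℝ) := Nat.cast_nonneg _
    calc ((k : ℝ) + 1) ^ 2 * hermiteEval k 0 ^ 2
        ≤ ((k : ℝ) + 1) ^ 2 * (k.factorial : ℝ) := by gcongr
      _ ≤ ((k : ℝ) + 1 + 1) * (((k : ℝ) + 1) * (k.factorial : ℝ)) := by
        nlinarith [mul_nonneg hk hf]

lemma integrable_polynomial_gaussianReal (p : Polynomial ℝ) (μ : ℝ) (v : NNReal) :
    Integrable (fun z => p.eval z) (gaussianReal μ v) := by
  simp_rw [Polynomial.eval_eq_sum_range]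
  exact integrable_finsetSum _ fun i _ => (integrable_pow_gaussianReal μ v i).const_mul _

lemma integrable_mul_polynomial_gaussianReal (p : Polynomial ℝ) (μ : ℝ) (v : NNReal) :
    Integrable (fun z => z * p.eval z) (gaussianReal μ v) := by
  have e : (fun z => z * p.eval z) = fun z => (Polynomial.X * p).eval z := by
    funext z; rw [Polynomial.eval_mul, Polynomial.eval_X]
  rw [e]
  exact integrable_polynomial_gaussianReal _ μ v

lemma hermiteEval_eq_eval (k : ℕ) (x : ℝ) :
    hermiteEval k x = ((Polynomial.hermite k).map (Int.castRingHom ℝ)).eval x := by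
  rw [hermiteEval, Polynomial.eval_map, Polynomial.aeval_def]
  rfl

lemma integrable_hermiteEval_mul (j k : ℕ) :
    Integrable (fun z => hermiteEval j z * hermiteEval k z) (gaussianReal 0 1) := by
  simp_rw [hermiteEval_eq_eval, ← Polynomial.eval_mul]
  exact integrable_polynomial_gaussianReal _ _ _

lemma integrable_gaussian_iff (f : ℝ → ℝ) :
    Integrable f (gaussianReal 0 1) ↔ Integrable fun z => stdPDF z * f z := by
  have e : gaussianReal 0 1 = volume.withDensity (fun z => ENNReal.ofReal (stdPDF z)) := by
    rw [gaussianReal_of_var_ne_zero _ (by simp)]; rfl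
  rw [e, integrable_withDensity_iff_integrable_smul' continuous_stdPDF.measurable.ennreal_ofReal
    (by simp)]
  refine integrable_congr (ae_of_all _ fun z => ?_)
  simp [(stdPDF_pos z).le]

/-- Stein's identity: the derivative `φ (p' - z p)` of the integrable function `φ p` has integral
`0`. -/
lemma integral_mul_polynomial_gaussian (p : Polynomial ℝ) :
    ∫ z, z * p.eval z ∂(gaussianReal 0 1) = ∫ z, p.derivative.eval z ∂(gaussianReal 0 1) := by
  have i1 : Integrable (fun z => z * p.eval z) (gaussianReal 0 1) :=
    integrable_mul_polynomial_gaussianReal p 0 1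
  have i2 := integrable_polynomial_gaussianReal p.derivative 0 1
  have i3 := integrable_polynomial_gaussianReal p 0 1
  have h := integral_eq_zero_of_hasDerivAt_of_integrable
    (f := fun z => stdPDF z * p.eval z)
    (f' := fun z => -(stdPDF z * (z * p.eval z)) + stdPDF z * p.derivative.eval z)
    (fun z => by
      exact ((hasDerivAt_stdPDF z).mul (p.hasDerivAt z)).congr_deriv (by ring))
    (((integrable_gaussian_iff _).1 i1).fun_neg.fun_add ((integrable_gaussian_iff _).1 i2))
    ((integrable_gaussian_iff _).1 i3)
  rw [integral_add ((integrable_gaussian_iff _).1 i1).fun_neg ((integrable_gaussian_iff _).1 i2),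
    integral_neg] at h
  rw [integral_gaussian_eq, integral_gaussian_eq]
  linarith

/-- Orthogonality of the Hermite polynomials. -/
lemma integral_hermiteEval_mul (j k : ℕ) :
    ∫ z, hermiteEval j z * hermiteEval k z ∂(gaussianReal 0 1)
      = if j = k then (k.factorial : ℝ) else 0 := by
  -- The recurrence `H_{k+1} = z H_k - H_k'` and Stein's identity show that all Hermite polynomials
  -- of positive degree are centered; the same device lowers both indices in the induction.
  have h0 : ∀ k : ℕ, ∫ z, hermiteEval (k + 1) z ∂(gaussianReal 0 1) = 0 := by
    intro k
    set p := (Polynomial.hermite k).map (Int.castRingHom ℝ) with hp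
    have e : ∀ z, hermiteEval (k + 1) z = z * p.eval z - p.derivative.eval z := by
      intro z
      rw [hermiteEval_eq_eval, Polynomial.hermite_succ]
      simp [hp, Polynomial.derivative_map]
    simp_rw [e]
    rw [integral_sub, integral_mul_polynomial_gaussian, sub_self]
    · exact integrable_mul_polynomial_gaussianReal p 0 1
    · exact integrable_polynomial_gaussianReal _ _ _
  induction j generalizing k with
  | zero =>
    cases k with
    | zero => simp [hermiteEval_zero]
    | succ k => simp [hermiteEval_zero, h0]
  | succ j ih =>
    cases k with
    | zero => simp [hermiteEval_zero, h0]
    | succ k =>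
      set p := (Polynomial.hermite j).map (Int.castRingHom ℝ) with hp
      set q := (Polynomial.hermite (k + 1)).map (Int.castRingHom ℝ) with hq
      have hq' : ∀ z, q.derivative.eval z = (k + 1) * hermiteEval k z := by
        intro z
        rw [hq, Polynomial.derivative_map, derivative_hermite_succ, hermiteEval_eq_eval]
        simp
      have e : ∀ z, hermiteEval (j + 1) z * hermiteEval (k + 1) z
          = z * (p * q).eval z - (p.derivative * q).eval z := by
        intro z
        rw [hermiteEval_eq_eval, hermiteEval_eq_eval (k + 1), ← hq, Polynomial.hermite_succ j]
        simp only [hp, Polynomial.derivative_map, Polynomial.map_sub, Polynomial.map_mul,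
          Polynomial.map_X, Polynomial.eval_sub, Polynomial.eval_mul, Polynomial.eval_X]
        ring
      simp_rw [e]
      rw [integral_sub, integral_mul_polynomial_gaussian, ← integral_sub]
      · have e2 : ∀ z, (p * q).derivative.eval z - (p.derivative * q).eval z
            = (k + 1) * (hermiteEval j z * hermiteEval k z) := by
          intro z
          rw [Polynomial.derivative_mul]
          simp only [Polynomial.eval_add, Polynomial.eval_mul, hq']
          rw [hermiteEval_eq_eval j]
          ring
        simp_rw [e2]
        rw [integral_const_mul, ih]
        by_cases hjk : j = k
        · simp [hjk, Nat.factorial_succ]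
        · simp [hjk]
      · exact integrable_polynomial_gaussianReal _ _ _
      · exact integrable_polynomial_gaussianReal _ _ _
      · exact integrable_mul_polynomial_gaussianReal (p * q) 0 1
      · exact integrable_polynomial_gaussianReal _ _ _

/-- Addition formula for the Hermite polynomials. -/
lemma hermiteEval_add (k : ℕ) (x z : ℝ) :
    hermiteEval k (x + z)
      = ∑ j ∈ Finset.range (k + 1), (k.choose j : ℝ) * x ^ (k - j) * hermiteEval j z := by
  induction k generalizing x with
  | zero => simp [hermiteEval_zero]
  | succ k ih =>
    -- By induction the difference of the two sides has derivative `0` in `x`, and it vanishes at `x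
    -- = 0`.
    set F : ℝ → ℝ := fun x => hermiteEval (k + 1) (x + z)
      - ∑ j ∈ Finset.range (k + 2), ((k + 1).choose j : ℝ) * x ^ (k + 1 - j) * hermiteEval j z
      with hF
    have hd : ∀ y, HasDerivAt F 0 y := by
      intro y
      have h1 : HasDerivAt (fun x => hermiteEval (k + 1) (x + z))
          ((k + 1) * hermiteEval k (y + z)) y :=
        (hasDerivAt_hermiteEval_succ k (y + z)).comp_add_const y z
      have h2 : HasDerivAt (fun x : ℝ => ∑ j ∈ Finset.range (k + 2),
          ((k + 1).choose j : ℝ) * x ^ (k + 1 - j) * hermiteEval j z)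
          (∑ j ∈ Finset.range (k + 2), ((k + 1).choose j : ℝ)
            * (((k + 1 - j : ℕ) : ℝ) * y ^ (k + 1 - j - 1)) * hermiteEval j z) y := by
        refine HasDerivAt.fun_sum fun j _ => ?_
        exact ((hasDerivAt_pow _ y).const_mul _).mul_const _
      have h3 := h1.sub h2
      refine h3.congr_deriv ?_
      rw [ih, Finset.sum_range_succ _ (k + 1), Finset.mul_sum]
      simp only [tsub_self, Nat.cast_zero, zero_mul, mul_zero, add_zero]
      rw [← Finset.sum_sub_distrib]
      refine Finset.sum_eq_zero fun j hj => ?_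
      have hj' : j ≤ k := by simpa [Nat.lt_succ_iff] using hj
      have e : ((k + 1).choose j : ℝ) * ((k + 1 - j : ℕ) : ℝ) = (k + 1) * k.choose j := by
        have := Nat.choose_mul_succ_eq k j
        have : (k.choose j : ℝ) * (k + 1) = ((k + 1).choose j : ℝ) * ((k + 1 - j : ℕ) : ℝ) := by
          exact_mod_cast this
        linarith
      have e2 : k + 1 - j - 1 = k - j := by omega
      rw [e2]
      linear_combination (-(y ^ (k - j) * hermiteEval j z)) * e
    have hc : F x = F 0 := is_const_of_deriv_eq_zero (fun y => (hd y).differentiableAt)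
      (fun y => (hd y).deriv) x 0
    have h0 : F 0 = 0 := by
      simp only [hF]
      rw [Finset.sum_range_succ, Finset.sum_eq_zero]
      · simp
      · intro j hj
        have : k + 1 - j ≠ 0 := by have := Finset.mem_range.1 hj; omega
        simp [zero_pow this]
    rw [h0] at hc
    simp only [hF] at hc
    linarith

/-! ### Moments of the rescaled Hermite polynomials under `N(w, s²)` -/

lemma scaledHermite_add (k : ℕ) {s : ℝ} (hs : s ≠ 0) (w z : ℝ) :
    scaledHermite k s (w + s * z)
      = ∑ j ∈ Finset.range (k + 1), ((k.choose j : ℝ) * w ^ (k - j) * s ^ j) * hermiteEval j z := by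
  rw [scaledHermite, if_neg hs, add_div, mul_div_cancel_left₀ _ hs, hermiteEval_add,
    Finset.mul_sum]
  refine Finset.sum_congr rfl fun j hj => ?_
  have hj' : j ≤ k := by simpa [Nat.lt_succ_iff] using hj
  have e : s ^ k = s ^ (k - j) * s ^ j := by rw [← pow_add, Nat.sub_add_cancel hj']
  rw [e, div_pow]
  field_simp

lemma continuous_scaledHermite (k : ℕ) (s : ℝ) : Continuous (scaledHermite k s) := by
  unfold scaledHermite
  split_ifs
  · fun_prop
  · exact continuous_const.mul ((continuous_hermiteEval k).comp (continuous_id.div_const s))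

lemma integrable_hermiteEval (k : ℕ) : Integrable (hermiteEval k) (gaussianReal 0 1) := by
  simpa [hermiteEval_zero] using integrable_hermiteEval_mul k 0

lemma integral_hermiteEval (k : ℕ) :
    ∫ z, hermiteEval k z ∂(gaussianReal 0 1) = if k = 0 then 1 else 0 := by
  simpa [hermiteEval_zero] using integral_hermiteEval_mul k 0

lemma integrable_scaledHermite (k : ℕ) {s : ℝ} (hs : s ≠ 0) (w : ℝ) :
    Integrable (fun z => scaledHermite k s (w + s * z)) (gaussianReal 0 1) := by
  simp_rw [scaledHermite_add k hs]
  exact integrable_finsetSum _ fun j _ => (integrable_hermiteEval j).const_mul _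

/-- In the addition formula only the term with `H_0` has nonzero mean. This is what makes the
estimate of the Taylor polynomial unbiased. -/
lemma integral_scaledHermite (k : ℕ) {s : ℝ} (hs : s ≠ 0) (w : ℝ) :
    ∫ z, scaledHermite k s (w + s * z) ∂(gaussianReal 0 1) = w ^ k := by
  simp_rw [scaledHermite_add k hs]
  rw [integral_finsetSum _ fun j _ => (integrable_hermiteEval j).const_mul _]
  simp_rw [integral_const_mul, integral_hermiteEval]
  simp

lemma integrable_scaledHermite_sq (k : ℕ) {s : ℝ} (hs : s ≠ 0) (w : ℝ) :
    Integrable (fun z => scaledHermite k s (w + s * z) ^ 2) (gaussianReal 0 1) := by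
  simp_rw [scaledHermite_add k hs, sq (Finset.sum _ _), Finset.sum_mul_sum,
    mul_mul_mul_comm _ (hermiteEval _ _)]
  exact integrable_finsetSum _ fun j _ => integrable_finsetSum _ fun l _ =>
    (integrable_hermiteEval_mul j l).const_mul _

/-- Orthogonality leaves the terms `(k choose j)² j! w^(2(k-j)) s^(2j)`; since `(k choose j) j! ≤
k^j`, the binomial theorem sums them. -/
lemma integral_scaledHermite_sq_le (k : ℕ) {s : ℝ} (hs : s ≠ 0) (w : ℝ) :
    ∫ z, scaledHermite k s (w + s * z) ^ 2 ∂(gaussianReal 0 1) ≤ (k * s ^ 2 + w ^ 2) ^ k := by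
  simp_rw [scaledHermite_add k hs, sq (Finset.sum _ _), Finset.sum_mul_sum,
    mul_mul_mul_comm _ (hermiteEval _ _)]
  rw [integral_finsetSum _ fun j _ => integrable_finsetSum _ fun l _ =>
    (integrable_hermiteEval_mul j l).const_mul _]
  rw [add_pow]
  refine Finset.sum_le_sum fun j hj => ?_
  rw [integral_finsetSum _ fun l _ => (integrable_hermiteEval_mul j l).const_mul _]
  simp_rw [integral_const_mul, integral_hermiteEval_mul]
  simp only [mul_ite, mul_zero, Finset.sum_ite_eq, hj, if_true]
  have hd : ((k.choose j : ℝ) * j.factorial) ≤ (k : ℝ) ^ j := by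
    have := Nat.descFactorial_le_pow k j
    rw [Nat.descFactorial_eq_factorial_mul_choose, mul_comm] at this
    exact_mod_cast this
  have hw : 0 ≤ (w ^ 2) ^ (k - j) := by positivity
  have hs2 : 0 ≤ (s ^ 2) ^ j := by positivity
  have hc : (0 : ℝ) ≤ k.choose j := Nat.cast_nonneg _
  calc (k.choose j : ℝ) * w ^ (k - j) * s ^ j * (k.choose j * w ^ (k - j) * s ^ j) * j.factorial
      = (k.choose j * j.factorial) * ((s ^ 2) ^ j * (w ^ 2) ^ (k - j) * k.choose j) := by
        rw [← pow_mul, ← pow_mul, mul_comm 2, mul_comm 2, pow_mul, pow_mul]; ring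
    _ ≤ (k : ℝ) ^ j * ((s ^ 2) ^ j * (w ^ 2) ^ (k - j) * k.choose j) := by gcongr
    _ = (k * s ^ 2) ^ j * (w ^ 2) ^ (k - j) * k.choose j := by rw [mul_pow]; ring

/-! ### The Taylor polynomial of `G` -/

/-- The Taylor coefficient of order `k` of `φ / φ(0)` at `0`. -/
noncomputable def gaussCoeff (k : ℕ) : ℝ := (-1) ^ k * hermiteEval k 0 / (k.factorial : ℝ)

lemma gaussCoeff_add_two (k : ℕ) : gaussCoeff (k + 2) = -gaussCoeff k / (k + 2) := by
  have h1 : (k.factorial : ℝ) ≠ 0 := by positivity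
  have h2 : (k : ℝ) + 1 ≠ 0 := by positivity
  have h3 : (k : ℝ) + 2 ≠ 0 := by positivity
  rw [gaussCoeff, gaussCoeff, hermiteEval_add_two, Nat.factorial_succ, Nat.factorial_succ, pow_add]
  push_cast
  rw [show (k : ℝ) + 1 + 1 = k + 2 by ring]
  field_simp
  ring

lemma gaussCoeff_even (j : ℕ) : gaussCoeff (2 * j) = (-1 / 2) ^ j / (j.factorial : ℝ) := by
  induction j with
  | zero => simp [gaussCoeff, hermiteEval_zero]
  | succ j ih =>
    have h1 : (j.factorial : ℝ) ≠ 0 := by positivity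
    have h2 : (j : ℝ) + 1 ≠ 0 := by positivity
    rw [mul_add, mul_one, gaussCoeff_add_two, ih, Nat.factorial_succ, pow_succ]
    push_cast
    rw [show 2 * (j : ℝ) + 2 = 2 * (j + 1) by ring]
    field_simp

lemma gaussCoeff_odd (j : ℕ) : gaussCoeff (2 * j + 1) = 0 := by
  induction j with
  | zero => simp [gaussCoeff, hermiteEval_one]
  | succ j ih =>
    rw [show 2 * (j + 1) + 1 = 2 * j + 1 + 2 by ring, gaussCoeff_add_two, ih]
    simp

/-- Odd coefficients vanish and even ones are those of `exp (-x²/2)`. There are `(N + 1) / 2` even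
indices below `N`. -/
lemma sum_gaussCoeff (N : ℕ) (x : ℝ) :
    ∑ k ∈ Finset.range N, gaussCoeff k * x ^ k
      = ∑ j ∈ Finset.range ((N + 1) / 2), (-x ^ 2 / 2) ^ j / (j.factorial : ℝ) := by
  induction N using Nat.twoStepInduction with
  | zero => simp
  | one => simp [gaussCoeff, hermiteEval_zero]
  | more N ih _ =>
    have e : (N + 2 + 1) / 2 = (N + 1) / 2 + 1 := by omega
    have key : ∀ j : ℕ, gaussCoeff (2 * j) * x ^ (2 * j)
        = (-x ^ 2 / 2) ^ j / (j.factorial : ℝ) := by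
      intro j
      rw [gaussCoeff_even, pow_mul, div_mul_eq_mul_div, ← mul_pow]
      congr 2
      ring
    rw [e, Finset.sum_range_succ, Finset.sum_range_succ, ih, Finset.sum_range_succ, add_assoc]
    congr 1
    rcases Nat.even_or_odd' N with ⟨j, rfl | rfl⟩
    · rw [gaussCoeff_odd, key, show (2 * j + 1) / 2 = j by omega]
      ring
    · rw [gaussCoeff_odd, show 2 * j + 1 + 1 = 2 * (j + 1) by ring, key,
        show 2 * (j + 1) / 2 = j + 1 by omega]
      ring

/-- Termwise comparison of the tail series, using `(j + m)! ≥ j! m!`. -/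
lemma exp_sub_sum_le {y : ℝ} (hy : 0 ≤ y) (m : ℕ) :
    Real.exp y - ∑ j ∈ Finset.range m, y ^ j / (j.factorial : ℝ)
      ≤ y ^ m / (m.factorial : ℝ) * Real.exp y := by
  have hs : HasSum (fun n : ℕ => y ^ n / (n.factorial : ℝ)) (Real.exp y) := by
    rw [Real.exp_eq_exp_ℝ]
    exact NormedSpace.expSeries_div_hasSum_exp y
  refine hasSum_le (fun j => ?_) ((hasSum_nat_add_iff' m).2 hs) (hs.mul_left _)
  have h : ((j.factorial : ℝ) * m.factorial) ≤ (j + m).factorial := by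
    exact_mod_cast Nat.le_of_dvd (Nat.factorial_pos _) (Nat.factorial_mul_factorial_dvd_factorial_add j m)
  rw [div_mul_div_comm, ← pow_add, add_comm m j, mul_comm (m.factorial : ℝ)]
  gcongr

lemma abs_exp_sub_sum_le (x : ℝ) (m : ℕ) :
    |Real.exp x - ∑ j ∈ Finset.range m, x ^ j / (j.factorial : ℝ)|
      ≤ |x| ^ m / (m.factorial : ℝ) * Real.exp |x| := by
  have h := Complex.norm_exp_sub_sum_le_exp_norm_sub_sum (x : ℂ) m
  have e : Complex.exp x - ∑ j ∈ Finset.range m, (x : ℂ) ^ j / (j.factorial : ℂ)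
      = ((Real.exp x - ∑ j ∈ Finset.range m, x ^ j / (j.factorial : ℝ) : ℝ) : ℂ) := by
    push_cast; rfl
  rw [e, Complex.norm_real, Complex.norm_real] at h
  exact h.trans (exp_sub_sum_le (abs_nonneg x) m)

/-- The Taylor polynomial of order `N + 1` of `G(·, β)` at `0`. -/
noncomputable def taylorG (β : ℝ) (N : ℕ) (w : ℝ) : ℝ :=
  G 0 β + derivG0 β * w + stdPDF 0 * ∑ k ∈ Finset.range N,
    ((-1) ^ k * hermiteEval k 0 / ((k + 2).factorial : ℝ)) * w ^ (k + 2)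

/-- The mean value inequality twice; the factor `1/2` of Taylor's formula is not needed. -/
lemma abs_le_of_abs_second_deriv_le {f f' f'' : ℝ → ℝ} {a ε : ℝ} (ha : 0 ≤ a) (hε : 0 ≤ ε)
    (h0 : f 0 = 0) (h0' : f' 0 = 0) (hf : ∀ x, HasDerivAt f (f' x) x)
    (hf' : ∀ x, HasDerivAt f' (f'' x) x) (hb : ∀ x, |x| ≤ a → |f'' x| ≤ ε) {w : ℝ}
    (hw : |w| ≤ a) : |f w| ≤ ε * a ^ 2 := by
  have hz : (0 : ℝ) ∈ Set.Icc (-a) a := ⟨by linarith, ha⟩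
  have h1 : ∀ x, |x| ≤ a → |f' x| ≤ ε * a := by
    intro x hx
    have := (convex_Icc (-a) a).norm_image_sub_le_of_norm_hasDerivWithin_le
      (f := f') (f' := f'') (C := ε) (fun y _ => (hf' y).hasDerivWithinAt)
      (fun y hy => hb y (abs_le.2 hy)) hz (abs_le.1 hx)
    rw [h0', sub_zero, sub_zero, Real.norm_eq_abs, Real.norm_eq_abs] at this
    exact this.trans (mul_le_mul_of_nonneg_left hx hε)
  have := (convex_Icc (-a) a).norm_image_sub_le_of_norm_hasDerivWithin_le
      (f := f) (f' := f') (C := ε * a) (fun y _ => (hf y).hasDerivWithinAt)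
      (fun y hy => h1 y (abs_le.2 hy)) hz (abs_le.1 hw)
  rw [h0, sub_zero, sub_zero, Real.norm_eq_abs, Real.norm_eq_abs] at this
  refine this.trans ?_
  rw [sq, ← mul_assoc]
  exact mul_le_mul_of_nonneg_left hw (mul_nonneg hε ha)

/-- The second derivative of `G(·, β)` is `φ`, so the second derivative of the error is `φ(0)` times
the remainder of the exponential series at `-x²/2`. -/
lemma abs_G_sub_taylorG_le_aux (β : ℝ) (N : ℕ) {w a : ℝ} (hw : |w| ≤ a) :
    |G w β - taylorG β N w|
      ≤ ((a ^ 2 / 2) ^ ((N + 1) / 2) / (((N + 1) / 2).factorial : ℝ) * Real.exp (a ^ 2 / 2))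
        * a ^ 2 := by
  have ha : 0 ≤ a := (abs_nonneg w).trans hw
  refine abs_le_of_abs_second_deriv_le (f := fun w => G w β - taylorG β N w)
    (f' := fun x => stdCDF x - β - (derivG0 β + stdPDF 0 * ∑ k ∈ Finset.range N,
      ((-1) ^ k * hermiteEval k 0 / ((k + 1).factorial : ℝ)) * x ^ (k + 1)))
    (f'' := fun x => stdPDF x - stdPDF 0 * ∑ k ∈ Finset.range N, gaussCoeff k * x ^ k)
    ha (by positivity) (by simp [taylorG]) (by simp [derivG0_eq]) ?_ ?_ ?_ hw
  · intro x
    refine (hasDerivAt_G x β).sub ?_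
    unfold taylorG
    have h1 : HasDerivAt (fun w : ℝ => ∑ k ∈ Finset.range N,
        ((-1) ^ k * hermiteEval k 0 / ((k + 2).factorial : ℝ)) * w ^ (k + 2))
        (∑ k ∈ Finset.range N,
          ((-1) ^ k * hermiteEval k 0 / ((k + 1).factorial : ℝ)) * x ^ (k + 1)) x := by
      refine HasDerivAt.fun_sum fun k _ => ?_
      refine ((hasDerivAt_pow (k + 2) x).const_mul _).congr_deriv ?_
      have h1 : ((k + 1).factorial : ℝ) ≠ 0 := by positivity
      have h2 : (k : ℝ) + 2 ≠ 0 := by positivity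
      rw [Nat.factorial_succ (k + 1)]
      push_cast
      rw [show (k : ℝ) + 1 + 1 = k + 2 by ring]
      field_simp
    have h2 := (((hasDerivAt_id' x).const_mul (derivG0 β)).const_add (G 0 β)).add
      (h1.const_mul (stdPDF 0))
    rw [mul_one] at h2
    exact h2
  · intro x
    refine ((hasDerivAt_stdCDF x).sub_const β).sub ?_
    refine (HasDerivAt.const_mul (stdPDF 0) (HasDerivAt.fun_sum fun k _ => ?_)).const_add _
    refine ((hasDerivAt_pow (k + 1) x).const_mul _).congr_deriv ?_
    have h1 : (k.factorial : ℝ) ≠ 0 := by positivity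
    have h2 : (k : ℝ) + 1 ≠ 0 := by positivity
    rw [Nat.factorial_succ, gaussCoeff]
    push_cast
    field_simp
  · intro x hx
    have e : stdPDF x = stdPDF 0 * Real.exp (-x ^ 2 / 2) := by
      rw [stdPDF_eq, stdPDF_eq]; simp
    rw [e, sum_gaussCoeff, ← mul_sub, abs_mul, abs_of_pos (stdPDF_pos 0)]
    have h1 := abs_exp_sub_sum_le (-x ^ 2 / 2) ((N + 1) / 2)
    have h2 : |-x ^ 2 / 2| ≤ a ^ 2 / 2 := by
      rw [neg_div, abs_neg, abs_of_nonneg (by positivity), ← sq_abs x]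
      gcongr
    have h3 := stdPDF_le_half 0
    have h4 := (stdPDF_pos 0).le
    calc stdPDF 0 * _ ≤ 1 * |Real.exp (-x ^ 2 / 2) - ∑ j ∈ Finset.range ((N + 1) / 2),
          (-x ^ 2 / 2) ^ j / (j.factorial : ℝ)| := by gcongr; linarith
      _ ≤ _ := by
        rw [one_mul]
        refine h1.trans ?_
        gcongr

/-- From `m^m / m! ≤ e^m` and `y ≤ m / e²` the quotient `y^m / m!` is at most `e^(-m)`, and `m ≥ e²
y ≥ 4 y`. -/
lemma pow_div_factorial_mul_exp_le {y : ℝ} (hy : 0 < y) {m : ℕ}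
    (hm : Real.exp 1 ^ 2 * y ≤ m) : y ^ m / (m.factorial : ℝ) * Real.exp y ≤ Real.exp (-3 * y) := by
  have h1 : y ≤ m / Real.exp 1 ^ 2 := by
    rw [le_div_iff₀ (by positivity)]; linarith
  have h2 := Real.pow_div_factorial_le_exp (m : ℝ) (Nat.cast_nonneg m) m
  have h3 : y ^ m / (m.factorial : ℝ) ≤ Real.exp (-m) := by
    calc y ^ m / (m.factorial : ℝ) ≤ ((m : ℝ) / Real.exp 1 ^ 2) ^ m / (m.factorial : ℝ) := by gcongr
      _ = (m : ℝ) ^ m / (m.factorial : ℝ) * Real.exp (-2 * m) := by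
        rw [div_pow, ← Real.exp_nat_mul, ← Real.exp_nat_mul, neg_mul, Real.exp_neg]
        push_cast
        rw [mul_one, mul_comm (m : ℝ) 2]
        field_simp
      _ ≤ Real.exp m * Real.exp (-2 * m) := by gcongr
      _ = Real.exp (-m) := by rw [← Real.exp_add]; congr 1; ring
  have h4 : (4 : ℝ) ≤ Real.exp 1 ^ 2 := by
    have := Real.add_one_le_exp (1 : ℝ); nlinarith
  calc y ^ m / (m.factorial : ℝ) * Real.exp y ≤ Real.exp (-m) * Real.exp y := by gcongr
    _ = Real.exp (-m + y) := (Real.exp_add _ _).symm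
    _ ≤ Real.exp (-3 * y) := Real.exp_le_exp.2 (by nlinarith)

/-- The Taylor polynomial is accurate on `[-a, a]` once its order exceeds `e² a²`. -/
lemma abs_G_sub_taylorG_le (β : ℝ) (N : ℕ) {w a : ℝ} (ha : 0 < a) (hw : |w| ≤ a)
    (hN : Real.exp 1 ^ 2 * a ^ 2 ≤ N) : |G w β - taylorG β N w| ≤ 4 / a ^ 2 := by
  refine (abs_G_sub_taylorG_le_aux β N hw).trans ?_
  -- `N` coefficients contain `⌈N/2⌉` even ones, which matches the variable `a²/2` of the
  -- exponential series.
  have hm : Real.exp 1 ^ 2 * (a ^ 2 / 2) ≤ ((N + 1) / 2 : ℕ) := by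
    have : N ≤ 2 * ((N + 1) / 2) := by omega
    have : (N : ℝ) ≤ 2 * ((N + 1) / 2 : ℕ) := by exact_mod_cast this
    linarith
  have h1 := pow_div_factorial_mul_exp_le (y := a ^ 2 / 2) (by positivity) hm
  have h2 := Real.quadratic_le_exp_of_nonneg (x := 3 * (a ^ 2 / 2)) (by positivity)
  have h3 : Real.exp (-3 * (a ^ 2 / 2)) * a ^ 2 ≤ 4 / a ^ 2 := by
    rw [neg_mul, Real.exp_neg, inv_mul_eq_div, div_le_div_iff₀ (by positivity) (by positivity)]
    nlinarith [sq_nonneg (a ^ 2)]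
  refine le_trans ?_ h3
  gcongr

/-! ### The unbiased estimate of the Taylor polynomial -/

/-- The polynomial in `u` whose mean under `N(w, s²)` is the Taylor polynomial of `G(·, β)`. -/
noncomputable def hermiteEst (β : ℝ) (N : ℕ) (s u : ℝ) : ℝ :=
  G 0 β + derivG0 β * u + stdPDF 0 * ∑ k ∈ Finset.range N,
    ((-1) ^ k * hermiteEval k 0 / ((k + 2).factorial : ℝ)) * scaledHermite (k + 2) s u

lemma continuous_hermiteEst (β : ℝ) (N : ℕ) (s : ℝ) : Continuous (hermiteEst β N s) := by
  unfold hermiteEst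
  have := fun k => continuous_scaledHermite k s
  fun_prop

lemma integrable_linear_gaussian (a b : ℝ) :
    Integrable (fun z : ℝ => a + b * z) (gaussianReal 0 1) := by
  have := (integrable_pow_gaussianReal 0 1 1).const_mul b
  simp only [pow_one] at this
  exact (integrable_const a).add this

lemma integral_linear_gaussian (a b : ℝ) : ∫ z, (a + b * z) ∂(gaussianReal 0 1) = a := by
  have := (integrable_pow_gaussianReal 0 1 1).const_mul b
  simp only [pow_one] at this
  rw [integral_add (integrable_const a) this, integral_const_mul, integral_id_gaussianReal]
  simp

lemma integrable_linear_sq_gaussian (a b : ℝ) :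
    Integrable (fun z : ℝ => (a + b * z) ^ 2) (gaussianReal 0 1) := by
  have e : (fun z : ℝ => (a + b * z) ^ 2) = fun z => (a ^ 2 + 2 * a * b * z) + b ^ 2 * z ^ 2 := by
    funext z; ring
  rw [e]
  exact (integrable_linear_gaussian _ _).add ((integrable_pow_gaussianReal 0 1 2).const_mul _)

lemma integral_linear_sq_gaussian (a b : ℝ) :
    ∫ z, (a + b * z) ^ 2 ∂(gaussianReal 0 1) = a ^ 2 + b ^ 2 := by
  have e : (fun z : ℝ => (a + b * z) ^ 2) = fun z => (a ^ 2 + 2 * a * b * z) + b ^ 2 * z ^ 2 := by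
    funext z; ring
  rw [e, integral_add (integrable_linear_gaussian _ _)
    ((integrable_pow_gaussianReal 0 1 2).const_mul _), integral_linear_gaussian,
    integral_const_mul, integral_sq_gaussian, mul_one]

lemma integrable_hermiteEst (β : ℝ) (N : ℕ) {s : ℝ} (hs : s ≠ 0) (w : ℝ) :
    Integrable (fun z => hermiteEst β N s (w + s * z)) (gaussianReal 0 1) := by
  unfold hermiteEst
  refine ((integrable_const _).add ((integrable_linear_gaussian w s).const_mul _)).add
    ((integrable_finsetSum _ fun k _ => ?_).const_mul _)
  exact (integrable_scaledHermite (k + 2) hs w).const_mul _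

lemma integral_hermiteEst (β : ℝ) (N : ℕ) {s : ℝ} (hs : s ≠ 0) (w : ℝ) :
    ∫ z, hermiteEst β N s (w + s * z) ∂(gaussianReal 0 1) = taylorG β N w := by
  unfold hermiteEst taylorG
  have hi : ∀ k ∈ Finset.range N, Integrable (fun z =>
      ((-1) ^ k * hermiteEval k 0 / ((k + 2).factorial : ℝ))
        * scaledHermite (k + 2) s (w + s * z)) (gaussianReal 0 1) := fun k _ =>
    (integrable_scaledHermite (k + 2) hs w).const_mul _
  have h2 := (integrable_linear_gaussian w s).const_mul (derivG0 β)
  rw [integral_add ((integrable_const _).fun_add h2) ((integrable_finsetSum _ hi).const_mul _),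
    integral_add (integrable_const _) h2, integral_const_mul, integral_const_mul,
    integral_finsetSum _ hi, integral_linear_gaussian]
  simp_rw [integral_const_mul, integral_scaledHermite _ hs]
  simp

lemma memLp_scaledHermite (k : ℕ) {s : ℝ} (hs : s ≠ 0) (w : ℝ) :
    MemLp (fun z => scaledHermite k s (w + s * z)) 2 (gaussianReal 0 1) := by
  have hc : Continuous fun z => scaledHermite k s (w + s * z) :=
    (continuous_scaledHermite k s).comp (by fun_prop)
  exact (memLp_two_iff_integrable_sq hc.aestronglyMeasurable).2
      (integrable_scaledHermite_sq k hs w)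

lemma memLp_linear_gaussian (a b : ℝ) :
    MemLp (fun z : ℝ => a + b * z) 2 (gaussianReal 0 1) :=
  (memLp_two_iff_integrable_sq (by fun_prop)).2 (integrable_linear_sq_gaussian a b)

lemma memLp_hermiteEst (β : ℝ) (N : ℕ) {s : ℝ} (hs : s ≠ 0) (w : ℝ) :
    MemLp (fun z => hermiteEst β N s (w + s * z)) 2 (gaussianReal 0 1) := by
  unfold hermiteEst
  generalize derivG0 β = d
  generalize G 0 β = g
  generalize stdPDF 0 = p
  have h1 : MemLp (fun z => g + d * (w + s * z)) 2 (gaussianReal 0 1) :=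
    (memLp_const g).add ((memLp_linear_gaussian w s).const_mul d)
  have h2 : MemLp (fun z => ∑ k ∈ Finset.range N,
      ((-1) ^ k * hermiteEval k 0 / ((k + 2).factorial : ℝ))
        * scaledHermite (k + 2) s (w + s * z)) 2 (gaussianReal 0 1) :=
    memLp_finsetSum (Finset.range N) fun k _ => (memLp_scaledHermite (k + 2) hs w).const_mul _
  exact h1.add (h2.const_mul p)

lemma integrable_hermiteEst_sq (β : ℝ) (N : ℕ) {s : ℝ} (hs : s ≠ 0) (w : ℝ) :
    Integrable (fun z => hermiteEst β N s (w + s * z) ^ 2) (gaussianReal 0 1) :=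
  (memLp_hermiteEst β N hs w).integrable_sq

/-- The inequality `e^t ≥ 1 + t` at `t = y/2 - 3/4`, multiplied by `e^(3/4) ≥ 1 + 3/4 + 9/32 ≥ 2`.
-/
lemma half_add_le_exp (y : ℝ) : 1 / 2 + y ≤ Real.exp (y / 2) := by
  have h1 := Real.add_one_le_exp ((1 / 2 + y) / 2 - 1)
  have h2 := Real.quadratic_le_exp_of_nonneg (x := (3 / 4 : ℝ)) (by norm_num)
  have h3 : Real.exp (y / 2) = Real.exp ((1 / 2 + y) / 2 - 1) * Real.exp (3 / 4) := by
    rw [← Real.exp_add]; congr 1; ring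
  rw [h3]
  nlinarith [Real.exp_pos ((1 / 2 + y) / 2 - 1)]

/-- After `k^k / k! ≤ e^k` the quantity is at most `(1/2 + L/k)^k`. The constant `1/2` in the
hypothesis on `s` gives `L/2` in the exponent: for `L = log n` the bound is `√n`, which division by
`n` can absorb. -/
lemma pow_div_factorial_le_exp_half {k : ℕ} (hk : 0 < k) {s w L : ℝ}
    (hs : Real.exp 1 * s ^ 2 ≤ 1 / 2) (hw : Real.exp 1 * w ^ 2 ≤ L) :
    (k * s ^ 2 + w ^ 2) ^ k / (k.factorial : ℝ) ≤ Real.exp (L / 2) := by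
  have hk' : (0 : ℝ) < k := Nat.cast_pos.2 hk
  have h1 := Real.pow_div_factorial_le_exp (k : ℝ) hk'.le k
  have h2 : (k * s ^ 2 + w ^ 2) ^ k / (k.factorial : ℝ)
      = ((s ^ 2 + w ^ 2 / k)) ^ k * ((k : ℝ) ^ k / k.factorial) := by
    rw [mul_div_assoc', ← mul_pow]
    congr 2
    field_simp
  rw [h2]
  calc (s ^ 2 + w ^ 2 / k) ^ k * ((k : ℝ) ^ k / k.factorial)
      ≤ (s ^ 2 + w ^ 2 / k) ^ k * Real.exp k := by gcongr
    _ = (Real.exp 1 * s ^ 2 + Real.exp 1 * w ^ 2 / k) ^ k := by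
        rw [← mul_one (k : ℝ), Real.exp_nat_mul, ← mul_pow, mul_one]
        congr 1
        ring
    _ ≤ (1 / 2 + L / k) ^ k := by gcongr
    _ ≤ (Real.exp (L / k / 2)) ^ k := by
        have h0 : 0 ≤ L := le_trans (by positivity) hw
        gcongr
        exact half_add_le_exp _
    _ = Real.exp (L / 2) := by
        rw [← Real.exp_nat_mul]
        congr 1
        field_simp

lemma abs_derivG0_le {β : ℝ} (h0 : 0 ≤ β) (h1 : β ≤ 1) : |derivG0 β| ≤ 1 := by
  rw [derivG0_eq, abs_le]
  constructor <;> linarith [stdCDF_nonneg 0, stdCDF_le_one 0]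

/-- The squared coefficients are at most `1/(k+2)!`, so every term contributes at most `exp (L/2)`.
One factor `N` counts the terms, the other comes from the Cauchy–Schwarz inequality. -/
lemma integral_hermiteEst_sq_le {β : ℝ} (h0 : 0 ≤ β) (h1 : β ≤ 1) (N : ℕ) {s w L : ℝ}
    (hs0 : s ≠ 0) (hs : Real.exp 1 * s ^ 2 ≤ 1 / 2) (hw : Real.exp 1 * w ^ 2 ≤ L) :
    ∫ z, hermiteEst β N s (w + s * z) ^ 2 ∂(gaussianReal 0 1)
      ≤ 3 * (1 + (w ^ 2 + s ^ 2) + N ^ 2 * Real.exp (L / 2)) := by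
  set c : ℕ → ℝ := fun k => (-1) ^ k * hermiteEval k 0 / ((k + 2).factorial : ℝ) with hc
  have hi : ∀ k, Integrable (fun z => c k ^ 2 * scaledHermite (k + 2) s (w + s * z) ^ 2)
      (gaussianReal 0 1) := fun k => (integrable_scaledHermite_sq (k + 2) hs0 w).const_mul _
  have hpt : ∀ z, hermiteEst β N s (w + s * z) ^ 2 ≤ 3 * (1 + (w + s * z) ^ 2
      + N * ∑ k ∈ Finset.range N, c k ^ 2 * scaledHermite (k + 2) s (w + s * z) ^ 2) := by
    intro z
    set u := w + s * z
    set q := ∑ k ∈ Finset.range N, c k * scaledHermite (k + 2) s u with hq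
    have e : hermiteEst β N s u = G 0 β + derivG0 β * u + stdPDF 0 * q := rfl
    have hG : (G 0 β) ^ 2 ≤ 1 := by
      have := abs_G_le 0 β h0 h1
      rw [abs_zero, zero_add] at this
      rw [← sq_abs]
      exact pow_le_one₀ (abs_nonneg _) this
    have hd : (derivG0 β * u) ^ 2 ≤ u ^ 2 := by
      have := abs_derivG0_le h0 h1
      rw [mul_pow]
      have h2 : derivG0 β ^ 2 ≤ 1 := by
        rw [← sq_abs]; exact pow_le_one₀ (abs_nonneg _) this
      nlinarith [sq_nonneg u]
    have hp : (stdPDF 0 * q) ^ 2 ≤ q ^ 2 := by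
      have := stdPDF_zero_le
      have h3 := (stdPDF_pos 0).le
      rw [mul_pow]
      have h2 : stdPDF 0 ^ 2 ≤ 1 := pow_le_one₀ h3 (by linarith)
      nlinarith [sq_nonneg q]
    have hcs : q ^ 2 ≤ N * ∑ k ∈ Finset.range N, c k ^ 2 * scaledHermite (k + 2) s u ^ 2 := by
      have := sq_sum_le_card_mul_sum_sq (s := Finset.range N)
        (f := fun k => c k * scaledHermite (k + 2) s u)
      rw [Finset.card_range] at this
      simpa only [mul_pow] using this
    rw [e]
    nlinarith [sq_nonneg (G 0 β - derivG0 β * u), sq_nonneg (G 0 β - stdPDF 0 * q),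
      sq_nonneg (derivG0 β * u - stdPDF 0 * q)]
  have hsum := integrable_finsetSum (Finset.range N) fun k _ => hi k
  have hlin : Integrable (fun z => 1 + (w + s * z) ^ 2) (gaussianReal 0 1) :=
    (integrable_const (1 : ℝ)).add (integrable_linear_sq_gaussian w s)
  refine (integral_mono (integrable_hermiteEst_sq β N hs0 w)
    ((hlin.add (hsum.const_mul (N : ℝ))).const_mul 3) hpt).trans ?_
  simp only [Pi.add_apply]
  rw [integral_const_mul, integral_add hlin (hsum.const_mul (N : ℝ)),
    integral_add (integrable_const _) (integrable_linear_sq_gaussian w s),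
    integral_linear_sq_gaussian, integral_const_mul, integral_finsetSum _ fun k _ => hi k]
  have hterm : ∀ k ∈ Finset.range N, ∫ z, c k ^ 2 * scaledHermite (k + 2) s (w + s * z) ^ 2
      ∂(gaussianReal 0 1) ≤ Real.exp (L / 2) := by
    intro k _
    rw [integral_const_mul]
    have h2 := integral_scaledHermite_sq_le (k + 2) hs0 w
    have h3 := pow_div_factorial_le_exp_half (k := k + 2) (by omega) hs hw
    have h4 : c k ^ 2 ≤ 1 / ((k + 2).factorial : ℝ) := by
      have hf : (0 : ℝ) < ((k + 2).factorial : ℝ) := by positivity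
      rw [hc]
      simp only
      rw [div_pow, mul_pow, ← pow_mul, mul_comm k 2, pow_mul, neg_one_sq, one_pow, one_mul,
        div_le_div_iff₀ (by positivity) hf, one_mul, sq ((k + 2).factorial : ℝ)]
      refine mul_le_mul_of_nonneg_right ((hermiteEval_zero_sq_le k).trans ?_) hf.le
      exact_mod_cast Nat.factorial_le (by omega)
    calc c k ^ 2 * _ ≤ 1 / ((k + 2).factorial : ℝ)
          * (((k + 2 : ℕ) : ℝ) * s ^ 2 + w ^ 2) ^ (k + 2) := by
          refine mul_le_mul h4 h2 (integral_nonneg fun z => sq_nonneg _) (by positivity)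
      _ ≤ _ := by rw [one_div, inv_mul_eq_div]; exact h3
  have := Finset.sum_le_card_nsmul _ _ _ hterm
  rw [Finset.card_range, nsmul_eq_mul] at this
  have hN : (0 : ℝ) ≤ N := Nat.cast_nonneg N
  simp only [integral_const, probReal_univ, smul_eq_mul, one_mul]
  nlinarith [mul_le_mul_of_nonneg_left this hN]

/-! ### Truncation -/

/-- Truncation to `[-n, n]`. -/
noncomputable def clip (n : ℕ) (u : ℝ) : ℝ := max (-(n : ℝ)) (min u n)

lemma abs_clip_le (n : ℕ) (u : ℝ) : |clip n u| ≤ n := by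
  have hn : (0 : ℝ) ≤ n := Nat.cast_nonneg n
  rw [clip, abs_le]
  exact ⟨le_max_left _ _, max_le (by linarith) (min_le_right _ _)⟩

lemma clip_sq_le (n : ℕ) (u : ℝ) : clip n u ^ 2 ≤ u ^ 2 := by
  have hn : (0 : ℝ) ≤ n := Nat.cast_nonneg n
  rw [sq_le_sq, clip]
  rcases le_total u n with h | h
  · rw [min_eq_left h]
    rcases le_total (-(n : ℝ)) u with h' | h'
    · rw [max_eq_right h']
    · rw [max_eq_left h', abs_neg, abs_of_nonneg hn, abs_of_nonpos (by linarith)]; linarith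
  · rw [min_eq_right h, max_eq_right (by linarith), abs_of_nonneg hn, abs_of_nonneg (by linarith)]
    exact h

/-- Truncation acts only where `|u| > n`, and there `|u| ≤ u²/n`. Thus a second moment of order
`o(n)` makes the bias due to truncation negligible. -/
lemma abs_clip_sub_le {n : ℕ} (hn : 0 < n) (u : ℝ) : |clip n u - u| ≤ u ^ 2 / n := by
  have hn' : (0 : ℝ) < n := Nat.cast_pos.2 hn
  rw [le_div_iff₀ hn', clip]
  rcases le_total u n with h | h
  · rw [min_eq_left h]
    rcases le_total (-(n : ℝ)) u with h' | h'
    · rw [max_eq_right h', sub_self, abs_zero, zero_mul]; positivity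
    · rw [max_eq_left h', abs_of_nonneg (by linarith)]; nlinarith
  · rw [min_eq_right h, max_eq_right (by linarith), abs_of_nonpos (by linarith)]; nlinarith

lemma continuous_clip (n : ℕ) : Continuous (clip n) := by unfold clip; fun_prop

/-! ### The randomized threshold estimate of `G(w, β)` -/

/-- The threshold estimate: `v` selects the regime, `u` is used for the estimate. -/
noncomputable def threshEst (β : ℝ) (N : ℕ) (s l : ℝ) (n : ℕ) (u v : ℝ) : ℝ :=
  if v < -l then -β * u else if v ≤ l then clip n (hermiteEst β N s u) else (1 - β) * u

lemma measurable_threshEst (β : ℝ) (N : ℕ) (s l : ℝ) (n : ℕ) :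
    Measurable fun p : ℝ × ℝ => threshEst β N s l n p.1 p.2 := by
  unfold threshEst
  have hc : Continuous fun u => clip n (hermiteEst β N s u) :=
    (continuous_clip n).comp (continuous_hermiteEst β N s)
  refine Measurable.ite (measurableSet_lt measurable_snd measurable_const) (by fun_prop) ?_
  refine Measurable.ite (measurableSet_le measurable_snd measurable_const) ?_ (by fun_prop)
  exact hc.measurable.comp measurable_fst

lemma abs_threshEst_le {β : ℝ} (h0 : 0 ≤ β) (h1 : β ≤ 1) (N : ℕ) (s l : ℝ) (n : ℕ) (u v : ℝ) :
    |threshEst β N s l n u v| ≤ |u| + n := by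
  have hn : (0 : ℝ) ≤ n := Nat.cast_nonneg n
  unfold threshEst
  split_ifs
  · rw [abs_mul, abs_neg, abs_of_nonneg h0]; nlinarith [abs_nonneg u]
  · linarith [abs_clip_le n (hermiteEst β N s u), abs_nonneg u]
  · rw [abs_mul, abs_of_nonneg (by linarith)]; nlinarith [abs_nonneg u]

lemma memLp_threshEst {β : ℝ} (h0 : 0 ≤ β) (h1 : β ≤ 1) (N : ℕ) (s l : ℝ) (n : ℕ) (w : ℝ) :
    MemLp (fun p : ℝ × ℝ => threshEst β N s l n (w + s * p.1) (w + s * p.2)) 2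
      ((gaussianReal 0 1).prod (gaussianReal 0 1)) := by
  have hm : Measurable fun p : ℝ × ℝ => threshEst β N s l n (w + s * p.1) (w + s * p.2) :=
    (measurable_threshEst β N s l n).comp (f := fun p : ℝ × ℝ => (w + s * p.1, w + s * p.2))
      (by fun_prop)
  have h2 : MemLp (fun z : ℝ => |w + s * z| + n) 2 (gaussianReal 0 1) :=
    (memLp_linear_gaussian w s).abs.add (memLp_const _)
  have h3 : MemLp (fun p : ℝ × ℝ => |w + s * p.1| + n) 2
      ((gaussianReal 0 1).prod (gaussianReal 0 1)) :=
    h2.comp_measurePreserving measurePreserving_fst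
  refine h3.mono hm.aestronglyMeasurable (ae_of_all _ fun p => ?_)
  rw [Real.norm_eq_abs, Real.norm_eq_abs]
  exact (abs_threshEst_le h0 h1 N s l n _ _).trans (le_abs_self _)

/-- Probability of `V < -l` when `V ∼ N(w, s²)`. -/
noncomputable def probLow (s l w : ℝ) : ℝ := (gaussianReal 0 1).real {z | w + s * z < -l}

/-- Probability of `|V| ≤ l` when `V ∼ N(w, s²)`. -/
noncomputable def probMid (s l w : ℝ) : ℝ :=
  (gaussianReal 0 1).real {z | -l ≤ w + s * z ∧ w + s * z ≤ l}

/-- Probability of `V > l` when `V ∼ N(w, s²)`. -/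
noncomputable def probHigh (s l w : ℝ) : ℝ := (gaussianReal 0 1).real {z | l < w + s * z}

lemma integral_three_regimes (s w a b c : ℝ) {l : ℝ} (hl : 0 ≤ l) :
    ∫ z, (if w + s * z < -l then a else if w + s * z ≤ l then b else c) ∂(gaussianReal 0 1)
      = probLow s l w * a + probMid s l w * b + probHigh s l w * c := by
  have m1 : MeasurableSet {z : ℝ | w + s * z < -l} :=
    measurableSet_lt (by fun_prop) measurable_const
  have m2 : MeasurableSet {z : ℝ | -l ≤ w + s * z ∧ w + s * z ≤ l} :=
    (measurableSet_Icc (a := -l) (b := l)).preimage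
      (by fun_prop : Measurable fun z : ℝ => w + s * z)
  have m3 : MeasurableSet {z : ℝ | l < w + s * z} :=
    measurableSet_lt measurable_const (by fun_prop)
  have e : (fun z : ℝ => if w + s * z < -l then a else if w + s * z ≤ l then b else c)
      = fun z => ({z : ℝ | w + s * z < -l}.indicator (fun _ => a) z
        + {z : ℝ | -l ≤ w + s * z ∧ w + s * z ≤ l}.indicator (fun _ => b) z)
        + {z : ℝ | l < w + s * z}.indicator (fun _ => c) z := by
    funext z
    simp only [Set.indicator_apply, Set.mem_ofPred_eq]
    by_cases h1 : w + s * z < -l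
    · rw [if_pos h1, if_pos h1, if_neg (by intro h; linarith [h.1]), if_neg (by linarith)]
      ring
    · by_cases h2 : w + s * z ≤ l
      · rw [if_neg h1, if_pos h2, if_neg h1, if_pos ⟨by linarith, h2⟩, if_neg (by linarith)]
        ring
      · rw [if_neg h1, if_neg h2, if_neg h1, if_neg (by intro h; exact h2 h.2),
          if_pos (by linarith)]
        ring
  have i : ∀ (S : Set ℝ) (d : ℝ), MeasurableSet S →
      Integrable (S.indicator fun _ => d) (gaussianReal 0 1) := fun S d hS =>
    (integrable_const d).indicator hS
  rw [e, integral_add ((i _ a m1).fun_add (i _ b m2)) (i _ c m3), integral_add (i _ a m1) (i _ b m2),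
    integral_indicator_const _ m1, integral_indicator_const _ m2, integral_indicator_const _ m3]
  rfl

/-- The selector and the estimate are independent, so integrating first over the estimate leaves a
function of the selector with three values. It is applied with `φ` a deviation or its square. -/
lemma integral_threshEst (φ : ℝ → ℝ) (β : ℝ) (N : ℕ) (s : ℝ) {l : ℝ} (hl : 0 ≤ l) (n : ℕ) (w : ℝ)
    (hi : Integrable (fun p : ℝ × ℝ => φ (threshEst β N s l n (w + s * p.1) (w + s * p.2)))
      ((gaussianReal 0 1).prod (gaussianReal 0 1))) :
    ∫ p : ℝ × ℝ, φ (threshEst β N s l n (w + s * p.1) (w + s * p.2))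
        ∂((gaussianReal 0 1).prod (gaussianReal 0 1))
      = probLow s l w * (∫ z, φ (-β * (w + s * z)) ∂(gaussianReal 0 1))
        + probMid s l w * (∫ z, φ (clip n (hermiteEst β N s (w + s * z))) ∂(gaussianReal 0 1))
        + probHigh s l w * (∫ z, φ ((1 - β) * (w + s * z)) ∂(gaussianReal 0 1)) := by
  rw [integral_prod_symm _ hi, ← integral_three_regimes s w _ _ _ hl]
  refine integral_congr_ae (ae_of_all _ fun z => ?_)
  simp only [threshEst]
  split_ifs <;> rfl

lemma probLow_nonneg (s l w : ℝ) : 0 ≤ probLow s l w := measureReal_nonneg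
lemma probMid_nonneg (s l w : ℝ) : 0 ≤ probMid s l w := measureReal_nonneg
lemma probHigh_nonneg (s l w : ℝ) : 0 ≤ probHigh s l w := measureReal_nonneg
lemma probLow_le_one (s l w : ℝ) : probLow s l w ≤ 1 := measureReal_le_one
lemma probMid_le_one (s l w : ℝ) : probMid s l w ≤ 1 := measureReal_le_one
lemma probHigh_le_one (s l w : ℝ) : probHigh s l w ≤ 1 := measureReal_le_one

lemma probLow_le {s l w : ℝ} (hs : 0 < s) (h : 0 < l + w) :
    probLow s l w ≤ s ^ 2 / (l + w) ^ 2 := by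
  refine (measureReal_mono (s₂ := {z : ℝ | (l + w) / s ≤ |z|}) fun z hz => ?_).trans
    ((gaussian_abs_tail_sq ((l + w) / s) (by positivity)).trans (le_of_eq ?_))
  · simp only [Set.mem_ofPred_eq] at hz ⊢
    rw [div_le_iff₀ hs]
    nlinarith [neg_abs_le z]
  · field_simp

lemma probHigh_le {s l w : ℝ} (hs : 0 < s) (h : 0 < l - w) :
    probHigh s l w ≤ s ^ 2 / (l + -w) ^ 2 := by
  refine (measureReal_mono (s₂ := {z : ℝ | (l - w) / s ≤ |z|}) fun z hz => ?_).trans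
    ((gaussian_abs_tail_sq ((l - w) / s) (by positivity)).trans (le_of_eq ?_))
  · simp only [Set.mem_ofPred_eq] at hz ⊢
    rw [div_le_iff₀ hs]
    nlinarith [le_abs_self z]
  · rw [← sub_eq_add_neg]
    field_simp

/-- To reach `[-l, l]` from `w` the noise must cover the distance `|w| - l`. -/
lemma mid_subset_tail {s l w : ℝ} (hs : 0 < s) :
    {z : ℝ | -l ≤ w + s * z ∧ w + s * z ≤ l} ⊆ {z : ℝ | (|w| - l) / s ≤ |z|} := by
  intro z hz
  simp only [Set.mem_ofPred_eq] at hz ⊢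
  rw [div_le_iff₀ hs]
  have h1 : |w + s * z| ≤ l := abs_le.2 hz
  have h2 : |w| ≤ |w + s * z| + |s * z| := by
    have := abs_sub (w + s * z) (s * z)
    simpa using this
  rw [abs_mul, abs_of_pos hs] at h2
  linarith

lemma probMid_le_sq {s l w : ℝ} (hs : 0 < s) (h : l < |w|) :
    probMid s l w ≤ s ^ 2 / (|w| - l) ^ 2 := by
  have h' : 0 < |w| - l := by linarith
  refine (measureReal_mono (mid_subset_tail hs)).trans
    ((gaussian_abs_tail_sq ((|w| - l) / s) (by positivity)).trans (le_of_eq ?_))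
  field_simp

lemma probMid_le_mills {s l w t : ℝ} (hs : 0 < s) (ht : 0 < t) (h : s * t ≤ |w| - l) :
    probMid s l w ≤ 2 * (stdPDF t / t) := by
  refine (measureReal_mono ((mid_subset_tail hs).trans fun z hz => ?_)).trans
    (gaussian_abs_tail_mills t ht)
  simp only [Set.mem_ofPred_eq] at hz ⊢
  refine le_trans ?_ hz
  rw [le_div_iff₀ hs]
  linarith

/-- Choosing a linear regime on the wrong side is unlikely enough. -/
lemma mul_gaussPos_le {p s l w : ℝ} (hp0 : 0 ≤ p) (hp1 : p ≤ 1) (hs : 0 < s) (hs1 : s ≤ 1)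
    (hl : 0 < l) (hp : 0 < l + w → p ≤ s ^ 2 / (l + w) ^ 2) :
    p * gaussPos w ≤ 1 / l + 4 / l ^ 2 ∧ p * gaussPos w ^ 2 ≤ 3 := by
  have hs2 : s ^ 2 ≤ 1 := pow_le_one₀ hs.le hs1
  have hG := gaussPos_le w
  have hG0 := gaussPos_nonneg w
  have hφ := stdPDF_le_half w
  have hφ0 := (stdPDF_pos w).le
  -- For `w ≥ 0` both follow from `p (l + w)² ≤ 1`, as `l w` and `w²` are at most `(l + w)²`.
  have a1 : p * max w 0 ≤ 1 / l ∧ p * max w 0 ^ 2 ≤ 1 := by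
    rcases le_total w 0 with h | h
    · rw [max_eq_right h]; constructor
      · simp; positivity
      · simp
    · rw [max_eq_left h]
      have hp' := hp (by linarith)
      rw [le_div_iff₀ (by positivity)] at hp'
      have hpw : 0 ≤ p * w := mul_nonneg hp0 h
      constructor
      · rw [le_div_iff₀ hl]
        nlinarith [mul_nonneg hp0 (sq_nonneg (l - w)), mul_nonneg hp0 (sq_nonneg l),
          mul_nonneg hp0 (sq_nonneg w), mul_nonneg hpw hl.le]
      · nlinarith [mul_nonneg hp0 (sq_nonneg l), mul_nonneg hpw hl.le]
  -- To the left of `-l/2` the density is small; to the right of it `p` is small.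
  have a2 : p * stdPDF w ≤ 4 / l ^ 2 := by
    rcases le_total w (-(l / 2)) with h | h
    · have h1 := stdPDF_le_inv_sq w (by linarith)
      have h2 : 1 / w ^ 2 ≤ 4 / l ^ 2 := by
        rw [div_le_div_iff₀ (by nlinarith) (by positivity)]
        nlinarith
      nlinarith
    · have hp' := hp (by linarith)
      have h2 : s ^ 2 / (l + w) ^ 2 ≤ 4 / l ^ 2 := by
        rw [div_le_div_iff₀ (by nlinarith) (by positivity)]
        have h4 : l ^ 2 ≤ 4 * (l + w) ^ 2 := by nlinarith
        nlinarith [sq_nonneg l]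
      have h3 : 0 ≤ 4 / l ^ 2 := by positivity
      nlinarith
  refine ⟨by nlinarith [a1.1], ?_⟩
  have h5 : gaussPos w ^ 2 ≤ 2 * max w 0 ^ 2 + 1 := by
    have h6 : gaussPos w ^ 2 ≤ (max w 0 + stdPDF w) ^ 2 := pow_le_pow_left₀ hG0 hG 2
    nlinarith [sq_nonneg (max w 0 - stdPDF w)]
  nlinarith [a1.2]

/-- Bound for the bias of the threshold estimate. -/
noncomputable def biasRate (g₀ : ℝ) (n : ℕ) : ℝ :=
  2 * (1 / (g₀ * √(2 * Real.log n)) + 4 / (g₀ * √(2 * Real.log n)) ^ 2)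
    + (4 / (g₀ * √(2 * Real.log n)) ^ 2 + 57 * Real.log n ^ 2 * √n / n)
    + (2 / √(2 * Real.log n) + 1 / (g₀ * √(2 * Real.log n)))

/-- Bound for the mean squared error of the threshold estimate. -/
noncomputable def mseRate (n : ℕ) : ℝ :=
  24 + 4 * Real.log n + 114 * Real.log n ^ 2 * √n + 2 * n / √(2 * Real.log n)

/-- The relations between the parameters of the threshold estimate: `s` is the standard deviation,
`S` a bound for it, `g` the factor of the threshold. -/
structure ThreshParams (β s S g g₀ : ℝ) (n : ℕ) : Prop where
  β_nonneg : 0 ≤ β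
  β_le : β ≤ 1
  s_pos : 0 < s
  s_le : s ≤ S
  g₀_pos : 0 < g₀
  g₀_le : g₀ ≤ g
  small : Real.exp 1 * (g + S) ^ 2 ≤ 1 / 2
  log_ge : 1 ≤ Real.log n

/-- The number of terms of the Taylor polynomial. -/
noncomputable def numTerms (g S : ℝ) (n : ℕ) : ℕ :=
  ⌈Real.exp 1 ^ 2 * (g + S) ^ 2 * (2 * Real.log n)⌉₊

lemma memLp_clip_hermiteEst (β s : ℝ) (n N : ℕ) (w : ℝ) :
    MemLp (fun z => clip n (hermiteEst β N s (w + s * z))) 2 (gaussianReal 0 1) := by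
  have hc : Continuous fun z => clip n (hermiteEst β N s (w + s * z)) :=
    (continuous_clip n).comp ((continuous_hermiteEst β N s).comp (by fun_prop))
  refine (memLp_const (n : ℝ)).mono hc.aestronglyMeasurable (ae_of_all _ fun z => ?_)
  rw [Real.norm_eq_abs, Real.norm_eq_abs]
  exact (abs_clip_le n _).trans (le_abs_self _)

/-! ### Bias and mean squared error of the threshold estimate, uniformly in `w` -/

namespace ThreshParams

variable {β s S g g₀ : ℝ} {n : ℕ}

lemma n_pos (h : ThreshParams β s S g g₀ n) : 0 < n := by
  rcases Nat.eq_zero_or_pos n with h0 | h0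
  · have := h.log_ge
    rw [h0] at this
    simp at this
    linarith
  · exact h0

lemma exp_half_log (h : ThreshParams β s S g g₀ n) : Real.exp (Real.log n / 2) = √n := by
  have hn : (0 : ℝ) < n := Nat.cast_pos.2 h.n_pos
  rw [Real.sqrt_eq_rpow, Real.rpow_def_of_pos hn]
  congr 1; ring

lemma sqrt_n_ge (h : ThreshParams β s S g g₀ n) : 1 ≤ √(n : ℝ) := by
  rw [← h.exp_half_log]
  exact Real.one_le_exp (by linarith [h.log_ge])

lemma exp_mul_sq_le (h : ThreshParams β s S g g₀ n) : Real.exp 1 * s ^ 2 ≤ 1 / 2 := by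
  refine le_trans ?_ h.small
  have := h.s_pos; have := h.s_le; have := h.g₀_pos; have := h.g₀_le
  gcongr
  linarith

lemma s_le_one (h : ThreshParams β s S g g₀ n) : s ≤ 1 := by
  have h1 := h.exp_mul_sq_le
  have h2 := Real.add_one_le_exp (1 : ℝ)
  nlinarith [h.s_pos]

lemma sum_le_one (h : ThreshParams β s S g g₀ n) : g + S ≤ 1 := by
  have h1 := h.small
  have h2 := Real.add_one_le_exp (1 : ℝ)
  nlinarith [sq_nonneg (g + S)]

lemma sqrt_ge (h : ThreshParams β s S g g₀ n) : 1 ≤ √(2 * Real.log n) :=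
  Real.le_sqrt_of_sq_le (by linarith [h.log_ge])

lemma sqrt_sq (h : ThreshParams β s S g g₀ n) : √(2 * Real.log n) ^ 2 = 2 * Real.log n :=
  Real.sq_sqrt (by linarith [h.log_ge])

/-- The hypothesis `small` turns `e² (g + S)² · 2 log n` into at most `e log n`, with `e < 3`; the
ceiling costs `1 ≤ log n`. -/
lemma numTerms_le (h : ThreshParams β s S g g₀ n) : (numTerms g S n : ℝ) ≤ 4 * Real.log n := by
  have hL := h.log_ge
  have h1 : Real.exp 1 ^ 2 * (g + S) ^ 2 * (2 * Real.log n) ≤ 3 * Real.log n := by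
    have h2 := h.small
    have h3 : Real.exp 1 < 3 := by linarith [Real.exp_one_lt_d9]
    have h4 := Real.exp_pos 1
    calc Real.exp 1 ^ 2 * (g + S) ^ 2 * (2 * Real.log n)
        = Real.exp 1 * (Real.exp 1 * (g + S) ^ 2) * (2 * Real.log n) := by ring
      _ ≤ 3 * (1 / 2) * (2 * Real.log n) := by gcongr
      _ = 3 * Real.log n := by ring
  have h2 := (Nat.ceil_lt_add_one (a := Real.exp 1 ^ 2 * (g + S) ^ 2 * (2 * Real.log n))
    (by positivity)).le
  rw [numTerms]
  linarith

/-- For these `w`, `small` gives `e w² ≤ log n`, so the exponential factor is `√n`. The constant is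
`57 = 3 (1 + 1 + 1 + 16)`, with `16` from the squared number of terms. -/
lemma second_moment_le (h : ThreshParams β s S g g₀ n) {w : ℝ}
    (hw : |w| ≤ (g + S) * √(2 * Real.log n)) :
    ∫ z, hermiteEst β (numTerms g S n) s (w + s * z) ^ 2 ∂(gaussianReal 0 1)
      ≤ 57 * Real.log n ^ 2 * √n := by
  have hL := h.log_ge
  have hw2 : w ^ 2 ≤ (g + S) ^ 2 * (2 * Real.log n) := by
    rw [← sq_abs, ← h.sqrt_sq, ← mul_pow]
    gcongr
  have hew : Real.exp 1 * w ^ 2 ≤ Real.log n := by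
    have h4 := Real.exp_pos 1
    calc Real.exp 1 * w ^ 2 ≤ Real.exp 1 * ((g + S) ^ 2 * (2 * Real.log n)) := by gcongr
      _ = Real.exp 1 * (g + S) ^ 2 * (2 * Real.log n) := by ring
      _ ≤ 1 / 2 * (2 * Real.log n) := by gcongr; exact h.small
      _ = Real.log n := by ring
  have hwL : w ^ 2 ≤ Real.log n := by
    have := Real.add_one_le_exp (1 : ℝ)
    nlinarith [sq_nonneg w]
  refine (integral_hermiteEst_sq_le h.β_nonneg h.β_le _ h.s_pos.ne' h.exp_mul_sq_le hew).trans ?_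
  rw [h.exp_half_log]
  have hs1 : s ^ 2 ≤ 1 := pow_le_one₀ h.s_pos.le h.s_le_one
  have hN : (numTerms g S n : ℝ) ^ 2 ≤ (4 * Real.log n) ^ 2 :=
    pow_le_pow_left₀ (Nat.cast_nonneg _) h.numTerms_le 2
  have hq := h.sqrt_n_ge
  have hLq : Real.log n ^ 2 ≤ Real.log n ^ 2 * √n := le_mul_of_one_le_right (by positivity) hq
  have := mul_le_mul_of_nonneg_right hN (by linarith : 0 ≤ √(n : ℝ))
  nlinarith

lemma sqrt_pos (h : ThreshParams β s S g g₀ n) : 0 < √(2 * Real.log n) := by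
  linarith [h.sqrt_ge]

lemma scale_pos (h : ThreshParams β s S g g₀ n) : 0 < g₀ * √(2 * Real.log n) :=
  mul_pos h.g₀_pos h.sqrt_pos

lemma scale_le (h : ThreshParams β s S g g₀ n) :
    g₀ * √(2 * Real.log n) ≤ g * √(2 * Real.log n) :=
  mul_le_mul_of_nonneg_right h.g₀_le h.sqrt_pos.le

lemma scale_le' (h : ThreshParams β s S g g₀ n) :
    g₀ * √(2 * Real.log n) ≤ (g + S) * √(2 * Real.log n) :=
  mul_le_mul_of_nonneg_right (by linarith [h.g₀_le, h.s_pos, h.s_le]) h.sqrt_pos.le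

/-- In the middle regime the estimate is nearly unbiased for moderate `w`. -/
lemma mid_bias_of_le (h : ThreshParams β s S g g₀ n) {w : ℝ}
    (hw : |w| ≤ (g + S) * √(2 * Real.log n)) :
    |∫ z, (clip n (hermiteEst β (numTerms g S n) s (w + s * z)) - G w β) ∂(gaussianReal 0 1)|
      ≤ 4 / (g₀ * √(2 * Real.log n)) ^ 2 + 57 * Real.log n ^ 2 * √n / n := by
  set N := numTerms g S n with hN
  have i1 := integrable_hermiteEst β N h.s_pos.ne' w
  have i2 := integrable_hermiteEst_sq β N h.s_pos.ne' w
  have i3 := (memLp_clip_hermiteEst β s n N w).integrable (by norm_num)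
  have hW : 0 < (g + S) * √(2 * Real.log n) := h.scale_pos.trans_le h.scale_le'
  have ht : |G w β - taylorG β N w| ≤ 4 / (g₀ * √(2 * Real.log n)) ^ 2 := by
    refine (abs_G_sub_taylorG_le β N hW hw ?_).trans ?_
    · rw [hN, mul_pow, h.sqrt_sq, ← mul_assoc]
      exact Nat.le_ceil _
    · exact div_le_div_of_nonneg_left (by norm_num) (pow_pos h.scale_pos 2)
        (pow_le_pow_left₀ h.scale_pos.le h.scale_le' 2)
  have hc : |∫ z, (clip n (hermiteEst β N s (w + s * z)) - hermiteEst β N s (w + s * z))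
      ∂(gaussianReal 0 1)| ≤ 57 * Real.log n ^ 2 * √n / n := by
    refine abs_integral_le_integral_abs.trans ?_
    refine (integral_mono (i3.sub i1).abs (i2.div_const (n : ℝ))
      fun z => abs_clip_sub_le h.n_pos _).trans ?_
    rw [integral_div]
    gcongr
    exact h.second_moment_le hw
  rw [integral_sub i3 i1, integral_hermiteEst β N h.s_pos.ne'] at hc
  rw [integral_sub i3 (integrable_const _)]
  simp only [integral_const, probReal_univ, smul_eq_mul, one_mul]
  rw [abs_le] at ht hc ⊢
  constructor <;> linarith [ht.1, ht.2, hc.1, hc.2]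

/-- Large `w` rarely lead to the middle regime. -/
lemma probMid_of_gt (h : ThreshParams β s S g g₀ n) {w : ℝ}
    (hw : (g + S) * √(2 * Real.log n) < |w|) :
    probMid s (g * √(2 * Real.log n)) w * n ≤ 1 / √(2 * Real.log n) ∧
      probMid s (g * √(2 * Real.log n)) w * w ^ 2 ≤ 1 := by
  set q := √(2 * Real.log n) with hq
  have hq0 : 0 < q := h.sqrt_pos
  have hn : (0 : ℝ) < n := Nat.cast_pos.2 h.n_pos
  have hS : 0 < S := h.s_pos.trans_le h.s_le
  have hg : 0 < g := h.g₀_pos.trans_le h.g₀_le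
  constructor
  · have h1 : probMid s (g * q) w ≤ 2 * (stdPDF q / q) := by
      refine probMid_le_mills h.s_pos hq0 ?_
      have := mul_le_mul_of_nonneg_right h.s_le hq0.le
      nlinarith
    have h2 : stdPDF q ≤ 1 / 2 * (n : ℝ)⁻¹ := by
      refine (stdPDF_le_exp q).trans (le_of_eq ?_)
      rw [neg_div, hq, h.sqrt_sq, mul_div_cancel_left₀ _ two_ne_zero, Real.exp_neg,
        Real.exp_log hn]
    calc probMid s (g * q) w * n ≤ 2 * (1 / 2 * (n : ℝ)⁻¹ / q) * n := by
          gcongr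
          exact h1.trans (by gcongr)
      _ = 1 / q := by field_simp
  · have hw0 : 0 < |w| := lt_trans (by positivity) hw
    -- That distance is also at least the fraction `S / (g + S)` of `|w|`, so Chebyshev's inequality
    -- gives decay of order `w^(-2)`.
    have h1 : |w| * S ≤ (|w| - g * q) * (g + S) := by nlinarith
    have h3 : 0 < |w| - g * q := by nlinarith
    have h2 := probMid_le_sq h.s_pos (l := g * q) (w := w) (by linarith)
    rw [le_div_iff₀ (by positivity)] at h2
    have h4 : (|w| * S) ^ 2 ≤ ((|w| - g * q) * (g + S)) ^ 2 := by gcongr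
    have h5 : (g + S) ^ 2 ≤ 1 := pow_le_one₀ (by positivity) h.sum_le_one
    have h6 : (|w| * S) ^ 2 ≤ (|w| - g * q) ^ 2 := by
      rw [mul_pow] at h4
      nlinarith [sq_nonneg (|w| - g * q)]
    have h7 : s ^ 2 ≤ S ^ 2 := pow_le_pow_left₀ h.s_pos.le h.s_le 2
    have h8 := probMid_nonneg s (g * q) w
    have h9 : probMid s (g * q) w * (w ^ 2 * S ^ 2) ≤ S ^ 2 := by
      rw [mul_pow, sq_abs] at h6
      nlinarith
    have hS2 : 0 < S ^ 2 := by positivity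
    nlinarith

lemma l_pos (h : ThreshParams β s S g g₀ n) : 0 < g * √(2 * Real.log n) :=
  h.scale_pos.trans_le h.scale_le

/-- In this regime the estimate has mean `-β w`, which misses `G w β` by exactly `gaussPos w`. -/
lemma low_bounds (h : ThreshParams β s S g g₀ n) (w : ℝ) :
    probLow s (g * √(2 * Real.log n)) w * gaussPos w
        ≤ 1 / (g₀ * √(2 * Real.log n)) + 4 / (g₀ * √(2 * Real.log n)) ^ 2 ∧
      probLow s (g * √(2 * Real.log n)) w * gaussPos w ^ 2 ≤ 3 := by
  have h1 := mul_gaussPos_le (probLow_nonneg s (g * √(2 * Real.log n)) w)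
    (probLow_le_one _ _ _) h.s_pos h.s_le_one h.l_pos (probLow_le h.s_pos)
  have := h.scale_pos
  refine ⟨h1.1.trans ?_, h1.2⟩
  gcongr 1 / ?_ + 4 / ?_ ^ 2 <;> exact h.scale_le

/-- The mirror image: the mean `(1 - β) w` misses `G w β` by `gaussPos (-w)`. -/
lemma high_bounds (h : ThreshParams β s S g g₀ n) (w : ℝ) :
    probHigh s (g * √(2 * Real.log n)) w * gaussPos (-w)
        ≤ 1 / (g₀ * √(2 * Real.log n)) + 4 / (g₀ * √(2 * Real.log n)) ^ 2 ∧
      probHigh s (g * √(2 * Real.log n)) w * gaussPos (-w) ^ 2 ≤ 3 := by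
  have h1 := mul_gaussPos_le (w := -w) (probHigh_nonneg s (g * √(2 * Real.log n)) w)
    (probHigh_le_one _ _ _) h.s_pos h.s_le_one h.l_pos
    (fun h' => probHigh_le h.s_pos (by linarith))
  have := h.scale_pos
  refine ⟨h1.1.trans ?_, h1.2⟩
  gcongr 1 / ?_ + 4 / ?_ ^ 2 <;> exact h.scale_le

lemma mid_bias (h : ThreshParams β s S g g₀ n) (w : ℝ) :
    probMid s (g * √(2 * Real.log n)) w * |∫ z, (clip n (hermiteEst β (numTerms g S n) s
        (w + s * z)) - G w β) ∂(gaussianReal 0 1)|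
      ≤ (4 / (g₀ * √(2 * Real.log n)) ^ 2 + 57 * Real.log n ^ 2 * √n / n)
        + (2 / √(2 * Real.log n) + 1 / (g₀ * √(2 * Real.log n))) := by
  have hp0 := probMid_nonneg s (g * √(2 * Real.log n)) w
  have hp1 := probMid_le_one s (g * √(2 * Real.log n)) w
  set p := probMid s (g * √(2 * Real.log n)) w with hp
  have hsc := h.scale_pos
  have hq := h.sqrt_pos
  -- Within this radius the Taylor polynomial is accurate. Beyond it the error is bounded crudely by
  -- `n + |w| + 1` and the rarity of the middle regime compensates.
  rcases le_or_gt |w| ((g + S) * √(2 * Real.log n)) with hw | hw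
  · have h1 := h.mid_bias_of_le hw
    have h2 : 0 ≤ 2 / √(2 * Real.log n) + 1 / (g₀ * √(2 * Real.log n)) := by positivity
    nlinarith [abs_nonneg (∫ z, (clip n (hermiteEst β (numTerms g S n) s
        (w + s * z)) - G w β) ∂(gaussianReal 0 1))]
  · obtain ⟨h1, h2⟩ := h.probMid_of_gt hw
    rw [← hp] at h1 h2
    have hW : g₀ * √(2 * Real.log n) ≤ |w| := h.scale_le'.trans hw.le
    have hI : |∫ z, (clip n (hermiteEst β (numTerms g S n) s
        (w + s * z)) - G w β) ∂(gaussianReal 0 1)| ≤ n + (|w| + 1) := by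
      have i3 := (memLp_clip_hermiteEst β s n (numTerms g S n) w).integrable (by norm_num)
      refine abs_integral_le_integral_abs.trans ?_
      refine (integral_mono (i3.sub (integrable_const _)).abs
        (integrable_const ((n : ℝ) + (|w| + 1))) fun z => ?_).trans (by simp)
      have a := abs_clip_le n (hermiteEst β (numTerms g S n) s (w + s * z))
      have b := abs_G_le w β h.β_nonneg h.β_le
      exact (abs_sub _ _).trans (add_le_add a b)
    have h3 : p * |w| ≤ 1 / (g₀ * √(2 * Real.log n)) := by
      rw [le_div_iff₀ hsc]
      have : p * |w| * (g₀ * √(2 * Real.log n)) ≤ p * |w| * |w| :=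
        mul_le_mul_of_nonneg_left hW (by positivity)
      have e : p * |w| * |w| = p * w ^ 2 := by rw [mul_assoc, abs_mul_abs_self, sq]
      linarith
    have h4 : p ≤ 1 / √(2 * Real.log n) := by
      refine le_trans ?_ h1
      refine le_mul_of_one_le_right hp0 ?_
      exact_mod_cast h.n_pos
    have h5 : 0 ≤ 4 / (g₀ * √(2 * Real.log n)) ^ 2 + 57 * Real.log n ^ 2 * √n / n := by positivity
    have h6 := mul_le_mul_of_nonneg_left hI hp0
    have h7 : 2 / √(2 * Real.log n) = 1 / √(2 * Real.log n) + 1 / √(2 * Real.log n) := by ring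
    rw [h7]
    nlinarith

/-- The threshold estimate is asymptotically unbiased, uniformly in `w`. -/
lemma abs_bias_le (h : ThreshParams β s S g g₀ n) (w : ℝ) :
    |(∫ p : ℝ × ℝ, threshEst β (numTerms g S n) s (g * √(2 * Real.log n)) n
        (w + s * p.1) (w + s * p.2) ∂((gaussianReal 0 1).prod (gaussianReal 0 1))) - G w β|
      ≤ biasRate g₀ n := by
  have hi := (memLp_threshEst h.β_nonneg h.β_le (numTerms g S n) s (g * √(2 * Real.log n)) n
    w).integrable (by norm_num)
  have hi' : Integrable (fun p : ℝ × ℝ => threshEst β (numTerms g S n) s (g * √(2 * Real.log n)) n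
    (w + s * p.1) (w + s * p.2) - G w β) ((gaussianReal 0 1).prod (gaussianReal 0 1)) :=
    hi.sub (integrable_const _)
  have e : (∫ p : ℝ × ℝ, threshEst β (numTerms g S n) s (g * √(2 * Real.log n)) n
        (w + s * p.1) (w + s * p.2) ∂((gaussianReal 0 1).prod (gaussianReal 0 1))) - G w β
      = ∫ p : ℝ × ℝ, (threshEst β (numTerms g S n) s (g * √(2 * Real.log n)) n
        (w + s * p.1) (w + s * p.2) - G w β) ∂((gaussianReal 0 1).prod (gaussianReal 0 1)) := by
    rw [integral_sub hi (integrable_const _)]; simp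
  rw [e, integral_threshEst (fun t => t - G w β) β _ s h.l_pos.le n w hi']
  have e1 : ∫ z, (-β * (w + s * z) - G w β) ∂(gaussianReal 0 1) = -gaussPos w := by
    have : ∀ z : ℝ, -β * (w + s * z) - G w β = -gaussPos w + (-β * s) * z := by
      intro z; rw [G_eq]; ring
    simp_rw [this]
    exact integral_linear_gaussian _ _
  have e2 : ∫ z, ((1 - β) * (w + s * z) - G w β) ∂(gaussianReal 0 1) = -gaussPos (-w) := by
    have : ∀ z : ℝ, (1 - β) * (w + s * z) - G w β = -gaussPos (-w) + ((1 - β) * s) * z := by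
      intro z; rw [G_eq, gaussPos_neg]; ring
    simp_rw [this]
    exact integral_linear_gaussian _ _
  rw [e1, e2]
  have hl := (h.low_bounds w).1
  have hh := (h.high_bounds w).1
  have hm := h.mid_bias w
  have hl0 := mul_nonneg (probLow_nonneg s (g * √(2 * Real.log n)) w) (gaussPos_nonneg w)
  have hh0 := mul_nonneg (probHigh_nonneg s (g * √(2 * Real.log n)) w) (gaussPos_nonneg (-w))
  rw [← abs_of_nonneg (probMid_nonneg s (g * √(2 * Real.log n)) w), ← abs_mul] at hm
  rw [abs_le] at hm
  rw [biasRate, abs_le]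
  constructor <;> linarith [hm.1, hm.2]

lemma mid_mse (h : ThreshParams β s S g g₀ n) (w : ℝ) :
    probMid s (g * √(2 * Real.log n)) w * ∫ z, (clip n (hermiteEst β (numTerms g S n) s
        (w + s * z)) - G w β) ^ 2 ∂(gaussianReal 0 1)
      ≤ 8 + 4 * Real.log n + 114 * Real.log n ^ 2 * √n + 2 * n / √(2 * Real.log n) := by
  have hp0 := probMid_nonneg s (g * √(2 * Real.log n)) w
  have hp1 := probMid_le_one s (g * √(2 * Real.log n)) w
  set p := probMid s (g * √(2 * Real.log n)) w with hp
  have hq := h.sqrt_pos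
  have hL := h.log_ge
  have hn : (0 : ℝ) < n := Nat.cast_pos.2 h.n_pos
  have i3 := memLp_clip_hermiteEst β s n (numTerms g S n) w
  have i4 : Integrable (fun z => (clip n (hermiteEst β (numTerms g S n) s
        (w + s * z)) - G w β) ^ 2) (gaussianReal 0 1) := (i3.sub (memLp_const _)).integrable_sq
  have hG : G w β ^ 2 ≤ 2 * w ^ 2 + 2 := by
    have b := abs_G_le w β h.β_nonneg h.β_le
    rw [← sq_abs, ← sq_abs w]
    nlinarith [abs_nonneg (G w β), sq_nonneg (|w| - 1)]
  -- The dominating function `f` is the square of the untruncated estimate for moderate `w`, and the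
  -- constant `n²` for large `w`.
  have hgen : ∀ (f : ℝ → ℝ), Integrable f (gaussianReal 0 1) →
      (∀ z, clip n (hermiteEst β (numTerms g S n) s (w + s * z)) ^ 2 ≤ f z) →
      ∫ z, (clip n (hermiteEst β (numTerms g S n) s (w + s * z)) - G w β) ^ 2 ∂(gaussianReal 0 1)
        ≤ 2 * (∫ z, f z ∂(gaussianReal 0 1)) + 2 * (2 * w ^ 2 + 2) := by
    intro f hf hle
    refine (integral_mono i4 ((hf.const_mul 2).add (integrable_const (2 * (2 * w ^ 2 + 2))))
      fun z => ?_).trans (le_of_eq ?_)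
    · have := hle z
      simp only [Pi.add_apply]
      nlinarith [sq_nonneg (clip n (hermiteEst β (numTerms g S n) s (w + s * z)) + G w β)]
    · simp only [Pi.add_apply]
      rw [integral_add (hf.const_mul 2) (integrable_const _), integral_const_mul]
      simp
  have hI0 : 0 ≤ ∫ z, (clip n (hermiteEst β (numTerms g S n) s
        (w + s * z)) - G w β) ^ 2 ∂(gaussianReal 0 1) := integral_nonneg fun z => sq_nonneg _
  rcases le_or_gt |w| ((g + S) * √(2 * Real.log n)) with hw | hw
  · have h1 := hgen _ (integrable_hermiteEst_sq β (numTerms g S n) h.s_pos.ne' w)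
      fun z => clip_sq_le n _
    have h2 := h.second_moment_le hw
    have hw2 : w ^ 2 ≤ Real.log n := by
      have : w ^ 2 ≤ (g + S) ^ 2 * (2 * Real.log n) := by
        rw [← sq_abs, ← h.sqrt_sq, ← mul_pow]
        gcongr
      have h3 := h.small
      have h4 := Real.add_one_le_exp (1 : ℝ)
      nlinarith [sq_nonneg (g + S)]
    have h5 : 0 ≤ 2 * n / √(2 * Real.log n) := by positivity
    nlinarith
  · obtain ⟨h1, h2⟩ := h.probMid_of_gt hw
    rw [← hp] at h1 h2
    have h3 := hgen (fun _ => (n : ℝ) ^ 2) (integrable_const _) fun z =>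
      sq_le_sq' (abs_le.1 (abs_clip_le n _)).1 (abs_le.1 (abs_clip_le n _)).2
    simp only [integral_const, probReal_univ, smul_eq_mul, one_mul] at h3
    have h4 : p * (n : ℝ) ^ 2 ≤ n / √(2 * Real.log n) := by
      have := mul_le_mul_of_nonneg_right h1 hn.le
      calc p * (n : ℝ) ^ 2 = p * n * n := by ring
        _ ≤ _ := this
        _ = _ := by ring
    have h5 : 0 ≤ 114 * Real.log n ^ 2 * √n := by positivity
    have h6 := mul_le_mul_of_nonneg_left h3 hp0
    have h7 : 2 * n / √(2 * Real.log n) = 2 * (n / √(2 * Real.log n)) := by ring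
    rw [h7]
    nlinarith

/-- The mean squared error of the threshold estimate, uniformly in `w`. -/
lemma mse_le (h : ThreshParams β s S g g₀ n) (w : ℝ) :
    ∫ p : ℝ × ℝ, (threshEst β (numTerms g S n) s (g * √(2 * Real.log n)) n
        (w + s * p.1) (w + s * p.2) - G w β) ^ 2 ∂((gaussianReal 0 1).prod (gaussianReal 0 1))
      ≤ mseRate n := by
  have hi : Integrable (fun p : ℝ × ℝ => (threshEst β (numTerms g S n) s
      (g * √(2 * Real.log n)) n (w + s * p.1) (w + s * p.2) - G w β) ^ 2)
      ((gaussianReal 0 1).prod (gaussianReal 0 1)) :=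
    ((memLp_threshEst h.β_nonneg h.β_le (numTerms g S n) s (g * √(2 * Real.log n)) n
    w).sub (memLp_const _)).integrable_sq
  rw [integral_threshEst (fun t => (t - G w β) ^ 2) β _ s h.l_pos.le n w hi]
  have hs1 : s ^ 2 ≤ 1 := pow_le_one₀ h.s_pos.le h.s_le_one
  have e1 : ∫ z, (-β * (w + s * z) - G w β) ^ 2 ∂(gaussianReal 0 1) ≤ gaussPos w ^ 2 + 1 := by
    have : ∀ z : ℝ, -β * (w + s * z) - G w β = -gaussPos w + (-β * s) * z := by
      intro z; rw [G_eq]; ring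
    simp_rw [this]
    rw [integral_linear_sq_gaussian, mul_pow, neg_sq, neg_sq]
    have : β ^ 2 ≤ 1 := pow_le_one₀ h.β_nonneg h.β_le
    nlinarith [sq_nonneg s]
  have e2 : ∫ z, ((1 - β) * (w + s * z) - G w β) ^ 2 ∂(gaussianReal 0 1)
      ≤ gaussPos (-w) ^ 2 + 1 := by
    have : ∀ z : ℝ, (1 - β) * (w + s * z) - G w β = -gaussPos (-w) + ((1 - β) * s) * z := by
      intro z; rw [G_eq, gaussPos_neg]; ring
    simp_rw [this]
    rw [integral_linear_sq_gaussian, mul_pow, neg_sq]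
    have : (1 - β) ^ 2 ≤ 1 := pow_le_one₀ (by linarith [h.β_le]) (by linarith [h.β_nonneg])
    nlinarith [sq_nonneg s]
  have hl := (h.low_bounds w).2
  have hh := (h.high_bounds w).2
  have hm := h.mid_mse w
  have a1 := mul_le_mul_of_nonneg_left e1 (probLow_nonneg s (g * √(2 * Real.log n)) w)
  have a2 := mul_le_mul_of_nonneg_left e2 (probHigh_nonneg s (g * √(2 * Real.log n)) w)
  have b1 := probLow_le_one s (g * √(2 * Real.log n)) w
  have b2 := probHigh_le_one s (g * √(2 * Real.log n)) w
  rw [mseRate]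
  linarith

end ThreshParams

/-! ### Rotation invariance -/

lemma charFunDual_gaussianReal_zero (v : NNReal) (L : StrongDual ℝ ℝ) :
    charFunDual (gaussianReal 0 v) L = Complex.exp (-(v * (L 1) ^ 2 / 2 : ℝ)) := by
  have e : charFunDual (gaussianReal 0 v) L = charFun (gaussianReal 0 v) (L 1) := by
    rw [charFunDual_apply, charFun_apply_real]
    congr 1
    ext x
    have : L x = L 1 * x := by
      have := L.map_smul x 1
      simpa [mul_comm] using this
    rw [this]
    push_cast
    ring_nf
  rw [e, charFun_gaussianReal]
  congr 1
  push_cast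
  ring

/-- The map is orthogonal, and the characteristic function of the standard normal law of the plane
depends only on the norm. The minus signs fit `coefD < 0`, so that the standard deviation `splitSD`
enters with a positive sign. -/
lemma measurePreserving_rotation :
    MeasurePreserving (fun p : ℝ × ℝ => (-(p.1 + p.2) / √2, -(p.1 - p.2) / √2))
      ((gaussianReal 0 1).prod (gaussianReal 0 1)) ((gaussianReal 0 1).prod (gaussianReal 0 1)) := by
  set R : (ℝ × ℝ) →L[ℝ] (ℝ × ℝ) :=
    ((-(√2)⁻¹) • (ContinuousLinearMap.fst ℝ ℝ ℝ + ContinuousLinearMap.snd ℝ ℝ ℝ)).prod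
      ((-(√2)⁻¹) • (ContinuousLinearMap.fst ℝ ℝ ℝ - ContinuousLinearMap.snd ℝ ℝ ℝ)) with hR
  have hRe : (fun p : ℝ × ℝ => (-(p.1 + p.2) / √2, -(p.1 - p.2) / √2)) = R := by
    funext p
    simp only [hR, ContinuousLinearMap.prod_apply, _root_.smul_apply,
      _root_.add_apply, _root_.sub_apply, ContinuousLinearMap.coe_fst',
      ContinuousLinearMap.coe_snd', smul_eq_mul, Prod.mk.injEq]
    constructor <;> ring
  refine ⟨by fun_prop, ?_⟩
  rw [hRe]
  refine Measure.ext_of_charFunDual ?_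
  ext L
  have hs : (√2 : ℝ)⁻¹ ^ 2 = 1 / 2 := by
    rw [inv_pow, Real.sq_sqrt (by norm_num)]; norm_num
  have hL : ∀ a b : ℝ, L (a, b) = a * L (1, 0) + b * L (0, 1) := by
    intro a b
    have e : ((a, b) : ℝ × ℝ) = a • (1, 0) + b • (0, 1) := by simp
    rw [e, map_add, map_smul, map_smul, smul_eq_mul, smul_eq_mul]
  rw [charFunDual_map, charFunDual_prod, charFunDual_prod]
  simp only [charFunDual_gaussianReal_zero]
  rw [← Complex.exp_add, ← Complex.exp_add, ← Complex.ofReal_neg, ← Complex.ofReal_neg,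
    ← Complex.ofReal_neg, ← Complex.ofReal_neg, ← Complex.ofReal_add, ← Complex.ofReal_add]
  congr 2
  simp only [hR, ContinuousLinearMap.comp_apply, ContinuousLinearMap.prod_apply,
    _root_.smul_apply,
    _root_.add_apply, _root_.sub_apply, ContinuousLinearMap.coe_fst',
    ContinuousLinearMap.coe_snd', smul_eq_mul, ContinuousLinearMap.inl_apply,
    ContinuousLinearMap.inr_apply, NNReal.coe_one]
  rw [hL (-(√2)⁻¹ * (1 + 0)), hL (-(√2)⁻¹ * (0 + 1))]
  linear_combination (-(L (1, 0) ^ 2 + L (0, 1) ^ 2)) * hs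

/-! ### Elementary bounds for the coefficients -/

namespace Model

variable {M : Model}

lemma shrink_nonneg (hM : M.Positive) (i : ℕ) (τ : ℝ≥0∞) : 0 ≤ M.shrink i τ := by
  have := hM.σp_pos i
  unfold shrink
  split_ifs
  · exact zero_le_one
  · positivity

lemma shrink_le_one (hM : M.Positive) (i : ℕ) (τ : ℝ≥0∞) : M.shrink i τ ≤ 1 := by
  have := hM.σp_pos i
  have h0 : 0 ≤ τ.toReal := ENNReal.toReal_nonneg
  unfold shrink
  split_ifs
  · exact le_refl _
  · rw [div_le_one (by positivity)]; linarith

lemma shrink_lt_one (hM : M.Positive) (i : ℕ) {τ : ℝ≥0∞} (hτ : τ ≠ ∞) : M.shrink i τ < 1 := by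
  have := hM.σp_pos i
  have h0 : 0 ≤ τ.toReal := ENNReal.toReal_nonneg
  rw [shrink, if_neg hτ, div_lt_one (by positivity)]
  linarith

lemma ratio_nonneg (hM : M.Positive) (i : ℕ) : 0 ≤ M.ratio i := by
  have := hM.b_pos i; have := hM.h_pos i
  unfold ratio
  positivity

lemma ratio_le_one (hM : M.Positive) (i : ℕ) : M.ratio i ≤ 1 := by
  have := hM.b_pos i; have := hM.h_pos i
  rw [ratio, div_le_one (by positivity)]
  linarith

lemma denom_pos (hM : M.Positive) (i : ℕ) (τ : ℝ≥0∞) :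
    0 < M.σf i + M.shrink i τ ^ 2 * M.σp i := by
  have := hM.σp_pos i; have := hM.σf_pos i
  positivity

lemma coefD_neg (hM : M.Positive) (i : ℕ) {τ : ℝ≥0∞} (hτ : τ ≠ ∞) : M.coefD i τ < 0 := by
  have h1 := shrink_lt_one hM i hτ
  have h2 := denom_pos hM i τ
  exact div_neg_of_neg_of_pos (by linarith) (by positivity)

lemma coefD_sq_le (hM : M.Positive) (i : ℕ) (τ : ℝ≥0∞) : M.coefD i τ ^ 2 ≤ 1 / M.σf i := by
  have h0 := shrink_nonneg hM i τ
  have h1 := shrink_le_one hM i τ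
  have h2 := denom_pos hM i τ
  have h3 := hM.σf_pos i
  have h4 := hM.σp_pos i
  rw [coefD, div_pow, Real.sq_sqrt h2.le, neg_sq]
  gcongr
  · exact pow_le_one₀ (by linarith) (by linarith)
  · nlinarith [mul_nonneg (sq_nonneg (M.shrink i τ)) h4.le]

/-- The standard deviation of the two halves of the split observation. -/
noncomputable def splitSD (M : Model) (i : ℕ) (τ : ℝ≥0∞) : ℝ := √(2 * M.σp i * M.coefD i τ ^ 2)

/-- The parameters of coordinate `i` are suitable for the threshold estimate. -/
lemma threshParams (hM : M.Positive) {γ : ℕ → ℝ} {g₀ : ℝ} (hg₀ : 0 < g₀) (hγ₀ : ∀ i, g₀ ≤ γ i)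
    (hγ : ∀ i, γ i < 1 / √(4 * Real.exp 1) - √(M.σp i / M.σf i)) {n : ℕ}
    (hn : 1 ≤ Real.log n) (i : ℕ) {τ : ℝ≥0∞} (hτ : τ ≠ ∞) :
    ThreshParams (M.ratio i) (M.splitSD i τ) (√(2 * M.σp i / M.σf i)) (γ i) g₀ n where
  β_nonneg := ratio_nonneg hM i
  β_le := ratio_le_one hM i
  s_pos := by
    have := hM.σp_pos i
    have := coefD_neg hM i hτ
    refine Real.sqrt_pos.2 ?_
    have : 0 < M.coefD i τ ^ 2 := sq_pos_iff.2 this.ne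
    positivity
  s_le := by
    have h := hM.σp_pos i
    have h2 := coefD_sq_le hM i τ
    refine Real.sqrt_le_sqrt ?_
    calc 2 * M.σp i * M.coefD i τ ^ 2 ≤ 2 * M.σp i * (1 / M.σf i) := by gcongr
      _ = _ := by ring
  g₀_pos := hg₀
  g₀_le := hγ₀ i
  small := by
    have h := hM.σp_pos i
    have hf := hM.σf_pos i
    have h1 : √(2 * M.σp i / M.σf i) = √2 * √(M.σp i / M.σf i) := by
      rw [← Real.sqrt_mul (by norm_num), mul_div_assoc]
    have hγi := hγ i
    have hγp : 0 < γ i := hg₀.trans_le (hγ₀ i)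
    have h2 : (1 : ℝ) ≤ √2 := Real.one_le_sqrt.2 (by norm_num)
    -- Enlarging `γ i` to `√2 γ i` lets the factor `√2` be taken out, and then admissibility
    -- applies; squaring gives `1/(2e)`.
    have h3 : γ i + √(2 * M.σp i / M.σf i) ≤ √2 * (1 / √(4 * Real.exp 1)) := by
      rw [h1]
      nlinarith [Real.sqrt_nonneg (M.σp i / M.σf i)]
    have h4 : (γ i + √(2 * M.σp i / M.σf i)) ^ 2 ≤ (√2 * (1 / √(4 * Real.exp 1))) ^ 2 := by
      gcongr
    rw [mul_pow, div_pow, Real.sq_sqrt (by norm_num), Real.sq_sqrt (by positivity)] at h4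
    calc Real.exp 1 * (γ i + √(2 * M.σp i / M.σf i)) ^ 2
        ≤ Real.exp 1 * (2 * (1 ^ 2 / (4 * Real.exp 1))) := by gcongr
      _ = 1 / 2 := by
        have := Real.exp_pos 1
        field_simp
        norm_num
  log_ge := hn

/-! ### The estimate of the risk of one coordinate -/

/-- The range of the sum has `K - 1` indices, so the summand `1` in `truncOrder` cancels and
`numTerms` remains. -/
lemma randT_eq (γ : ℕ → ℝ) (n i : ℕ) (τ : ℝ≥0∞) (x z : ℝ) :
    M.randT γ n i τ x z
      = threshEst (M.ratio i) (numTerms (γ i) (√(2 * M.σp i / M.σf i)) n) (M.splitSD i τ)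
          (γ i * √(2 * Real.log n)) n (M.splitU i τ x z) (M.splitV i τ x z) := by
  unfold randT threshEst threshold truncTaylorEst clip taylorEst hermiteEst truncOrder numTerms
    splitSD
  rw [Nat.add_sub_cancel_left]

lemma splitSD_eq (hM : M.Positive) (i : ℕ) {τ : ℝ≥0∞} (hτ : τ ≠ ∞) :
    M.splitSD i τ = -(√2 * √(M.σp i) * M.coefD i τ) := by
  have := hM.σp_pos i
  rw [splitSD, Real.sqrt_mul (by positivity), Real.sqrt_mul (by norm_num), Real.sqrt_sq_eq_abs,
    abs_of_neg (coefD_neg hM i hτ)]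
  ring

lemma splitU_eq (hM : M.Positive) (i : ℕ) {τ : ℝ≥0∞} (hτ : τ ≠ ∞) (t y z : ℝ) :
    M.splitU i τ (√(M.σp i) * y + t) z
      = (M.coefC i τ + M.coefD i τ * t) + M.splitSD i τ * (-(y + z) / √2) := by
  have : (√2 : ℝ) ≠ 0 := by positivity
  rw [splitSD_eq hM i hτ, splitU]
  field_simp
  ring

lemma splitV_eq (hM : M.Positive) (i : ℕ) {τ : ℝ≥0∞} (hτ : τ ≠ ∞) (t y z : ℝ) :
    M.splitV i τ (√(M.σp i) * y + t) z
      = (M.coefC i τ + M.coefD i τ * t) + M.splitSD i τ * (-(y - z) / √2) := by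
  have : (√2 : ℝ) ≠ 0 := by positivity
  rw [splitSD_eq hM i hτ, splitV]
  field_simp
  ring

lemma gaussianReal_eq_map (v : ℝ) :
    gaussianReal 0 v.toNNReal = (gaussianReal 0 1).map fun y => √v * y := by
  rw [gaussianReal_map_const_mul]
  congr 1
  · simp
  · ext
    rw [mul_one]
    simp [Real.sq_sqrt', Real.coe_toNNReal']

end Model

lemma sq_integral_le {Ω : Type*} {mΩ : MeasurableSpace Ω} {μ : Measure Ω} [IsProbabilityMeasure μ]
    {f : Ω → ℝ} (hf : MemLp f 2 μ) : (∫ x, f x ∂μ) ^ 2 ≤ ∫ x, f x ^ 2 ∂μ := by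
  have h := variance_nonneg f μ
  rw [variance_eq_sub hf] at h
  simpa using h

lemma integral_abs_linear_le (a b : ℝ) :
    ∫ z, |a + b * z| ∂(gaussianReal 0 1) ≤ |a| + |b| := by
  have h : (∫ z, |a + b * z| ∂(gaussianReal 0 1)) ^ 2
      ≤ ∫ z, |a + b * z| ^ 2 ∂(gaussianReal 0 1) := sq_integral_le (memLp_linear_gaussian a b).abs
  simp only [sq_abs] at h
  rw [integral_linear_sq_gaussian] at h
  refine abs_le_of_sq_le_sq' ?_ (by positivity) |>.2
  refine h.trans ?_
  rw [add_sq, sq_abs, sq_abs]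
  have : 0 ≤ 2 * |a| * |b| := by positivity
  linarith

namespace Model

variable {M : Model}

lemma measurable_randT (γ : ℕ → ℝ) (n i : ℕ) (τ : ℝ≥0∞) :
    Measurable fun p : ℝ × ℝ => M.randT γ n i τ p.1 p.2 := by
  simp_rw [randT_eq]
  refine (measurable_threshEst _ _ _ _ _).comp
    (f := fun p : ℝ × ℝ => (M.splitU i τ p.1 p.2, M.splitV i τ p.1 p.2)) ?_
  unfold splitU splitV
  fun_prop

lemma measurable_coordT (γ : ℕ → ℝ) (n i : ℕ) (τ : ℝ≥0∞) : Measurable (M.coordT γ n i τ) :=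
  ((measurable_randT γ n i τ).stronglyMeasurable.integral_prod_right').measurable

lemma abs_randT_le (hM : M.Positive) (γ : ℕ → ℝ) (n i : ℕ) (τ : ℝ≥0∞) (x z : ℝ) :
    |M.randT γ n i τ x z|
      ≤ |(M.coefC i τ + M.coefD i τ * x) + (M.coefD i τ * √(M.σp i)) * z| + n := by
  rw [randT_eq]
  refine (abs_threshEst_le (ratio_nonneg hM i) (ratio_le_one hM i) _ _ _ _ _ _).trans
    (le_of_eq ?_)
  rw [splitU]
  congr 2
  ring

lemma memLp_randT (hM : M.Positive) (γ : ℕ → ℝ) (n i : ℕ) (τ : ℝ≥0∞) (x : ℝ) :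
    MemLp (fun z => M.randT γ n i τ x z) 2 (gaussianReal 0 1) := by
  have hm : Measurable fun z => M.randT γ n i τ x z :=
    (measurable_randT γ n i τ).comp measurable_prodMk_left
  have h2 : MemLp (fun z : ℝ => |(M.coefC i τ + M.coefD i τ * x)
      + (M.coefD i τ * √(M.σp i)) * z| + n) 2 (gaussianReal 0 1) :=
    (memLp_linear_gaussian _ _).abs.add (memLp_const _)
  refine h2.mono hm.aestronglyMeasurable (ae_of_all _ fun z => ?_)
  rw [Real.norm_eq_abs, Real.norm_eq_abs]
  exact (abs_randT_le hM γ n i τ x z).trans (le_abs_self _)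

lemma abs_coordT_le (hM : M.Positive) (γ : ℕ → ℝ) (n i : ℕ) (τ : ℝ≥0∞) (x : ℝ) :
    |M.coordT γ n i τ x|
      ≤ |M.coefC i τ| + |M.coefD i τ| * |x| + |M.coefD i τ| * √(M.σp i) + n := by
  refine abs_integral_le_integral_abs.trans ?_
  have hl : Integrable (fun z => |(M.coefC i τ + M.coefD i τ * x)
      + (M.coefD i τ * √(M.σp i)) * z|) (gaussianReal 0 1) := (integrable_linear_gaussian _ _).abs
  refine (integral_mono ((memLp_randT hM γ n i τ x).integrable (by norm_num)).abs
    (hl.add (integrable_const (n : ℝ))) fun z => abs_randT_le hM γ n i τ x z).trans ?_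
  simp only [Pi.add_apply]
  rw [integral_add hl (integrable_const _)]
  simp only [integral_const, probReal_univ, smul_eq_mul, one_mul]
  refine add_le_add (integral_abs_linear_le _ _ |>.trans ?_) le_rfl
  rw [abs_mul, abs_of_nonneg (Real.sqrt_nonneg (M.σp i)), ← abs_mul]
  exact add_le_add (abs_add_le _ _) le_rfl

lemma randT_eq_comp (hM : M.Positive) {γ : ℕ → ℝ} {n : ℕ} (i : ℕ) {τ : ℝ≥0∞}
    (hτ : τ ≠ ∞) (t : ℝ) (y z : ℝ) :
    M.randT γ n i τ (√(M.σp i) * y + t) z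
      = (fun p : ℝ × ℝ => threshEst (M.ratio i) (numTerms (γ i) (√(2 * M.σp i / M.σf i)) n)
          (M.splitSD i τ) (γ i * √(2 * Real.log n)) n
          ((M.coefC i τ + M.coefD i τ * t) + M.splitSD i τ * p.1)
          ((M.coefC i τ + M.coefD i τ * t) + M.splitSD i τ * p.2))
        ((fun p : ℝ × ℝ => (-(p.1 + p.2) / √2, -(p.1 - p.2) / √2)) (y, z)) := by
  rw [randT_eq, splitU_eq hM i hτ, splitV_eq hM i hτ]

lemma memLp_randT_prod (hM : M.Positive) {γ : ℕ → ℝ} {n : ℕ} (i : ℕ) {τ : ℝ≥0∞}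
    (hτ : τ ≠ ∞) (t : ℝ) :
    MemLp (fun p : ℝ × ℝ => M.randT γ n i τ (√(M.σp i) * p.1 + t) p.2) 2
      ((gaussianReal 0 1).prod (gaussianReal 0 1)) := by
  simp_rw [randT_eq_comp hM i hτ t]
  exact (memLp_threshEst (ratio_nonneg hM i) (ratio_le_one hM i) _ _ _ _ _).comp_measurePreserving
    measurePreserving_rotation

lemma integral_randT_prod (hM : M.Positive) {γ : ℕ → ℝ} {n : ℕ} (i : ℕ) {τ : ℝ≥0∞}
    (hτ : τ ≠ ∞) (t : ℝ) (φ : ℝ → ℝ) (hφ : Measurable φ) :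
    ∫ p : ℝ × ℝ, φ (M.randT γ n i τ (√(M.σp i) * p.1 + t) p.2)
        ∂((gaussianReal 0 1).prod (gaussianReal 0 1))
      = ∫ p : ℝ × ℝ, φ (threshEst (M.ratio i) (numTerms (γ i) (√(2 * M.σp i / M.σf i)) n)
          (M.splitSD i τ) (γ i * √(2 * Real.log n)) n
          ((M.coefC i τ + M.coefD i τ * t) + M.splitSD i τ * p.1)
          ((M.coefC i τ + M.coefD i τ * t) + M.splitSD i τ * p.2))
        ∂((gaussianReal 0 1).prod (gaussianReal 0 1)) := by
  simp_rw [randT_eq_comp hM i hτ t]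
  have hm : Measurable fun p : ℝ × ℝ => φ (threshEst (M.ratio i)
      (numTerms (γ i) (√(2 * M.σp i / M.σf i)) n)
      (M.splitSD i τ) (γ i * √(2 * Real.log n)) n
      ((M.coefC i τ + M.coefD i τ * t) + M.splitSD i τ * p.1)
      ((M.coefC i τ + M.coefD i τ * t) + M.splitSD i τ * p.2)) :=
    hφ.comp ((measurable_threshEst _ _ _ _ _).comp (f := fun p : ℝ × ℝ =>
      ((M.coefC i τ + M.coefD i τ * t) + M.splitSD i τ * p.1,
        (M.coefC i τ + M.coefD i τ * t) + M.splitSD i τ * p.2)) (by fun_prop))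
  conv_rhs => rw [← measurePreserving_rotation.map_eq]
  rw [integral_map (by fun_prop) hm.aestronglyMeasurable]

/-- Observation and added noise become the independent pair `(U, V)` by rotation, so the bounds for
the threshold estimate apply. Averaging over the noise keeps the mean and, by Jensen's inequality,
does not increase the squared error. The point `τ = ∞` is excluded since `coefD` and the split
variance vanish there. -/
lemma coordT_moments (hM : M.Positive) {γ : ℕ → ℝ} {g₀ : ℝ} (hg₀ : 0 < g₀) (hγ₀ : ∀ i, g₀ ≤ γ i)
    (hγ : ∀ i, γ i < 1 / √(4 * Real.exp 1) - √(M.σp i / M.σf i)) {n : ℕ}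
    (hn : 1 ≤ Real.log n) (i : ℕ) {τ : ℝ≥0∞} (hτ : τ ≠ ∞) (t : ℝ) :
    MemLp (fun y => M.coordT γ n i τ (y + t)) 2 (gaussianReal 0 (M.σp i).toNNReal) ∧
      |(∫ y, M.coordT γ n i τ (y + t) ∂(gaussianReal 0 (M.σp i).toNNReal))
          - G (M.coefC i τ + M.coefD i τ * t) (M.ratio i)| ≤ biasRate g₀ n ∧
      ∫ y, (M.coordT γ n i τ (y + t) - G (M.coefC i τ + M.coefD i τ * t) (M.ratio i)) ^ 2
        ∂(gaussianReal 0 (M.σp i).toNNReal) ≤ mseRate n := by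
  have hP := threshParams hM hg₀ hγ₀ hγ hn i hτ
  set w := M.coefC i τ + M.coefD i τ * t with hw
  set β := M.ratio i
  have hmc : Measurable fun y => M.coordT γ n i τ (y + t) :=
    (measurable_coordT γ n i τ).comp (measurable_id.add_const t)
  have hL := memLp_randT_prod (γ := γ) (n := n) hM i hτ t
  have hLG : MemLp (fun p : ℝ × ℝ => M.randT γ n i τ (√(M.σp i) * p.1 + t) p.2 - G w β) 2
      ((gaussianReal 0 1).prod (gaussianReal 0 1)) := hL.sub (memLp_const _)
  have hjen : ∀ y, (M.coordT γ n i τ (√(M.σp i) * y + t) - G w β) ^ 2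
      ≤ ∫ z, (M.randT γ n i τ (√(M.σp i) * y + t) z - G w β) ^ 2 ∂(gaussianReal 0 1) := by
    intro y
    have hf := memLp_randT hM γ n i τ (√(M.σp i) * y + t)
    have h := sq_integral_le (hf.sub (memLp_const (G w β)))
    simp only [Pi.sub_apply] at h
    rw [integral_sub (hf.integrable (by norm_num)) (integrable_const _)] at h
    simpa [coordT] using h
  have hsq := hLG.integrable_sq
  have hdom := hsq.integral_prod_left
  simp only at hdom
  have hint : Integrable (fun y => (M.coordT γ n i τ (√(M.σp i) * y + t) - G w β) ^ 2)
      (gaussianReal 0 1) := by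
    refine hdom.mono' ?_ (ae_of_all _ fun y => ?_)
    · exact (((hmc.comp (measurable_const_mul (√(M.σp i)))).sub_const _).pow_const
        2).aestronglyMeasurable
    · rw [Real.norm_eq_abs, abs_of_nonneg (sq_nonneg _)]
      exact hjen y
  have hmem : MemLp (fun y => M.coordT γ n i τ (√(M.σp i) * y + t)) 2 (gaussianReal 0 1) := by
    have h1 : MemLp (fun y => M.coordT γ n i τ (√(M.σp i) * y + t) - G w β) 2
        (gaussianReal 0 1) := by
      refine (memLp_two_iff_integrable_sq ?_).2 hint
      exact ((hmc.comp (measurable_const_mul (√(M.σp i)))).sub_const _).aestronglyMeasurable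
    have h2 := h1.add (memLp_const (G w β))
    refine h2.ae_eq (ae_of_all _ fun y => ?_)
    simp
  rw [gaussianReal_eq_map]
  refine ⟨?_, ?_, ?_⟩
  · rw [memLp_map_measure_iff hmc.aestronglyMeasurable (by fun_prop)]
    exact hmem
  · rw [integral_map (by fun_prop) hmc.aestronglyMeasurable]
    have h1 := integral_prod _ (hL.integrable (by norm_num))
    have h2 := integral_randT_prod (γ := γ) (n := n) hM i hτ t id measurable_id
    simp only [id] at h2
    rw [h2] at h1
    have h3 := hP.abs_bias_le w
    rw [h1] at h3
    exact h3
  · rw [integral_map (by fun_prop)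
      (((hmc.sub_const _).pow_const 2).aestronglyMeasurable)]
    refine (integral_mono hint hdom hjen).trans ?_
    have h1 := integral_prod _ hsq
    have h2 := integral_randT_prod (γ := γ) (n := n) hM i hτ t (fun u => (u - G w β) ^ 2)
      (by fun_prop)
    rw [h2] at h1
    rw [← h1]
    exact hP.mse_le w

end Model

/-! ### Comparison of normal laws -/

lemma sq_integral_mul_le {Ω : Type*} {mΩ : MeasurableSpace Ω} {μ : Measure Ω} {f g : Ω → ℝ}
    (hf : MemLp f 2 μ) (hg : MemLp g 2 μ) :
    (∫ x, f x * g x ∂μ) ^ 2 ≤ (∫ x, f x ^ 2 ∂μ) * ∫ x, g x ^ 2 ∂μ := by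
  have hfg : Integrable (fun x => f x * g x) μ := hf.integrable_mul hg
  have h : ∀ t : ℝ, 0 ≤ (∫ x, g x ^ 2 ∂μ) * (t * t) + (2 * ∫ x, f x * g x ∂μ) * t
      + ∫ x, f x ^ 2 ∂μ := by
    intro t
    have h1 : 0 ≤ ∫ x, (f x + t * g x) ^ 2 ∂μ := integral_nonneg fun x => sq_nonneg _
    have e : (fun x => (f x + t * g x) ^ 2)
        = fun x => (f x ^ 2 + (2 * t) * (f x * g x)) + t ^ 2 * g x ^ 2 := by
      funext x; ring
    rw [e, integral_add (hf.integrable_sq.fun_add (hfg.const_mul _)) (hg.integrable_sq.const_mul _),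
      integral_add hf.integrable_sq (hfg.const_mul _), integral_const_mul, integral_const_mul] at h1
    linarith
  have := discrim_le_zero h
  rw [discrim] at this
  linarith

lemma integral_gaussianReal_eq {v : ℝ} (hv : 0 < v) (c : ℝ) (f : ℝ → ℝ) :
    ∫ x, f x ∂(gaussianReal c v.toNNReal) = ∫ x, gaussianPDFReal c v.toNNReal x * f x := by
  rw [integral_gaussianReal_eq_integral_smul (by simpa using hv)]
  rfl

lemma gaussianPDFReal_toNNReal {v : ℝ} (hv : 0 < v) (c x : ℝ) :
    gaussianPDFReal c v.toNNReal x
      = (√(2 * Real.pi * v))⁻¹ * Real.exp (-(x - c) ^ 2 / (2 * v)) := by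
  rw [gaussianPDFReal, Real.coe_toNNReal _ hv.le]

lemma integrable_gaussianReal_iff {v : ℝ} (hv : 0 < v) (c : ℝ) (f : ℝ → ℝ) :
    Integrable f (gaussianReal c v.toNNReal)
      ↔ Integrable fun x => gaussianPDFReal c v.toNNReal x * f x := by
  rw [gaussianReal_of_var_ne_zero _ (by simpa using hv),
    integrable_withDensity_iff_integrable_smul' (measurable_gaussianPDF _ _)
    (by simp [gaussianPDF])]
  refine integrable_congr (ae_of_all _ fun x => ?_)
  simp [toReal_gaussianPDF]

/-- Completing the square shows that `p²/q` is a constant times a normal density. That constant is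
one plus the `χ²`-distance; `v < 2σ` is the condition for it to be finite. -/
lemma gaussianPDFReal_sq {v σ : ℝ} (hv : 0 < v) (hσ : 0 < σ) (h : v < 2 * σ) (c x : ℝ) :
    gaussianPDFReal c v.toNNReal x ^ 2
      = (σ / √(v * (2 * σ - v)) * Real.exp (c ^ 2 / (2 * σ - v)))
        * (gaussianPDFReal (2 * σ * c / (2 * σ - v)) (v * σ / (2 * σ - v)).toNNReal x
          * gaussianPDFReal 0 σ.toNNReal x) := by
  have hd : 0 < 2 * σ - v := by linarith
  have hv' : 0 < v * σ / (2 * σ - v) := by positivity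
  rw [gaussianPDFReal_toNNReal hv, gaussianPDFReal_toNNReal hσ, gaussianPDFReal_toNNReal hv',
    mul_pow, ← Real.exp_nat_mul]
  have e1 : ((√(2 * Real.pi * v))⁻¹) ^ 2 = σ / √(v * (2 * σ - v))
      * ((√(2 * Real.pi * (v * σ / (2 * σ - v))))⁻¹ * (√(2 * Real.pi * σ))⁻¹) := by
    have hp := Real.pi_pos
    rw [← mul_inv, ← Real.sqrt_mul (by positivity), inv_pow, Real.sq_sqrt (by positivity),
      div_mul_eq_mul_div, ← div_eq_mul_inv, div_div, ← Real.sqrt_mul (by positivity)]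
    have e : 2 * Real.pi * (v * σ / (2 * σ - v)) * (2 * Real.pi * σ) * (v * (2 * σ - v))
        = (2 * Real.pi * v * σ) ^ 2 := by
      field_simp
    rw [e, Real.sqrt_sq (by positivity)]
    field_simp
  have e2 : ((2 : ℕ) : ℝ) * (-(x - c) ^ 2 / (2 * v)) = c ^ 2 / (2 * σ - v)
      + (-(x - 2 * σ * c / (2 * σ - v)) ^ 2 / (2 * (v * σ / (2 * σ - v)))
        + -(x - 0) ^ 2 / (2 * σ)) := by
    field_simp
    push_cast
    ring
  rw [e1, e2, Real.exp_add, Real.exp_add]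
  ring

/-- The `χ²`-distance of `N(c, v)` from `N(0, σ)` controls the effect on centered functions. -/
lemma sq_integral_gaussianReal_le {v σ : ℝ} (hv : 0 < v) (hσ : 0 < σ) (h : v < 2 * σ) (c : ℝ)
    {f : ℝ → ℝ} (hf : MemLp f 2 (gaussianReal 0 σ.toNNReal))
    (h0 : ∫ x, f x ∂(gaussianReal 0 σ.toNNReal) = 0) :
    (∫ x, f x ∂(gaussianReal c v.toNNReal)) ^ 2
      ≤ (σ / √(v * (2 * σ - v)) * Real.exp (c ^ 2 / (2 * σ - v)) - 1)
        * ∫ x, f x ^ 2 ∂(gaussianReal 0 σ.toNNReal) := by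
  have hd : 0 < 2 * σ - v := by linarith
  have hv' : 0 < v * σ / (2 * σ - v) := by positivity
  set p := gaussianPDFReal c v.toNNReal with hp
  set q := gaussianPDFReal 0 σ.toNNReal with hq
  set k := gaussianPDFReal (2 * σ * c / (2 * σ - v)) (v * σ / (2 * σ - v)).toNNReal with hk
  set K := σ / √(v * (2 * σ - v)) * Real.exp (c ^ 2 / (2 * σ - v)) with hK
  have hq0 : ∀ x, 0 < q x := fun x => gaussianPDFReal_pos _ _ _ (by simpa using hσ)
  have hr2 : ∀ x, q x * (p x / q x) ^ 2 = K * k x := by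
    intro x
    have h2 : p x ^ 2 = K * (k x * q x) := gaussianPDFReal_sq hv hσ h c x
    have hne := (hq0 x).ne'
    rw [div_pow, h2]
    field_simp
  have hi2 : Integrable (fun x => (p x / q x) ^ 2) (gaussianReal 0 σ.toNNReal) := by
    rw [integrable_gaussianReal_iff hσ]
    simp_rw [← hq, hr2]
    exact (integrable_gaussianPDFReal _ _).const_mul _
  have hrm : MemLp (fun x => p x / q x) 2 (gaussianReal 0 σ.toNNReal) :=
    (memLp_two_iff_integrable_sq (((measurable_gaussianPDFReal _ _).div
      (measurable_gaussianPDFReal _ _)).aestronglyMeasurable)).2 hi2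
  have I2 : ∫ x, (p x / q x) ^ 2 ∂(gaussianReal 0 σ.toNNReal) = K := by
    rw [integral_gaussianReal_eq hσ]
    simp_rw [← hq, hr2]
    rw [integral_const_mul, hk, integral_gaussianPDFReal_eq_one _ (by simpa using hv'), mul_one]
  have hchange : ∀ g : ℝ → ℝ, ∫ x, g x ∂(gaussianReal c v.toNNReal)
      = ∫ x, g x * (p x / q x) ∂(gaussianReal 0 σ.toNNReal) := by
    intro g
    rw [integral_gaussianReal_eq hσ, integral_gaussianReal_eq hv]
    refine integral_congr_ae (ae_of_all _ fun x => ?_)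
    have hne := (hq0 x).ne'
    simp only [← hp, ← hq]
    field_simp
  have I1 : ∫ x, (p x / q x) ∂(gaussianReal 0 σ.toNNReal) = 1 := by
    have := hchange fun _ => 1
    simpa using this.symm
  have hrm1 : MemLp (fun x => p x / q x - 1) 2 (gaussianReal 0 σ.toNNReal) :=
    hrm.sub (memLp_const 1)
  have hri := hrm.integrable (by norm_num)
  have I3 : ∫ x, (p x / q x - 1) ^ 2 ∂(gaussianReal 0 σ.toNNReal) = K - 1 := by
    have e : (fun x => (p x / q x - 1) ^ 2)
        = fun x => ((p x / q x) ^ 2 - 2 * (p x / q x)) + 1 := by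
      funext x; ring
    have i : Integrable (fun x => (p x / q x) ^ 2 - 2 * (p x / q x))
        (gaussianReal 0 σ.toNNReal) := hi2.sub (hri.const_mul 2)
    rw [e, integral_add i (integrable_const _),
      integral_sub hi2 (hri.const_mul 2), integral_const_mul, I1, I2]
    simp
    ring
  -- As `f` is centered under `q`, the likelihood ratio may be replaced by its deviation from `1`.
  have e1 : ∫ x, f x ∂(gaussianReal c v.toNNReal)
      = ∫ x, f x * (p x / q x - 1) ∂(gaussianReal 0 σ.toNNReal) := by
    rw [hchange f]
    simp_rw [mul_sub, mul_one]
    have hfr : Integrable (fun x => f x * (p x / q x)) (gaussianReal 0 σ.toNNReal) :=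
      hf.integrable_mul hrm
    rw [integral_sub hfr (hf.integrable (by norm_num)), h0, sub_zero]
  rw [e1, ← I3, mul_comm]
  exact sq_integral_mul_le hf hrm1

lemma gaussianPDFReal_mul_exp_sq {v a : ℝ} (hv : 0 < v) (h : 2 * a * v < 1) (x : ℝ) :
    gaussianPDFReal 0 v.toNNReal x * Real.exp (a * x ^ 2)
      = (√(1 - 2 * a * v))⁻¹ * gaussianPDFReal 0 (v / (1 - 2 * a * v)).toNNReal x := by
  have hd : 0 < 1 - 2 * a * v := by linarith
  have hv' : 0 < v / (1 - 2 * a * v) := by positivity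
  have hp := Real.pi_pos
  rw [gaussianPDFReal_toNNReal hv, gaussianPDFReal_toNNReal hv', mul_assoc, ← Real.exp_add,
    ← mul_assoc, ← mul_inv, ← Real.sqrt_mul hd.le]
  congr 3
  · field_simp
    exact (div_self (by linarith)).symm
  · field_simp
    ring

lemma integrable_exp_sq_gaussianReal {v a : ℝ} (hv : 0 < v) (h : 2 * a * v < 1) :
    Integrable (fun x => Real.exp (a * x ^ 2)) (gaussianReal 0 v.toNNReal) := by
  rw [integrable_gaussianReal_iff hv]
  simp_rw [gaussianPDFReal_mul_exp_sq hv h]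
  exact (integrable_gaussianPDFReal _ _).const_mul _

lemma integral_exp_sq_gaussianReal {v a : ℝ} (hv : 0 < v) (h : 2 * a * v < 1) :
    ∫ x, Real.exp (a * x ^ 2) ∂(gaussianReal 0 v.toNNReal) = (√(1 - 2 * a * v))⁻¹ := by
  have hd : 0 < 1 - 2 * a * v := by linarith
  have hv' : 0 < v / (1 - 2 * a * v) := by positivity
  rw [integral_gaussianReal_eq hv]
  simp_rw [gaussianPDFReal_mul_exp_sq hv h]
  rw [integral_const_mul, integral_gaussianPDFReal_eq_one _ (by simpa using hv'), mul_one]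

lemma memLp_of_abs_le_linear {f : ℝ → ℝ} (hf : Measurable f) {A : ℝ}
    (hb : ∀ x, |f x| ≤ A * (1 + |x|)) (c : ℝ) (v : NNReal) : MemLp f 2 (gaussianReal c v) := by
  have h : MemLp (fun x : ℝ => A * (1 + |x|)) 2 (gaussianReal c v) :=
    ((memLp_const (1 : ℝ)).add (memLp_id_gaussianReal' 2 (by norm_num)).abs).const_mul A
  refine h.mono hf.aestronglyMeasurable (ae_of_all _ fun x => ?_)
  rw [Real.norm_eq_abs, Real.norm_eq_abs]
  exact (hb x).trans (le_abs_self _)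

lemma integral_pow_gaussianReal {v : ℝ} (hv : 0 ≤ v) (k : ℕ) :
    ∫ x, x ^ (2 * k) ∂(gaussianReal 0 v.toNNReal)
      = v ^ k * ∫ z, z ^ (2 * k) ∂(gaussianReal 0 1) := by
  rw [Model.gaussianReal_eq_map, integral_map (by fun_prop) (by fun_prop), ← integral_const_mul]
  refine integral_congr_ae (ae_of_all _ fun z => ?_)
  simp only [mul_pow]
  rw [pow_mul (√v), Real.sq_sqrt hv]

/-- Constant in the comparison of second moments under nearby normal laws. -/
noncomputable def momentConst (c C B : ℝ) : ℝ :=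
  2 * Real.exp (2 * C / c ^ 2) + 2 * B ^ 2 * ((2 * C) ^ 2 * ∫ z, z ^ 4 ∂(gaussianReal 0 1))
    + 2 * B ^ 2 * ((2 * C) ^ 3 * ∫ z, z ^ 6 ∂(gaussianReal 0 1))

/-- Where `x² ≤ n` the two densities are comparable, since the variances differ by `O(1/n)`. Where
`x² > n`, the growth factor `n²` of `f²` is at most `x⁴`, and fixed moments of the normal law
suffice. Hence the factor `n` in the growth of `f` does not enter the bound. -/
lemma integral_sq_perturb {c C B : ℝ} (hc : 0 < c) {n : ℕ} (hn : 16 * C / c ≤ n) (hn0 : 0 < n)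
    {σ σ' : ℝ} (hσ : c ≤ σ) (hσC : σ ≤ C) (hd : |σ' - σ| ≤ 2 * C / n) {f : ℝ → ℝ}
    (hf : Measurable f) (hb : ∀ x, |f x| ≤ B * n * (1 + |x|)) :
    ∫ x, f x ^ 2 ∂(gaussianReal 0 σ'.toNNReal)
      ≤ momentConst c C B * ((∫ x, f x ^ 2 ∂(gaussianReal 0 σ.toNNReal)) + 1) := by
  have hn' : (0 : ℝ) < n := Nat.cast_pos.2 hn0
  have hC : 0 < C := by linarith
  have hσ0 : 0 < σ := by linarith
  have hκ : 2 * C / n ≤ c / 8 := by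
    rw [div_le_iff₀ hc] at hn
    rw [div_le_div_iff₀ hn' (by norm_num)]
    linarith
  obtain ⟨hd1, hd2⟩ := abs_le.1 hd
  have hσ'0 : c / 2 ≤ σ' := by linarith
  have hσ'p : 0 < σ' := by linarith
  have hσ'C : σ' ≤ 2 * C := by linarith
  have m1 := memLp_of_abs_le_linear hf hb 0 σ.toNNReal
  have m2 := memLp_of_abs_le_linear hf hb 0 σ'.toNNReal
  have i1 := m1.integrable_sq
  have i2 := m2.integrable_sq
  have hp4 := integrable_pow_gaussianReal 0 σ'.toNNReal 4
  have hp6 := integrable_pow_gaussianReal 0 σ'.toNNReal 6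
  have hpt : ∀ x, gaussianPDFReal 0 σ'.toNNReal x * f x ^ 2
      ≤ 2 * Real.exp (2 * C / c ^ 2) * (gaussianPDFReal 0 σ.toNNReal x * f x ^ 2)
        + gaussianPDFReal 0 σ'.toNNReal x * (2 * B ^ 2 * (x ^ 4 + x ^ 6)) := by
    intro x
    have hp0 := gaussianPDFReal_nonneg 0 σ'.toNNReal x
    have hq0 := gaussianPDFReal_nonneg 0 σ.toNNReal x
    rcases le_or_gt (x ^ 2) n with hx | hx
    · have h1 : gaussianPDFReal 0 σ'.toNNReal x
          ≤ 2 * Real.exp (2 * C / c ^ 2) * gaussianPDFReal 0 σ.toNNReal x := by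
        rw [gaussianPDFReal_toNNReal hσ0, gaussianPDFReal_toNNReal hσ'p, sub_zero]
        have hp := Real.pi_pos
        have a1 : (√(2 * Real.pi * σ'))⁻¹ ≤ 2 * (√(2 * Real.pi * σ))⁻¹ := by
          have : √(2 * Real.pi * σ) ≤ 2 * √(2 * Real.pi * σ') := by
            rw [show (2 : ℝ) * √(2 * Real.pi * σ') = √(2 ^ 2 * (2 * Real.pi * σ')) by
              rw [Real.sqrt_mul (x := 2 ^ 2) (by norm_num), Real.sqrt_sq (by norm_num)]]
            refine Real.sqrt_le_sqrt ?_
            nlinarith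
          rw [← div_eq_mul_inv, inv_eq_one_div, div_le_div_iff₀ (by positivity) (by positivity)]
          linarith
        have a2 : Real.exp (-x ^ 2 / (2 * σ'))
            ≤ Real.exp (2 * C / c ^ 2) * Real.exp (-x ^ 2 / (2 * σ)) := by
          rw [← Real.exp_add, Real.exp_le_exp]
          have e : -x ^ 2 / (2 * σ') = x ^ 2 * (σ' - σ) / (2 * σ * σ') + -x ^ 2 / (2 * σ) := by
            field_simp
            ring
          rw [e]
          refine add_le_add ?_ le_rfl
          rw [div_le_div_iff₀ (by positivity) (by positivity)]
          -- Here `x² ≤ n` meets the gap `2C/n` of the variances; the exponents then differ by at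
          -- most `2C/c²`.
          have b1 : x ^ 2 * (σ' - σ) ≤ n * (2 * C / n) := by
            calc x ^ 2 * (σ' - σ) ≤ x ^ 2 * (2 * C / n) := by gcongr
              _ ≤ n * (2 * C / n) := by gcongr
          rw [mul_div_cancel₀ _ hn'.ne'] at b1
          have b2 : c ^ 2 ≤ 2 * σ * σ' := by nlinarith
          calc x ^ 2 * (σ' - σ) * c ^ 2 ≤ 2 * C * c ^ 2 := by gcongr
            _ ≤ 2 * C * (2 * σ * σ') := by gcongr
        calc _ ≤ (2 * (√(2 * Real.pi * σ))⁻¹)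
              * (Real.exp (2 * C / c ^ 2) * Real.exp (-x ^ 2 / (2 * σ))) := by gcongr
          _ = _ := by ring
      have h2 : 0 ≤ gaussianPDFReal 0 σ'.toNNReal x * (2 * B ^ 2 * (x ^ 4 + x ^ 6)) := by
        have : 0 ≤ x ^ 4 + x ^ 6 := by positivity
        positivity
      nlinarith [mul_le_mul_of_nonneg_right h1 (sq_nonneg (f x))]
    · have h1 : f x ^ 2 ≤ 2 * B ^ 2 * (x ^ 4 + x ^ 6) := by
        have a1 : f x ^ 2 ≤ (B * n * (1 + |x|)) ^ 2 := by
          rw [← sq_abs]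
          exact pow_le_pow_left₀ (abs_nonneg _) (hb x) 2
        have a2 : (1 + |x|) ^ 2 ≤ 2 * (1 + x ^ 2) := by
          rw [← sq_abs x]; nlinarith [sq_nonneg (|x| - 1)]
        have a3 : (n : ℝ) ^ 2 ≤ x ^ 4 := by
          calc (n : ℝ) ^ 2 ≤ (x ^ 2) ^ 2 := by gcongr
            _ = x ^ 4 := by ring
        calc f x ^ 2 ≤ B ^ 2 * (n ^ 2 * (1 + |x|) ^ 2) := by linarith
          _ ≤ B ^ 2 * (x ^ 4 * (2 * (1 + x ^ 2))) := by gcongr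
          _ = _ := by ring
      have h2 : 0 ≤ 2 * Real.exp (2 * C / c ^ 2)
          * (gaussianPDFReal 0 σ.toNNReal x * f x ^ 2) := by positivity
      nlinarith [mul_le_mul_of_nonneg_left h1 hp0]
  have i1' := (integrable_gaussianReal_iff hσ0 0 _).1 i1
  have i2' := (integrable_gaussianReal_iff hσ'p 0 _).1 i2
  have i3 : Integrable (fun x : ℝ => 2 * B ^ 2 * (x ^ 4 + x ^ 6)) (gaussianReal 0 σ'.toNNReal) :=
    (hp4.fun_add hp6).const_mul _
  have i3' := (integrable_gaussianReal_iff hσ'p 0 _).1 i3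
  have hI := integral_mono i2' ((i1'.const_mul (2 * Real.exp (2 * C / c ^ 2))).fun_add i3') hpt
  rw [integral_add (i1'.const_mul _) i3', integral_const_mul, ← integral_gaussianReal_eq hσ0,
    ← integral_gaussianReal_eq hσ'p, ← integral_gaussianReal_eq hσ'p, integral_const_mul,
    integral_add hp4 hp6] at hI
  have e4 := integral_pow_gaussianReal hσ'p.le 2
  have e6 := integral_pow_gaussianReal hσ'p.le 3
  norm_num at e4 e6
  rw [e4, e6] at hI
  have q4 : 0 ≤ ∫ z, z ^ 4 ∂(gaussianReal 0 1) := integral_nonneg fun z => by positivity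
  have q6 : 0 ≤ ∫ z, z ^ 6 ∂(gaussianReal 0 1) := integral_nonneg fun z => by positivity
  have r4 : σ' ^ 2 * ∫ z, z ^ 4 ∂(gaussianReal 0 1)
      ≤ (2 * C) ^ 2 * ∫ z, z ^ 4 ∂(gaussianReal 0 1) := by gcongr
  have r6 : σ' ^ 3 * ∫ z, z ^ 6 ∂(gaussianReal 0 1)
      ≤ (2 * C) ^ 3 * ∫ z, z ^ 6 ∂(gaussianReal 0 1) := by gcongr
  have hV : 0 ≤ ∫ x, f x ^ 2 ∂(gaussianReal 0 σ.toNNReal) := integral_nonneg fun x => sq_nonneg _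
  rw [momentConst]
  generalize (∫ x, f x ^ 2 ∂(gaussianReal 0 σ.toNNReal)) = V at *
  generalize (∫ z, z ^ 4 ∂(gaussianReal 0 1)) = M4 at *
  generalize (∫ z, z ^ 6 ∂(gaussianReal 0 1)) = M6 at *
  have s4 := mul_le_mul_of_nonneg_left r4 (by positivity : 0 ≤ 2 * B ^ 2)
  have s6 := mul_le_mul_of_nonneg_left r6 (by positivity : 0 ≤ 2 * B ^ 2)
  have t4 : 0 ≤ 2 * B ^ 2 * ((2 * C) ^ 2 * M4) := by positivity
  have t6 : 0 ≤ 2 * B ^ 2 * ((2 * C) ^ 3 * M6) := by positivity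
  have t0 := (Real.exp_pos (2 * C / c ^ 2)).le
  have t4V := mul_nonneg t4 hV
  have t6V := mul_nonneg t6 hV
  linarith

/-! ### Linear forms in independent normal variables -/

/-- Law of independent centered normal variables with variances `σ i`. -/
noncomputable def centeredLaw {n : ℕ} (σ : Fin n → ℝ) : Measure (Fin n → ℝ) :=
  Measure.pi fun i => gaussianReal 0 (σ i).toNNReal

instance {n : ℕ} (σ : Fin n → ℝ) : IsProbabilityMeasure (centeredLaw σ) := by
  unfold centeredLaw; infer_instance

/-- The linear form with coefficients `a`. -/
def linForm {n : ℕ} (a : Fin n → ℝ) (y : Fin n → ℝ) : ℝ := ∑ k, a k * y k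

lemma measurable_linForm {n : ℕ} (a : Fin n → ℝ) : Measurable (linForm a) := by
  unfold linForm; fun_prop

lemma measurePreserving_eval_centeredLaw {n : ℕ} (σ : Fin n → ℝ) (i : Fin n) :
    MeasurePreserving (fun y : Fin n → ℝ => y i) (centeredLaw σ)
      (gaussianReal 0 (σ i).toNNReal) :=
  measurePreserving_eval (fun i => gaussianReal 0 (σ i).toNNReal) i

lemma integral_eval_centeredLaw {n : ℕ} (σ : Fin n → ℝ) (i : Fin n) {f : ℝ → ℝ}
    (hf : Measurable f) :
    ∫ y : Fin n → ℝ, f (y i) ∂(centeredLaw σ) = ∫ x, f x ∂(gaussianReal 0 (σ i).toNNReal) := by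
  rw [← (measurePreserving_eval_centeredLaw σ i).map_eq,
    integral_map (measurable_pi_apply i).aemeasurable hf.aestronglyMeasurable]

lemma memLp_eval_centeredLaw {n : ℕ} (σ : Fin n → ℝ) (i : Fin n) :
    MemLp (fun y : Fin n → ℝ => y i) 2 (centeredLaw σ) :=
  (memLp_id_gaussianReal' 2 (by norm_num)).comp_measurePreserving
    (measurePreserving_eval_centeredLaw σ i)

lemma iIndepFun_centeredLaw {n : ℕ} (σ : Fin n → ℝ) :
    iIndepFun (fun (i : Fin n) (y : Fin n → ℝ) => y i) (centeredLaw σ) :=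
  iIndepFun_pi (X := fun _ x => x) fun _ => aemeasurable_id

lemma covariance_eval_centeredLaw {n : ℕ} {σ : Fin n → ℝ} (hσ : ∀ i, 0 ≤ σ i) (i j : Fin n) :
    cov[fun y : Fin n → ℝ => y i, fun y => y j; centeredLaw σ] = if i = j then σ i else 0 := by
  split_ifs with h
  · subst h
    rw [covariance_self (measurable_pi_apply i).aemeasurable,
      (measurePreserving_eval_centeredLaw σ i).variance_fun_comp (f := fun x => x) (by fun_prop),
      variance_fun_id_gaussianReal, Real.coe_toNNReal _ (hσ i)]
  · exact ((iIndepFun_centeredLaw σ).indepFun h).covariance_eq_zero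
      (memLp_eval_centeredLaw σ i) (memLp_eval_centeredLaw σ j)

lemma covariance_linForm {n : ℕ} {σ : Fin n → ℝ} (hσ : ∀ i, 0 ≤ σ i) (a b : Fin n → ℝ) :
    cov[linForm a, linForm b; centeredLaw σ] = ∑ k, a k * b k * σ k := by
  have h1 : linForm a = fun y => ∑ k, a k * y k := rfl
  have h2 : linForm b = fun y => ∑ k, b k * y k := rfl
  rw [h1, h2, covariance_fun_sum_fun_sum (fun i => (memLp_eval_centeredLaw σ i).const_mul _)
    (fun i => (memLp_eval_centeredLaw σ i).const_mul _)]
  simp_rw [covariance_const_mul_left, covariance_const_mul_right, covariance_eval_centeredLaw hσ]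
  refine Finset.sum_congr rfl fun i _ => ?_
  simp
  ring

lemma hasGaussianLaw_linForm_pair {n : ℕ} (σ : Fin n → ℝ) (a b : Fin n → ℝ) :
    HasGaussianLaw (fun y => (linForm a y, linForm b y)) (centeredLaw σ) := by
  have h : HasGaussianLaw (fun y : Fin n → ℝ => (y ·)) (centeredLaw σ) := by
    refine iIndepFun.hasGaussianLaw (X := fun i (y : Fin n → ℝ) => y i) (fun i => ⟨?_⟩)
      (iIndepFun_centeredLaw σ)
    rw [(measurePreserving_eval_centeredLaw σ i).map_eq]
    infer_instance
  have := h.map_fun (((∑ k, a k • ContinuousLinearMap.proj (R := ℝ) (φ := fun _ : Fin n => ℝ) k).prod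
    (∑ k, b k • ContinuousLinearMap.proj (R := ℝ) (φ := fun _ : Fin n => ℝ) k)))
  refine this.congr (ae_of_all _ fun y => ?_)
  simp [linForm]

lemma map_linForm {n : ℕ} {σ : Fin n → ℝ} (hσ : ∀ i, 0 ≤ σ i) (a : Fin n → ℝ) :
    (centeredLaw σ).map (linForm a) = gaussianReal 0 (∑ k, a k ^ 2 * σ k).toNNReal := by
  have h := (hasGaussianLaw_linForm_pair σ a a).fst
  rw [h.map_eq_gaussianReal, ← covariance_self (measurable_linForm a).aemeasurable,
    covariance_linForm hσ]
  congr 2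
  · unfold linForm
    rw [integral_finsetSum _ fun i _ => ((memLp_eval_centeredLaw σ i).integrable
      (by norm_num)).const_mul _]
    refine Finset.sum_eq_zero fun i _ => ?_
    rw [integral_const_mul]
    rw [integral_eval_centeredLaw σ i (f := fun x => x) measurable_id, integral_id_gaussianReal,
      mul_zero]
  · refine Finset.sum_congr rfl fun i _ => ?_
    ring

/-- Gaussian regression: for the slope `ρ` the residual `b - ρ a` is uncorrelated with, hence
independent of, the form `a`. Conditionally on the value `x` of `a`, the form `b` is therefore
normal with mean `ρ x`. -/
lemma integral_linForm_mul {n : ℕ} {σ : Fin n → ℝ} (hσ : ∀ i, 0 ≤ σ i) (a b : Fin n → ℝ)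
    {ρ : ℝ} (hρ : ∑ k, a k * (b k - ρ * a k) * σ k = 0) {f g : ℝ → ℝ} (hf : Measurable f)
    (hg : Measurable g)
    (hfg : Integrable (fun y => f (linForm a y) * g (linForm b y)) (centeredLaw σ)) :
    ∫ y, f (linForm a y) * g (linForm b y) ∂(centeredLaw σ)
      = ∫ x, f x * ∫ w, g w ∂(gaussianReal (ρ * x) (∑ k, (b k - ρ * a k) ^ 2 * σ k).toNNReal)
          ∂(gaussianReal 0 (∑ k, a k ^ 2 * σ k).toNNReal) := by
  set b' : Fin n → ℝ := fun k => b k - ρ * a k with hb'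
  have hb : ∀ y, linForm b y = ρ * linForm a y + linForm b' y := by
    intro y
    simp only [linForm, hb', Finset.mul_sum, ← Finset.sum_add_distrib]
    refine Finset.sum_congr rfl fun k _ => ?_
    ring
  have hind : IndepFun (linForm a) (linForm b') (centeredLaw σ) :=
    (hasGaussianLaw_linForm_pair σ a b').indepFun_of_covariance_eq_zero
      (by rw [covariance_linForm hσ]; exact hρ)
  have hma := measurable_linForm a
  have hmb := measurable_linForm b'
  have hmap := (indepFun_iff_map_prod_eq_prod_map_map hma.aemeasurable hmb.aemeasurable).1 hind
  rw [map_linForm hσ, map_linForm hσ] at hmap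
  simp_rw [hb] at hfg ⊢
  have hF : Measurable fun p : ℝ × ℝ => f p.1 * g (ρ * p.1 + p.2) := by fun_prop
  have e1 := integral_map (μ := centeredLaw σ) (hma.prodMk hmb).aemeasurable
    (f := fun p : ℝ × ℝ => f p.1 * g (ρ * p.1 + p.2)) hF.aestronglyMeasurable
  have i1 := (integrable_map_measure (μ := centeredLaw σ)
    (g := fun p : ℝ × ℝ => f p.1 * g (ρ * p.1 + p.2)) hF.aestronglyMeasurable
    (hma.prodMk hmb).aemeasurable).2 hfg
  rw [hmap] at e1 i1
  rw [← e1, integral_prod _ i1]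
  refine integral_congr_ae (ae_of_all _ fun x => ?_)
  simp only
  rw [integral_const_mul]
  congr 1
  have := gaussianReal_map_const_add (μ := 0) (v := (∑ k, b' k ^ 2 * σ k).toNNReal) (ρ * x)
  rw [zero_add] at this
  rw [← this, integral_map (by fun_prop) hg.aestronglyMeasurable]

lemma inv_sqrt_one_sub_le {u : ℝ} (h0 : 0 ≤ u) (h1 : u ≤ 1 / 2) : (√(1 - u))⁻¹ ≤ 1 + 2 * u := by
  have hp : 0 < √(1 - u) := Real.sqrt_pos.2 (by linarith)
  rw [inv_le_iff_one_le_mul₀ hp]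
  have : (1 : ℝ) ≤ √((1 + 2 * u) ^ 2 * (1 - u)) := by
    rw [Real.one_le_sqrt]
    nlinarith [mul_nonneg h0 (sub_nonneg.2 h1), mul_nonneg h0 h0]
  rwa [Real.sqrt_mul (sq_nonneg _), Real.sqrt_sq (by linarith)] at this

/-- Conditional expectations of centered functions under a slight correlation. -/
lemma integral_sq_condExp_le {c κ s σ v ρ : ℝ} (hc : 0 < c) (hκ0 : 0 ≤ κ) (hκ : κ ≤ c / 8)
    (hs : c / 2 ≤ s) (hσ : c ≤ σ) (hv : |v - σ| ≤ 2 * κ) (hρ : |ρ * s| ≤ κ) {g : ℝ → ℝ}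
    (hg : Measurable g) {A : ℝ} (hb : ∀ x, |g x| ≤ A * (1 + |x|))
    (h0 : ∫ x, g x ∂(gaussianReal 0 σ.toNNReal) = 0) :
    MemLp (fun x => ∫ w, g w ∂(gaussianReal (ρ * x) v.toNNReal)) 2 (gaussianReal 0 s.toNNReal) ∧
    ∫ x, (∫ w, g w ∂(gaussianReal (ρ * x) v.toNNReal)) ^ 2 ∂(gaussianReal 0 s.toNNReal)
      ≤ 24 * κ ^ 2 / c ^ 2 * ∫ x, g x ^ 2 ∂(gaussianReal 0 σ.toNNReal) := by
  obtain ⟨hv1, hv2⟩ := abs_le.1 hv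
  have hv0 : 0 < v := by linarith
  have hσ0 : 0 < σ := by linarith
  have hs0 : 0 < s := by linarith
  have hd : c * (3 / 4) ≤ 2 * σ - v := by linarith
  have hd0 : 0 < 2 * σ - v := by linarith
  have hρs : ρ ^ 2 * s ≤ κ ^ 2 / (c / 2) := by
    rw [le_div_iff₀ (by positivity)]
    have : (ρ * s) ^ 2 ≤ κ ^ 2 := sq_le_sq' (abs_le.1 hρ).1 (abs_le.1 hρ).2
    calc ρ ^ 2 * s * (c / 2) ≤ ρ ^ 2 * s * s := by gcongr
      _ ≤ κ ^ 2 := by linarith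
  set a := ρ ^ 2 / (2 * σ - v) with ha
  have ha0 : 0 ≤ a := by positivity
  set V := ∫ x, g x ^ 2 ∂(gaussianReal 0 σ.toNNReal) with hV
  have hV0 : 0 ≤ V := integral_nonneg fun x => sq_nonneg _
  set K := σ / √(v * (2 * σ - v)) with hK
  have hκc : (κ / c) ^ 2 ≤ (1 / 8) ^ 2 := by
    refine pow_le_pow_left₀ (by positivity) ?_ 2
    rw [div_le_iff₀ hc]; linarith
  have ha2 : 2 * a * s ≤ 6 * (κ / c) ^ 2 := by
    have : 2 * a * s = 2 * (ρ ^ 2 * s) / (2 * σ - v) := by rw [ha]; ring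
    rw [this]
    calc 2 * (ρ ^ 2 * s) / (2 * σ - v) ≤ 2 * (κ ^ 2 / (c / 2)) / (c * (3 / 4)) := by gcongr
      _ = (16 / 3) * (κ / c) ^ 2 := by field_simp; ring
      _ ≤ 6 * (κ / c) ^ 2 := by gcongr; norm_num
  have hδ : ((σ - v) / σ) ^ 2 ≤ 4 * (κ / c) ^ 2 := by
    have : |(σ - v) / σ| ≤ 2 * κ / c := by
      rw [abs_div, abs_of_pos hσ0, abs_sub_comm]
      gcongr
    calc ((σ - v) / σ) ^ 2 = |(σ - v) / σ| ^ 2 := (sq_abs _).symm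
      _ ≤ (2 * κ / c) ^ 2 := pow_le_pow_left₀ (abs_nonneg _) this 2
      _ = _ := by ring
  have ha1 : 2 * a * s < 1 := by linarith
  -- The `χ²` bound for each value of the conditioning variable; the exponential of `a x²` stems
  -- from the conditional mean `ρ x`.
  have hle : ∀ x, (∫ w, g w ∂(gaussianReal (ρ * x) v.toNNReal)) ^ 2
      ≤ (K * Real.exp (a * x ^ 2) - 1) * V := by
    intro x
    have := sq_integral_gaussianReal_le hv0 hσ0 (by linarith) (ρ * x)
      (memLp_of_abs_le_linear hg hb 0 σ.toNNReal) h0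
    convert this using 5
    rw [ha]; ring
  have iE := integrable_exp_sq_gaussianReal hs0 ha1
  have hi : Integrable (fun x => (K * Real.exp (a * x ^ 2) - 1) * V) (gaussianReal 0 s.toNNReal) :=
    ((iE.const_mul K).sub (integrable_const 1)).mul_const V
  have hmeas : Measurable fun x => ∫ w, g w ∂(gaussianReal (ρ * x) v.toNNReal) := by
    have e : (fun x => ∫ w, g w ∂(gaussianReal (ρ * x) v.toNNReal))
        = fun x => ∫ w, g (ρ * x + w) ∂(gaussianReal 0 v.toNNReal) := by
      funext x
      have := gaussianReal_map_const_add (μ := 0) (v := v.toNNReal) (ρ * x)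
      rw [zero_add] at this
      rw [← this, integral_map (by fun_prop) hg.aestronglyMeasurable]
    rw [e]
    have : Measurable (Function.uncurry fun x w => g (ρ * x + w)) := by
      unfold Function.uncurry; fun_prop
    exact this.stronglyMeasurable.integral_prod_right.measurable
  refine ⟨(memLp_two_iff_integrable_sq hmeas.aestronglyMeasurable).2
    (hi.mono' (hmeas.pow_const 2).aestronglyMeasurable (ae_of_all _ fun x => ?_)), ?_⟩
  · rw [Real.norm_eq_abs, abs_of_nonneg (sq_nonneg _)]
    exact hle x
  refine (integral_mono_of_nonneg (ae_of_all _ fun x => sq_nonneg _) hi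
    (ae_of_all _ hle)).trans ?_
  have i1 : Integrable (fun x => K * Real.exp (a * x ^ 2)) (gaussianReal 0 s.toNNReal) :=
    iE.const_mul K
  rw [integral_mul_const, integral_sub i1 (integrable_const _), integral_const_mul,
    integral_exp_sq_gaussianReal hs0 ha1, integral_const, probReal_univ, one_smul]
  refine mul_le_mul_of_nonneg_right ?_ hV0
  -- Change of variance and change of mean each contribute an inverse square root, and their product
  -- is `(1 - u)^(-1/2)`. Both deviations from `1` are quadratic in `κ/c`, hence so is `u`.
  set u := 1 - (1 - ((σ - v) / σ) ^ 2) * (1 - 2 * a * s) with hu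
  have eK : K * (√(1 - 2 * a * s))⁻¹ = (√(1 - u))⁻¹ := by
    have e1 : K = (√(1 - ((σ - v) / σ) ^ 2))⁻¹ := by
      have : v * (2 * σ - v) = σ ^ 2 * (1 - ((σ - v) / σ) ^ 2) := by field_simp; ring
      rw [hK, this, Real.sqrt_mul (sq_nonneg _), Real.sqrt_sq hσ0.le]
      rw [← div_div, div_self hσ0.ne', one_div]
    rw [e1, ← mul_inv, ← Real.sqrt_mul (by linarith)]
    congr 2
    rw [hu]; ring
  have has : 0 ≤ 2 * a * s := by positivity
  have hu0 : 0 ≤ u := by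
    rw [hu]
    nlinarith [sq_nonneg ((σ - v) / σ)]
  have hu1 : u ≤ 12 * (κ / c) ^ 2 := by
    rw [hu]
    nlinarith [sq_nonneg ((σ - v) / σ), mul_nonneg (sq_nonneg ((σ - v) / σ)) has]
  rw [eK]
  have := inv_sqrt_one_sub_le hu0 (by linarith)
  calc (√(1 - u))⁻¹ - 1 ≤ 24 * (κ / c) ^ 2 := by linarith
    _ = _ := by ring

/-! ### Averages of functions of the deviations from the grand mean -/

/-- Coefficients of the deviation of coordinate `i` from the grand mean. -/
noncomputable def devCoef {n : ℕ} (i k : Fin n) : ℝ := (if k = i then 1 else 0) - 1 / (n : ℝ)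

lemma linForm_devCoef {n : ℕ} (i : Fin n) (y : Fin n → ℝ) :
    linForm (devCoef i) y = y i - grandMean y := by
  simp [linForm, devCoef, grandMean, sub_mul, Finset.sum_sub_distrib, Finset.mul_sum]

lemma sum_devCoef {n : ℕ} (σ : Fin n → ℝ) (i j : Fin n) :
    ∑ k, devCoef i k * devCoef j k * σ k
      = (if i = j then σ i else 0) - (σ i + σ j) / n + (∑ k, σ k) / n ^ 2 := by
  have e : ∀ k, devCoef i k * devCoef j k * σ k
      = (if k = i then (if i = j then σ i else 0) else 0)
        - ((if k = i then σ i / n else 0) + (if k = j then σ j / n else 0)) + σ k / n ^ 2 := by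
    intro k
    unfold devCoef
    by_cases h1 : k = i
    · subst h1
      by_cases h2 : k = j
      · subst h2; simp; ring
      · simp [h2]; ring
    · by_cases h2 : k = j
      · subst h2; simp [h1]; ring
      · simp [h1, h2]; ring
  simp_rw [e, Finset.sum_add_distrib, Finset.sum_sub_distrib, Finset.sum_add_distrib,
    ← Finset.sum_div]
  simp
  ring

/-- Subtracting the grand mean changes each covariance by two terms of opposite sign, of sizes at
most `2C/n` and `C/n`. -/
lemma abs_sum_devCoef_sub_le {n : ℕ} (hn : 0 < n) {σ : Fin n → ℝ} {C : ℝ} (h0 : ∀ i, 0 ≤ σ i)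
    (hC : ∀ i, σ i ≤ C) (i j : Fin n) :
    |∑ k, devCoef i k * devCoef j k * σ k - (if i = j then σ i else 0)| ≤ 2 * C / n := by
  have hn' : (0 : ℝ) < n := Nat.cast_pos.2 hn
  rw [sum_devCoef]
  have h1 : (∑ k, σ k) / n ^ 2 ≤ C / n := by
    have : ∑ k, σ k ≤ n * C := by
      calc ∑ k, σ k ≤ ∑ _k : Fin n, C := Finset.sum_le_sum fun k _ => hC k
        _ = n * C := by simp
    rw [div_le_div_iff₀ (by positivity) hn']
    nlinarith
  have h2 : 0 ≤ (∑ k, σ k) / n ^ 2 := by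
    have := Finset.sum_nonneg fun k (_ : k ∈ Finset.univ) => h0 k
    positivity
  have h3 : 0 ≤ (σ i + σ j) / n := div_nonneg (add_nonneg (h0 i) (h0 j)) hn'.le
  have h4 : (σ i + σ j) / n ≤ 2 * C / n := by
    gcongr; linarith [hC i, hC j]
  have h5 : 0 ≤ C / n := h2.trans h1
  have h6 : 2 * C / n = 2 * (C / n) := by ring
  rw [abs_le]
  constructor <;> linarith

variable {c C B : ℝ} {n : ℕ} {σ : Fin n → ℝ} {f : Fin n → ℝ → ℝ} {V : ℝ}

lemma memLp_comp_linForm (h0 : ∀ i, 0 ≤ σ i) (a : Fin n → ℝ) {g : ℝ → ℝ} (hg : Measurable g)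
    {A : ℝ} (hb : ∀ x, |g x| ≤ A * (1 + |x|)) :
    MemLp (fun y => g (linForm a y)) 2 (centeredLaw σ) := by
  have h := memLp_of_abs_le_linear hg hb 0 (∑ k, a k ^ 2 * σ k).toNNReal
  exact h.comp_measurePreserving ⟨measurable_linForm a, map_linForm h0 a⟩

lemma integral_comp_linForm (h0 : ∀ i, 0 ≤ σ i) (a : Fin n → ℝ) {g : ℝ → ℝ} (hg : Measurable g) :
    ∫ y, g (linForm a y) ∂(centeredLaw σ)
      = ∫ x, g x ∂(gaussianReal 0 (∑ k, a k ^ 2 * σ k).toNNReal) := by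
  rw [← map_linForm h0 a, integral_map (measurable_linForm a).aemeasurable hg.aestronglyMeasurable]

lemma integral_sq_dev_le (hc : 0 < c) (hn : 16 * C / c ≤ n) (hn0 : 0 < n) (hσ : ∀ i, c ≤ σ i)
    (hσC : ∀ i, σ i ≤ C) (hf : ∀ i, Measurable (f i)) (hb : ∀ i x, |f i x| ≤ B * n * (1 + |x|))
    (hV : ∀ i, ∫ x, f i x ^ 2 ∂(gaussianReal 0 (σ i).toNNReal) ≤ V) (i : Fin n) :
    ∫ x, f i x ^ 2 ∂(gaussianReal 0 (∑ k, devCoef i k ^ 2 * σ k).toNNReal)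
      ≤ momentConst c C B * (V + 1) := by
  have h0 : ∀ i, 0 ≤ σ i := fun i => hc.le.trans (hσ i)
  have hC : 0 < C := hc.trans_le ((hσ i).trans (hσC i))
  have hd := abs_sum_devCoef_sub_le hn0 h0 hσC i i
  rw [if_pos rfl] at hd
  simp_rw [← sq] at hd
  have hm : 0 ≤ momentConst c C B := by
    have q4 : 0 ≤ ∫ z, z ^ 4 ∂(gaussianReal 0 1) := integral_nonneg fun z => by positivity
    have q6 : 0 ≤ ∫ z, z ^ 6 ∂(gaussianReal 0 1) := integral_nonneg fun z => by positivity
    unfold momentConst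
    positivity
  refine (integral_sq_perturb hc hn hn0 (hσ i) (hσC i) hd (hf i) (hb i)).trans ?_
  gcongr
  exact hV i

/-- Condition the second deviation on the first and apply the Cauchy–Schwarz inequality: one factor
is a second moment, the other is that of a conditional expectation, smaller by order `n^(-2)`. The
square root leaves the factor `1/n`. -/
lemma abs_integral_mul_dev_le (hc : 0 < c) (hn : 16 * C / c ≤ n) (hn0 : 0 < n)
    (hσ : ∀ i, c ≤ σ i) (hσC : ∀ i, σ i ≤ C) (hf : ∀ i, Measurable (f i))
    (hb : ∀ i x, |f i x| ≤ B * n * (1 + |x|))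
    (hz : ∀ i, ∫ x, f i x ∂(gaussianReal 0 (σ i).toNNReal) = 0)
    (hV : ∀ i, ∫ x, f i x ^ 2 ∂(gaussianReal 0 (σ i).toNNReal) ≤ V) {i j : Fin n} (hij : i ≠ j) :
    |∫ y, f i (y i - grandMean y) * f j (y j - grandMean y) ∂(centeredLaw σ)|
      ≤ 2 * C / c * √(24 * momentConst c C B) * (V + 1) / n := by
  have hn' : (0 : ℝ) < n := Nat.cast_pos.2 hn0
  have h0 : ∀ i, 0 ≤ σ i := fun i => hc.le.trans (hσ i)
  have hC : 0 < C := hc.trans_le ((hσ i).trans (hσC i))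
  have hV0 : 0 ≤ V := (integral_nonneg fun x => sq_nonneg (f i x)).trans (hV i)
  simp_rw [← linForm_devCoef]
  have hκ : 2 * C / n ≤ c / 8 := by
    rw [div_le_iff₀ hc] at hn
    rw [div_le_div_iff₀ hn' (by norm_num)]
    linarith
  have hκ0 : 0 ≤ 2 * C / n := by positivity
  have di := abs_sum_devCoef_sub_le hn0 h0 hσC i i
  have dj := abs_sum_devCoef_sub_le hn0 h0 hσC j j
  have de := abs_sum_devCoef_sub_le hn0 h0 hσC i j
  have hA := integral_sq_dev_le hc hn hn0 hσ hσC hf hb hV i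
  rw [if_pos rfl] at di dj
  rw [if_neg hij, sub_zero] at de
  simp_rw [← sq] at di dj
  set s := ∑ k, devCoef i k ^ 2 * σ k with hs
  set s' := ∑ k, devCoef j k ^ 2 * σ k with hs'
  set e := ∑ k, devCoef i k * devCoef j k * σ k with he
  set κ := 2 * C / n with hκd
  have hs2 : c / 2 ≤ s := by linarith [(abs_le.1 di).1, hσ i]
  have hs0 : 0 < s := by linarith
  set ρ := e / s with hρ
  have hρs : ρ * s = e := div_mul_cancel₀ _ hs0.ne'
  have r1 : ∑ k, devCoef i k * (devCoef j k - ρ * devCoef i k) * σ k = 0 := by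
    have : ∑ k, devCoef i k * (devCoef j k - ρ * devCoef i k) * σ k = e - ρ * s := by
      rw [he, hs, Finset.mul_sum, ← Finset.sum_sub_distrib]
      exact Finset.sum_congr rfl fun k _ => by ring
    rw [this, hρs, sub_self]
  -- The residual variance is smaller than the variance of the second deviation by `ρ e`, itself at
  -- most `κ`; this explains the tolerance `2κ` below.
  have r2 : ∑ k, (devCoef j k - ρ * devCoef i k) ^ 2 * σ k = s' - ρ * e := by
    have : ∑ k, (devCoef j k - ρ * devCoef i k) ^ 2 * σ k = s' - 2 * ρ * e + ρ * (ρ * s) := by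
      rw [he, hs, hs', Finset.mul_sum, Finset.mul_sum, Finset.mul_sum, ← Finset.sum_sub_distrib,
        ← Finset.sum_add_distrib]
      exact Finset.sum_congr rfl fun k _ => by ring
    rw [this, hρs]; ring
  have hρe0 : 0 ≤ ρ * e := by rw [hρ, div_mul_eq_mul_div]; exact div_nonneg (mul_self_nonneg e) hs0.le
  have hρe : ρ * e ≤ κ := by
    rw [hρ, div_mul_eq_mul_div, div_le_iff₀ hs0]
    have : e * e ≤ κ * κ := by
      have := sq_le_sq' (abs_le.1 de).1 (abs_le.1 de).2
      linarith
    nlinarith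
  have hv : |(s' - ρ * e) - σ j| ≤ 2 * κ := by
    rw [abs_le] at dj ⊢
    constructor <;> linarith [dj.1, dj.2]
  obtain ⟨hm, hle⟩ := integral_sq_condExp_le hc hκ0 hκ hs2 (hσ j) hv (by rwa [hρs]) (hf j) (hb j)
    (hz j)
  have hfg : Integrable (fun y => f i (linForm (devCoef i) y) * f j (linForm (devCoef j) y))
      (centeredLaw σ) :=
    (memLp_comp_linForm h0 _ (hf i) (hb i)).integrable_mul (memLp_comp_linForm h0 _ (hf j) (hb j))
  rw [integral_linForm_mul h0 _ _ r1 (hf i) (hf j) hfg, r2]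
  refine abs_le_of_sq_le_sq ?_ (by positivity)
  refine (sq_integral_mul_le (memLp_of_abs_le_linear (hf i) (hb i) 0 _) hm).trans ?_
  have hmc : 0 ≤ momentConst c C B := by
    by_contra h
    have : 0 ≤ momentConst c C B * (V + 1) :=
      (integral_nonneg fun x => sq_nonneg (f i x)).trans hA
    nlinarith
  calc _ ≤ (momentConst c C B * (V + 1)) * (24 * κ ^ 2 / c ^ 2 * V) := by
        refine mul_le_mul hA (hle.trans ?_) (integral_nonneg fun x => sq_nonneg _) (by positivity)
        gcongr
        exact hV j
    _ ≤ (momentConst c C B * (V + 1)) * (24 * κ ^ 2 / c ^ 2 * (V + 1)) := by gcongr; linarith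
    _ = (κ / c) ^ 2 * (√(24 * momentConst c C B)) ^ 2 * (V + 1) ^ 2 := by
        rw [Real.sq_sqrt (by positivity)]; ring
    _ = _ := by rw [hκd]; ring

/-- Constant in `integral_sq_mean_dev_le`. -/
noncomputable def concConst (c C B : ℝ) : ℝ :=
  momentConst c C B + 2 * C / c * √(24 * momentConst c C B)

lemma memLp_comp_dev (h0 : ∀ i, 0 ≤ σ i) (hf : ∀ i, Measurable (f i)) {A : ℝ}
    (hb : ∀ i x, |f i x| ≤ A * (1 + |x|)) (i : Fin n) :
    MemLp (fun y => f i (y i - grandMean y)) 2 (centeredLaw σ) := by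
  simp_rw [← linForm_devCoef]
  exact memLp_comp_linForm h0 _ (hf i) (hb i)

/-- Averages of centered functions of the deviations from the grand mean concentrate at `0`. -/
theorem integral_sq_mean_dev_le (hc : 0 < c) (hn : 16 * C / c ≤ n) (hn0 : 0 < n)
    (hσ : ∀ i, c ≤ σ i) (hσC : ∀ i, σ i ≤ C) (hf : ∀ i, Measurable (f i))
    (hb : ∀ i x, |f i x| ≤ B * n * (1 + |x|))
    (hz : ∀ i, ∫ x, f i x ∂(gaussianReal 0 (σ i).toNNReal) = 0)
    (hV : ∀ i, ∫ x, f i x ^ 2 ∂(gaussianReal 0 (σ i).toNNReal) ≤ V) :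
    ∫ y, ((1 / (n : ℝ)) * ∑ i, f i (y i - grandMean y)) ^ 2 ∂(centeredLaw σ)
      ≤ concConst c C B * (V + 1) / n := by
  have hn' : (0 : ℝ) < n := Nat.cast_pos.2 hn0
  have h0 : ∀ i, 0 ≤ σ i := fun i => hc.le.trans (hσ i)
  have hm := memLp_comp_dev h0 hf hb
  have hi : ∀ i j, Integrable (fun y => f i (y i - grandMean y) * f j (y j - grandMean y))
      (centeredLaw σ) := fun i j => (hm i).integrable_mul (hm j)
  have e : (fun y : Fin n → ℝ => ((1 / (n : ℝ)) * ∑ i, f i (y i - grandMean y)) ^ 2)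
      = fun y => (1 / (n : ℝ) ^ 2) * ∑ i, ∑ j,
        f i (y i - grandMean y) * f j (y j - grandMean y) := by
    funext y
    rw [← Finset.sum_mul_sum]; ring
  rw [e, integral_const_mul, integral_finsetSum _ fun i _ => integrable_finsetSum _ fun j _ => hi i j]
  simp_rw [integral_finsetSum _ fun j (_ : j ∈ Finset.univ) => hi _ j]
  have i0 : Fin n := ⟨0, hn0⟩
  have hV0 : 0 ≤ V := (integral_nonneg fun x => sq_nonneg (f i0 x)).trans (hV i0)
  have hC : 0 < C := hc.trans_le ((hσ i0).trans (hσC i0))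
  set P := 2 * C / c * √(24 * momentConst c C B) * (V + 1) / n with hP
  have hP0 : 0 ≤ P := by positivity
  -- The `n` diagonal terms are `O(V + 1)` and the `n²` others are `O((V + 1)/n)`, so after division
  -- by `n²` both kinds give `O((V + 1)/n)`.
  have hle : ∀ i j, ∫ y, f i (y i - grandMean y) * f j (y j - grandMean y) ∂(centeredLaw σ)
      ≤ (if i = j then momentConst c C B * (V + 1) else 0) + P := by
    intro i j
    split_ifs with h
    · subst h
      have := integral_sq_dev_le hc hn hn0 hσ hσC hf hb hV i
      rw [← integral_comp_linForm h0 _ ((hf i).pow_const 2)] at this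
      simp_rw [linForm_devCoef, sq] at this
      linarith
    · rw [zero_add]
      exact (le_abs_self _).trans (abs_integral_mul_dev_le hc hn hn0 hσ hσC hf hb hz hV h)
  calc _ ≤ 1 / (n : ℝ) ^ 2 * ∑ i : Fin n, ∑ j : Fin n,
        ((if i = j then momentConst c C B * (V + 1) else 0) + P) := by
        gcongr with i _ j _
        exact hle i j
    _ = concConst c C B * (V + 1) / n := by
        simp_rw [Finset.sum_add_distrib]
        simp only [Finset.sum_ite_eq, Finset.mem_univ, if_true, Finset.sum_const,
          Finset.card_univ, Fintype.card_fin, nsmul_eq_mul]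
        rw [hP, concConst]
        field_simp

end CheckLoss

namespace CheckLoss

/-! ### The predictive loss -/

/-- The check loss of the prediction error `r = q - y`. -/
noncomputable def checkFun (b h r : ℝ) : ℝ := b * max (-r) 0 + h * max r 0

lemma checkFun_eq (b h r : ℝ) : checkFun b h r = (b + h) * max r 0 - b * r := by
  unfold checkFun
  rcases le_total r 0 with hr | hr
  · rw [max_eq_right hr, max_eq_left (by linarith)]; ring
  · rw [max_eq_left hr, max_eq_right (by linarith)]; ring

lemma gaussianReal_eq_map_sub (m v : ℝ) :
    gaussianReal m v.toNNReal = (gaussianReal 0 1).map fun z => m - √v * z := by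
  have h := gaussianReal_map_const_sub (μ := 0) (v := v.toNNReal) m
  rw [sub_zero, Model.gaussianReal_eq_map, Measure.map_map (by fun_prop) (by fun_prop)] at h
  exact h.symm

lemma integrable_id_gaussianReal' (m : ℝ) (v : NNReal) :
    Integrable (fun x : ℝ => x) (gaussianReal m v) :=
  (memLp_id_gaussianReal' 2 (by norm_num)).integrable (by norm_num)

lemma integrable_checkFun (b h m : ℝ) (v : NNReal) :
    Integrable (checkFun b h) (gaussianReal m v) := by
  have e : checkFun b h = fun r => (b + h) * max r 0 - b * r := funext (checkFun_eq b h)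
  rw [e]
  have := integrable_id_gaussianReal' m v
  exact (this.pos_part.const_mul _).sub (this.const_mul _)

lemma integral_checkFun {b h : ℝ} (hbh : 0 < b + h) (m : ℝ) {v : ℝ} (hv : 0 < v) :
    ∫ r, checkFun b h r ∂(gaussianReal m v.toNNReal)
      = (b + h) * √v * G (m / √v) (b / (b + h)) := by
  have hs : 0 < √v := Real.sqrt_pos.2 hv
  have hm : Measurable (checkFun b h) := by unfold checkFun; fun_prop
  have hz := integrable_id_gaussianReal' 0 1
  rw [gaussianReal_eq_map_sub, integral_map (by fun_prop) hm.aestronglyMeasurable]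
  have e : (fun z => checkFun b h (m - √v * z))
      = fun z => (b + h) * √v * max (m / √v - z) 0 - (b * m - (b * √v) * z) := by
    funext z
    have h1 : max (m - √v * z) 0 = √v * max (m / √v - z) 0 := by
      rw [mul_max_of_nonneg _ _ hs.le, mul_zero, mul_sub, mul_div_cancel₀ _ hs.ne']
    rw [checkFun_eq, h1]; ring
  have i1 : Integrable (fun z : ℝ => m / √v - z) (gaussianReal 0 1) := (integrable_const _).sub hz
  have i2 : Integrable (fun z : ℝ => b * m - (b * √v) * z) (gaussianReal 0 1) :=
    (integrable_const _).sub (hz.const_mul _)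
  rw [e, integral_sub (i1.pos_part.const_mul _) i2, integral_const_mul, integral_pos_part,
    integral_sub (integrable_const _) (hz.const_mul _), integral_const_mul, integral_const_mul,
    integral_id_gaussianReal, G_eq]
  simp only [integral_const, probReal_univ, one_smul, mul_zero, sub_zero]
  field_simp

lemma abs_G_sub_le {β : ℝ} (h0 : 0 ≤ β) (h1 : β ≤ 1) (w w' : ℝ) :
    |G w β - G w' β| ≤ |w - w'| := by
  have := Convex.norm_image_sub_le_of_norm_hasDerivWithin_le (C := 1) (s := Set.univ)
    (f := fun w => G w β) (fun x _ => (hasDerivAt_G x β).hasDerivWithinAt) (fun x _ => by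
      rw [Real.norm_eq_abs, abs_le]
      have := stdCDF_nonneg x
      have := stdCDF_le_one x
      constructor <;> linarith) convex_univ (Set.mem_univ w') (Set.mem_univ w)
  simpa using this

namespace Model

variable {M : Model}

lemma coordLoss_eq_integral (i : ℕ) (t q : ℝ) :
    M.coordLoss i t q
      = ∫ r, checkFun (M.b i) (M.h i) r ∂(gaussianReal (q - t) (M.σf i).toNNReal) := by
  have hm : Measurable (checkFun (M.b i) (M.h i)) := by unfold checkFun; fun_prop
  rw [← gaussianReal_map_const_sub, integral_map (by fun_prop) hm.aestronglyMeasurable]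
  simp [coordLoss, checkFun]

lemma coordLoss_eq (hM : M.Positive) (i : ℕ) (t q : ℝ) :
    M.coordLoss i t q
      = (M.b i + M.h i) * √(M.σf i) * G ((q - t) / √(M.σf i)) (M.ratio i) := by
  rw [coordLoss_eq_integral, integral_checkFun (add_pos (hM.b_pos i) (hM.h_pos i)) _ (hM.σf_pos i),
    ratio]

lemma abs_coordLoss_sub_le (hM : M.Positive) (i : ℕ) (t q q' : ℝ) :
    |M.coordLoss i t q - M.coordLoss i t q'| ≤ (M.b i + M.h i) * |q - q'| := by
  have hs : 0 < √(M.σf i) := Real.sqrt_pos.2 (hM.σf_pos i)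
  have hb : 0 < M.b i + M.h i := add_pos (hM.b_pos i) (hM.h_pos i)
  rw [coordLoss_eq hM, coordLoss_eq hM, ← mul_sub, abs_mul, abs_of_pos (mul_pos hb hs), mul_assoc]
  refine mul_le_mul_of_nonneg_left ?_ hb.le
  have := abs_G_sub_le (ratio_nonneg hM i) (ratio_le_one hM i) ((q - t) / √(M.σf i))
    ((q' - t) / √(M.σf i))
  rw [← sub_div, sub_sub_sub_cancel_right, abs_div, abs_of_pos hs] at this
  calc _ ≤ √(M.σf i) * (|q - q'| / √(M.σf i)) := by gcongr
    _ = |q - q'| := mul_div_cancel₀ _ hs.ne'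

lemma coordLoss_nonneg (hM : M.Positive) (i : ℕ) (t q : ℝ) : 0 ≤ M.coordLoss i t q :=
  integral_nonneg fun _ => add_nonneg (mul_nonneg (hM.b_pos i).le (le_max_right _ _))
    (mul_nonneg (hM.h_pos i).le (le_max_right _ _))

lemma coordLoss_le (hM : M.Positive) (i : ℕ) (t q : ℝ) :
    M.coordLoss i t q ≤ (M.b i + M.h i) * (√(M.σf i) + |q - t|) := by
  have hs : 0 < √(M.σf i) := Real.sqrt_pos.2 (hM.σf_pos i)
  have hb : 0 < M.b i + M.h i := add_pos (hM.b_pos i) (hM.h_pos i)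
  rw [coordLoss_eq hM]
  have := (le_abs_self _).trans (abs_G_le ((q - t) / √(M.σf i)) (M.ratio i) (ratio_nonneg hM i)
    (ratio_le_one hM i))
  rw [abs_div, abs_of_pos hs] at this
  calc _ ≤ (M.b i + M.h i) * √(M.σf i) * (|q - t| / √(M.σf i) + 1) := by gcongr
    _ = _ := by field_simp; ring

lemma measurable_coordLoss (hM : M.Positive) (i : ℕ) (t : ℝ) : Measurable (M.coordLoss i t) := by
  have e : M.coordLoss i t
      = fun q => (M.b i + M.h i) * √(M.σf i) * G ((q - t) / √(M.σf i)) (M.ratio i) :=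
    funext (coordLoss_eq hM i t)
  have hG : Continuous fun w => G w (M.ratio i) :=
    continuous_iff_continuousAt.2 fun w => (hasDerivAt_G w _).continuousAt
  rw [e]
  exact (continuous_const.mul (hG.comp (by fun_prop))).measurable

/-- The expected predictive loss of coordinate `i` when the grand mean of the data is replaced by a
constant at distance `t` from `θ i`. -/
noncomputable def coordTarget (M : Model) (i : ℕ) (τ : ℝ≥0∞) (t : ℝ) : ℝ :=
  (M.b i + M.h i) * √(M.σf i + M.σp i * M.shrink i τ ^ 2)
    * G (M.coefC i τ + M.coefD i τ * t) (M.ratio i)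

/-- The prediction of coordinate `i` with the grand mean replaced by the constant `m`. -/
noncomputable def shrinkTo (M : Model) (i : ℕ) (τ : ℝ≥0∞) (m x : ℝ) : ℝ :=
  M.shrink i τ * x + (1 - M.shrink i τ) * m
    + √(M.σf i + M.shrink i τ * M.σp i) * stdQuantile (M.ratio i)

/-- The prediction error is a sum of two independent normal variables, the past noise scaled by the
shrinkage factor and the future noise. Their convolution has variance `σf + α² σp`, and dividing its
mean by the standard deviation gives `c + d (t - m)`. -/
lemma integral_coordLoss (hM : M.Positive) (i : ℕ) (τ : ℝ≥0∞) (t m : ℝ) :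
    ∫ y, M.coordLoss i t (M.shrinkTo i τ m (y + t)) ∂(gaussianReal 0 (M.σp i).toNNReal)
      = M.coordTarget i τ (t - m) := by
  set a := M.shrink i τ with ha
  set k := √(M.σf i + a * M.σp i) * stdQuantile (M.ratio i) - (1 - a) * (t - m) with hk
  have hσp := hM.σp_pos i
  have hσf := hM.σf_pos i
  have hm : Measurable (checkFun (M.b i) (M.h i)) := by unfold checkFun; fun_prop
  have e1 : ∀ y, M.coordLoss i t (M.shrinkTo i τ m (y + t))
      = ∫ r, checkFun (M.b i) (M.h i) (a * y + r) ∂(gaussianReal k (M.σf i).toNNReal) := by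
    intro y
    have h := gaussianReal_map_const_add (μ := k) (v := (M.σf i).toNNReal) (a * y)
    have e : M.shrinkTo i τ m (y + t) - t = k + a * y := by
      rw [shrinkTo, hk, ← ha]; ring
    rw [coordLoss_eq_integral, e, ← h, integral_map (by fun_prop) hm.aestronglyMeasurable]
  simp_rw [e1]
  have h2 : (gaussianReal 0 (M.σp i).toNNReal).map (fun y => a * y)
      = gaussianReal 0 (a ^ 2 * M.σp i).toNNReal := by
    rw [gaussianReal_map_const_mul, mul_zero]
    congr 1
    rw [Real.toNNReal_mul (sq_nonneg a)]
    congr 1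
    ext
    simp [sq_nonneg a]
  have h3 : gaussianReal 0 (a ^ 2 * M.σp i).toNNReal ∗ gaussianReal k (M.σf i).toNNReal
      = gaussianReal k (M.σf i + M.σp i * a ^ 2).toNNReal := by
    rw [gaussianReal_conv_gaussianReal, zero_add, ← Real.toNNReal_add (by positivity) hσf.le]
    congr 2; ring
  have h4 := integral_conv (μ := gaussianReal 0 (a ^ 2 * M.σp i).toNNReal)
    (ν := gaussianReal k (M.σf i).toNNReal) (f := checkFun (M.b i) (M.h i))
    (by rw [h3]; exact integrable_checkFun _ _ _ _)
  rw [← h2, integral_map (f := fun x => ∫ y, checkFun (M.b i) (M.h i) (x + y)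
    ∂gaussianReal k (M.σf i).toNNReal) (by fun_prop) ?_, h2, h3] at h4
  · have hv : 0 < M.σf i + M.σp i * a ^ 2 := by positivity
    rw [← h4, integral_checkFun (add_pos (hM.b_pos i) (hM.h_pos i)) _ hv, coordTarget, ← ratio, ← ha]
    congr 2
    have hs : 0 < √(M.σf i + M.σp i * a ^ 2) := Real.sqrt_pos.2 hv
    have ha0 : 0 ≤ a := shrink_nonneg hM i τ
    rw [coefC, coefD, ← ha, mul_comm (a ^ 2), Real.sqrt_div (by positivity), hk]
    field_simp
    ring
  · have : Measurable (Function.uncurry fun x y => checkFun (M.b i) (M.h i) (x + y)) := by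
      unfold Function.uncurry; fun_prop
    exact this.stronglyMeasurable.integral_prod_right.aestronglyMeasurable

end Model

/-! ### Averages of independent terms -/

lemma integral_sq_sub_integral_le {Ω : Type*} {mΩ : MeasurableSpace Ω} {μ : Measure Ω}
    [IsProbabilityMeasure μ] {f : Ω → ℝ} (hf : MemLp f 2 μ) (a : ℝ) :
    ∫ x, (f x - ∫ y, f y ∂μ) ^ 2 ∂μ ≤ ∫ x, (f x - a) ^ 2 ∂μ := by
  have hm : MemLp (fun x => f x - a) 2 μ := hf.sub (memLp_const a)
  have h := variance_le_expectation_sq hm.aestronglyMeasurable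
  have hi := hf.integrable (by norm_num)
  rw [variance_eq_integral hm.aestronglyMeasurable.aemeasurable,
    integral_sub hi (integrable_const a)] at h
  simpa using h

lemma integral_abs_mean_sub_le {n : ℕ} (hn : 0 < n) {σ : Fin n → ℝ} {f : Fin n → ℝ → ℝ}
    {μ : Fin n → ℝ} {V : ℝ} (hf : ∀ i, Measurable (f i))
    (hm : ∀ i, MemLp (f i) 2 (gaussianReal 0 (σ i).toNNReal))
    (hμ : ∀ i, ∫ x, f i x ∂(gaussianReal 0 (σ i).toNNReal) = μ i)
    (hV : ∀ i, ∫ x, (f i x - μ i) ^ 2 ∂(gaussianReal 0 (σ i).toNNReal) ≤ V) :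
    ∫ y, |(1 / (n : ℝ)) * ∑ i, (f i (y i) - μ i)| ∂(centeredLaw σ) ≤ √(V / n) := by
  have hn' : (0 : ℝ) < n := Nat.cast_pos.2 hn
  set g : Fin n → ℝ → ℝ := fun i x => f i x - μ i with hg
  have hgm : ∀ i, Measurable (g i) := fun i => (hf i).sub_const _
  have hgL : ∀ i, MemLp (fun y : Fin n → ℝ => g i (y i)) 2 (centeredLaw σ) := fun i =>
    ((hm i).sub (memLp_const (μ i))).comp_measurePreserving (measurePreserving_eval_centeredLaw σ i)
  have hz : ∀ i, ∫ y, g i (y i) ∂(centeredLaw σ) = 0 := by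
    intro i
    rw [integral_eval_centeredLaw σ i (hgm i), hg]
    simp only
    rw [integral_sub ((hm i).integrable (by norm_num)) (integrable_const _), hμ]
    simp
  have hle : ∀ i j, ∫ y, g i (y i) * g j (y j) ∂(centeredLaw σ) ≤ if i = j then V else 0 := by
    intro i j
    split_ifs with h
    · subst h
      simp_rw [← sq]
      rw [integral_eval_centeredLaw σ i ((hgm i).pow_const 2)]
      exact hV i
    · have hind := ((iIndepFun_centeredLaw σ).indepFun h).comp (hgm i) (hgm j)
      have := hind.integral_fun_mul_eq_mul_integral (hgL i).aestronglyMeasurable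
        (hgL j).aestronglyMeasurable
      simp only [Function.comp_def] at this
      rw [this, hz, zero_mul]
  have hi : ∀ i j, Integrable (fun y : Fin n → ℝ => g i (y i) * g j (y j)) (centeredLaw σ) :=
    fun i j => (hgL i).integrable_mul (hgL j)
  have hF : MemLp (fun y : Fin n → ℝ => (1 / (n : ℝ)) * ∑ i, g i (y i)) 2 (centeredLaw σ) :=
    (memLp_finsetSum _ fun i _ => hgL i).const_mul _
  have hF' : MemLp (fun y : Fin n → ℝ => |(1 / (n : ℝ)) * ∑ i, g i (y i)|) 2 (centeredLaw σ) :=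
    hF.abs
  refine Real.le_sqrt_of_sq_le ((sq_integral_le hF').trans ?_)
  simp only [sq_abs]
  have e : (fun y : Fin n → ℝ => ((1 / (n : ℝ)) * ∑ i, g i (y i)) ^ 2)
      = fun y => (1 / (n : ℝ) ^ 2) * ∑ i, ∑ j, g i (y i) * g j (y j) := by
    funext y
    rw [← Finset.sum_mul_sum]; ring
  rw [e, integral_const_mul, integral_finsetSum _ fun i _ => integrable_finsetSum _ fun j _ => hi i j]
  simp_rw [integral_finsetSum _ fun j (_ : j ∈ Finset.univ) => hi _ j]
  calc _ ≤ 1 / (n : ℝ) ^ 2 * ∑ i : Fin n, ∑ j : Fin n, (if i = j then V else 0) := by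
        gcongr with i _ j _
        exact hle i j
    _ = V / n := by
        simp
        field_simp

lemma abs_grandMean_le {n : ℕ} (x : Fin n → ℝ) : |grandMean x| ≤ (1 / (n : ℝ)) * ∑ i, |x i| := by
  rw [grandMean, abs_mul, abs_of_nonneg (by positivity : (0 : ℝ) ≤ 1 / n)]
  gcongr
  exact Finset.abs_sum_le_sum_abs _ _

lemma grandMean_add {n : ℕ} (x y : Fin n → ℝ) :
    grandMean (fun i => x i + y i) = grandMean x + grandMean y := by
  simp [grandMean, Finset.sum_add_distrib, mul_add]

lemma measurable_grandMean {n : ℕ} : Measurable (grandMean (n := n)) := by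
  unfold grandMean; fun_prop

lemma integral_abs_grandMean_le {n : ℕ} (hn : 0 < n) {σ : Fin n → ℝ} {C : ℝ} (h0 : ∀ i, 0 ≤ σ i)
    (hC : ∀ i, σ i ≤ C) : ∫ y, |grandMean y| ∂(centeredLaw σ) ≤ √(C / n) := by
  have := integral_abs_mean_sub_le (f := fun _ x => x) (μ := fun _ => 0) (V := C) hn
    (fun _ => measurable_id) (fun i => memLp_id_gaussianReal' (μ := 0) (v := (σ i).toNNReal) 2
      (by norm_num)) (fun i => integral_id_gaussianReal) (fun i => by
      have := integral_pow_gaussianReal (h0 i) 1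
      norm_num at this
      simp only [sub_zero]
      rw [this]
      have h1 : ∫ z : ℝ, z ^ 2 ∂(gaussianReal 0 1) = 1 := integral_sq_gaussian
      rw [h1, mul_one]
      exact hC i)
  simpa [grandMean] using this

/-! ### The law of the data and the loss of the shrinkage rules -/

namespace Model

variable {M : Model}

instance (n : ℕ) (θ : ℕ → ℝ) : IsProbabilityMeasure (M.dataLaw n θ) := by
  unfold dataLaw; infer_instance

lemma measurePreserving_shift (n : ℕ) (θ : ℕ → ℝ) :
    MeasurePreserving (fun (y : Fin n → ℝ) i => y i + θ i) (centeredLaw fun i : Fin n => M.σp i)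
      (M.dataLaw n θ) :=
  measurePreserving_pi (f := fun (i : Fin n) (y : ℝ) => y + θ i) _ _ fun i =>
    ⟨by fun_prop, by rw [gaussianReal_map_add_const, zero_add]⟩

lemma integral_dataLaw (n : ℕ) (θ : ℕ → ℝ) (F : (Fin n → ℝ) → ℝ) :
    ∫ x, F x ∂(M.dataLaw n θ) = ∫ y, F (fun i => y i + θ i) ∂(centeredLaw fun i : Fin n => M.σp i) :=
  ((measurePreserving_shift n θ).integral_comp
    (measurableEmbedding_addRight (G := Fin n → ℝ) fun i : Fin n => θ i) F).symm

lemma integrable_eval_dataLaw (n : ℕ) (θ : ℕ → ℝ) (i : Fin n) :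
    Integrable (fun x : Fin n → ℝ => x i) (M.dataLaw n θ) :=
  (measurePreserving_eval (fun i : Fin n => gaussianReal (θ i) (M.σp i).toNNReal)
    i).integrable_comp_of_integrable (integrable_id_gaussianReal' _ _)

lemma integrable_grandMean_dataLaw (n : ℕ) (θ : ℕ → ℝ) :
    Integrable (grandMean (n := n)) (M.dataLaw n θ) :=
  (integrable_finsetSum _ fun i _ => integrable_eval_dataLaw n θ i).const_mul _

lemma measurable_shrink (i : ℕ) : Measurable (M.shrink i) := by
  unfold shrink
  refine Measurable.ite (measurableSet_singleton _) measurable_const ?_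
  fun_prop

lemma qG_eq {n : ℕ} (τ : ℝ≥0∞) (x : Fin n → ℝ) (i : Fin n) :
    M.qG τ x i = M.shrinkTo i τ (grandMean x) (x i) := rfl

lemma measurable_qG {n : ℕ} {τ : (Fin n → ℝ) → ℝ≥0∞} (hτ : Measurable τ) (i : Fin n) :
    Measurable fun x => M.qG (τ x) x i := by
  have h1 : Measurable fun x => M.shrink i (τ x) := (measurable_shrink _).comp hτ
  have h2 := measurable_grandMean (n := n)
  unfold qG
  fun_prop

lemma abs_qG_sub_le (hM : M.Positive) {n : ℕ} (τ : ℝ≥0∞) (x : Fin n → ℝ) (i : Fin n) (t : ℝ) :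
    |M.qG τ x i - t| ≤ |x i| + |grandMean x|
      + (√(M.σf i + M.σp i) * |stdQuantile (M.ratio i)| + |t|) := by
  have h0 := shrink_nonneg hM i τ
  have h1 := shrink_le_one hM i τ
  have hs := (hM.σp_pos i).le
  have e1 : |M.shrink i τ * x i| ≤ |x i| := by
    rw [abs_mul, abs_of_nonneg h0]
    exact mul_le_of_le_one_left (abs_nonneg _) h1
  have e2 : |(1 - M.shrink i τ) * grandMean x| ≤ |grandMean x| := by
    rw [abs_mul, abs_of_nonneg (by linarith)]
    exact mul_le_of_le_one_left (abs_nonneg _) (by linarith)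
  have e3 : |√(M.σf i + M.shrink i τ * M.σp i) * stdQuantile (M.ratio i)|
      ≤ √(M.σf i + M.σp i) * |stdQuantile (M.ratio i)| := by
    rw [abs_mul, abs_of_nonneg (Real.sqrt_nonneg _)]
    gcongr
    exact mul_le_of_le_one_left hs h1
  rw [qG]
  refine (abs_sub _ _).trans ?_
  have := abs_add_three (M.shrink i τ * x i) ((1 - M.shrink i τ) * grandMean x)
    (√(M.σf i + M.shrink i τ * M.σp i) * stdQuantile (M.ratio i))
  linarith

lemma integrable_loss_qG (hM : M.Positive) (n : ℕ) (θ : ℕ → ℝ) {τ : (Fin n → ℝ) → ℝ≥0∞}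
    (hτ : Measurable τ) : Integrable (fun x => M.loss n θ (M.qG (τ x) x)) (M.dataLaw n θ) := by
  unfold loss
  refine (integrable_finsetSum _ fun i _ => ?_).const_mul _
  have hb : 0 < M.b i + M.h i := add_pos (hM.b_pos i) (hM.h_pos i)
  have hi : Integrable (fun x : Fin n → ℝ => (M.b i + M.h i) * (√(M.σf i) + (|x i| + |grandMean x|
      + (√(M.σf i + M.σp i) * |stdQuantile (M.ratio i)| + |θ i|)))) (M.dataLaw n θ) :=
    ((integrable_const _).add (((integrable_eval_dataLaw n θ i).abs.add
      (integrable_grandMean_dataLaw n θ).abs).add (integrable_const _))).const_mul _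
  refine hi.mono' ((measurable_coordLoss hM i _).comp (measurable_qG hτ i)).aestronglyMeasurable
    (ae_of_all _ fun x => ?_)
  rw [Real.norm_eq_abs, abs_of_nonneg (coordLoss_nonneg hM _ _ _)]
  refine (coordLoss_le hM _ _ _).trans ?_
  gcongr
  exact abs_qG_sub_le hM _ _ _ _

lemma abs_loss_sub_le (hM : M.Positive) {n : ℕ} (θ : ℕ → ℝ) (q q' : Fin n → ℝ) :
    |M.loss n θ q - M.loss n θ q'| ≤ (1 / (n : ℝ)) * ∑ i : Fin n, (M.b i + M.h i) * |q i - q' i| := by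
  rw [loss, loss, ← mul_sub, ← Finset.sum_sub_distrib, abs_mul,
    abs_of_nonneg (by positivity : (0 : ℝ) ≤ 1 / n)]
  gcongr
  refine (Finset.abs_sum_le_sum_abs _ _).trans (Finset.sum_le_sum fun i _ => ?_)
  exact abs_coordLoss_sub_le hM _ _ _ _

lemma abs_shrinkTo_sub_le (hM : M.Positive) (i : ℕ) (τ : ℝ≥0∞) (m m' x x' : ℝ) :
    |M.shrinkTo i τ m x - M.shrinkTo i τ m' x'| ≤ |x - x'| + |m - m'| := by
  have h0 := shrink_nonneg hM i τ
  have h1 := shrink_le_one hM i τ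
  have e : M.shrinkTo i τ m x - M.shrinkTo i τ m' x'
      = M.shrink i τ * (x - x') + (1 - M.shrink i τ) * (m - m') := by
    unfold shrinkTo; ring
  rw [e]
  refine (abs_add_le _ _).trans (add_le_add ?_ ?_)
  · rw [abs_mul, abs_of_nonneg h0]
    exact mul_le_of_le_one_left (abs_nonneg _) h1
  · rw [abs_mul, abs_of_nonneg (by linarith)]
    exact mul_le_of_le_one_left (abs_nonneg _) (by linarith)

lemma abs_grandMean_sub_le_dist {n : ℕ} (x y : Fin n → ℝ) :
    |grandMean x - grandMean y| ≤ dist x y := by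
  rcases Nat.eq_zero_or_pos n with rfl | hn
  · simp [grandMean]
  have hn' : (0 : ℝ) < n := Nat.cast_pos.2 hn
  rw [grandMean, grandMean, ← mul_sub, ← Finset.sum_sub_distrib, abs_mul,
    abs_of_nonneg (by positivity : (0 : ℝ) ≤ 1 / n)]
  calc _ ≤ 1 / (n : ℝ) * ∑ _i : Fin n, dist x y := by
        gcongr
        refine (Finset.abs_sum_le_sum_abs _ _).trans (Finset.sum_le_sum fun i _ => ?_)
        rw [← Real.dist_eq]
        exact dist_le_pi_dist x y i
    _ = dist x y := by simp; field_simp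

lemma abs_loss_qG_sub_le_dist (hM : M.Positive) {n : ℕ} (θ : ℕ → ℝ) (τ : ℝ≥0∞) (x y : Fin n → ℝ) :
    |M.loss n θ (M.qG τ x) - M.loss n θ (M.qG τ y)|
      ≤ (1 / (n : ℝ)) * (∑ i : Fin n, (M.b i + M.h i) * 2) * dist x y := by
  refine (abs_loss_sub_le hM θ _ _).trans ?_
  rw [mul_assoc, Finset.sum_mul]
  refine mul_le_mul_of_nonneg_left (Finset.sum_le_sum fun i _ => ?_) (by positivity)
  rw [mul_assoc]
  have hb : 0 < M.b i + M.h i := add_pos (hM.b_pos i) (hM.h_pos i)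
  gcongr
  have h1 := abs_shrinkTo_sub_le hM i τ (grandMean x) (grandMean y) (x i) (y i)
  have h2 := abs_grandMean_sub_le_dist x y
  have h3 := dist_le_pi_dist x y i
  rw [Real.dist_eq] at h3
  rw [qG_eq, qG_eq]
  linarith

/-- The loss of the oracle is a continuous function of the data. -/
lemma continuous_loss_oracle (hM : M.Positive) {n : ℕ} (θ : ℕ → ℝ) {τ : (Fin n → ℝ) → ℝ≥0∞}
    (hτ : ∀ x, IsArgmin (fun τ => M.loss n θ (M.qG τ x)) Set.univ (τ x)) :
    Continuous fun x => M.loss n θ (M.qG (τ x) x) := by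
  set K := (1 / (n : ℝ)) * (∑ i : Fin n, (M.b i + M.h i) * 2) with hK
  have hK0 : 0 ≤ K := by
    have : 0 ≤ ∑ i : Fin n, (M.b i + M.h i) * 2 := Finset.sum_nonneg fun i _ => by
      have := hM.b_pos i; have := hM.h_pos i; positivity
    positivity
  -- The hyperparameter optimal for `y` is admissible for `x`, so the minimal loss inherits the
  -- Lipschitz constant common to all `τ`. This yields measurability of the minimal loss without a
  -- measurable choice of the minimizer.
  have h1 : ∀ x y, M.loss n θ (M.qG (τ x) x) - M.loss n θ (M.qG (τ y) y) ≤ K * dist x y := by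
    intro x y
    have h := (hτ x).2 (τ y) (Set.mem_univ _)
    have h' := (le_abs_self _).trans (abs_loss_qG_sub_le_dist hM θ (τ y) x y)
    simp only at h
    linarith
  refine (LipschitzWith.of_dist_le_mul (K := K.toNNReal) fun x y => ?_).continuous
  rw [Real.coe_toNNReal _ hK0, Real.dist_eq, abs_le]
  have := h1 y x
  rw [dist_comm] at this
  exact ⟨by linarith, h1 x y⟩

lemma loss_nonneg (hM : M.Positive) {n : ℕ} (θ : ℕ → ℝ) (q : Fin n → ℝ) : 0 ≤ M.loss n θ q :=
  mul_nonneg (by positivity) (Finset.sum_nonneg fun _ _ => coordLoss_nonneg hM _ _ _)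

lemma integrable_loss_oracle (hM : M.Positive) {n : ℕ} (θ : ℕ → ℝ) {τ : (Fin n → ℝ) → ℝ≥0∞}
    (hτ : ∀ x, IsArgmin (fun τ => M.loss n θ (M.qG τ x)) Set.univ (τ x)) :
    Integrable (fun x => M.loss n θ (M.qG (τ x) x)) (M.dataLaw n θ) := by
  refine (integrable_loss_qG hM n θ (τ := fun _ => 0) measurable_const).mono'
    (continuous_loss_oracle hM θ hτ).aestronglyMeasurable (ae_of_all _ fun x => ?_)
  rw [Real.norm_eq_abs, abs_of_nonneg (loss_nonneg hM _ _)]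
  exact (hτ x).2 0 (Set.mem_univ _)

/-- Uniform bounds for the constants of a model. -/
structure Bounded (M : Model) (c C : ℝ) : Prop where
  positive : M.Positive
  c_pos : 0 < c
  σp_ge : ∀ i, c ≤ M.σp i
  σp_le_σf : ∀ i, M.σp i ≤ M.σf i
  σf_le : ∀ i, M.σf i ≤ C
  weights_le : ∀ i, M.b i + M.h i ≤ C
  quantile_le : ∀ i, |stdQuantile (M.ratio i)| ≤ C

variable {c C : ℝ}

lemma Bounded.σp_le (h : M.Bounded c C) (i : ℕ) : M.σp i ≤ C := (h.σp_le_σf i).trans (h.σf_le i)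

lemma Bounded.C_pos (h : M.Bounded c C) : 0 < C := h.c_pos.trans_le ((h.σp_ge 0).trans (h.σp_le 0))

/-- The expected loss when the grand mean of the data is replaced by that of the parameters. -/
noncomputable def target (M : Model) (n : ℕ) (θ : ℕ → ℝ) (τ : ℝ≥0∞) : ℝ :=
  (1 / (n : ℝ)) * ∑ i : Fin n, M.coordTarget i τ (θ i - grandMean fun i : Fin n => θ i)

/-- With `m` in place of the grand mean of the data the summands are independent Lipschitz functions
of the noise. Restoring the grand mean costs at most `C` times the mean of the noise, again of order
`n^(-1/2)` in `L¹`. -/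
lemma integral_abs_loss_sub_target_le (h : M.Bounded c C) {n : ℕ} (hn : 0 < n) (θ : ℕ → ℝ)
    (τ : ℝ≥0∞) :
    ∫ x, |M.loss n θ (M.qG τ x) - M.target n θ τ| ∂(M.dataLaw n θ) ≤ 2 * C * √(C / n) := by
  have hM := h.positive
  have hC := h.C_pos
  have hn' : (0 : ℝ) < n := Nat.cast_pos.2 hn
  set m := grandMean fun i : Fin n => θ i with hm
  set f : Fin n → ℝ → ℝ := fun i y => M.coordLoss i (θ i) (M.shrinkTo i τ m (y + θ i)) with hf
  have hfm : ∀ i, Measurable (f i) := fun i =>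
    (measurable_coordLoss hM i (θ i)).comp (by unfold shrinkTo; fun_prop)
  have hL : ∀ i y, |f i y - f i 0| ≤ C * |y| := by
    intro i y
    refine (abs_coordLoss_sub_le hM _ _ _ _).trans ?_
    have := abs_shrinkTo_sub_le hM i τ m m (y + θ i) (0 + θ i)
    simp only [add_sub_add_right_eq_sub, sub_zero, sub_self, abs_zero, add_zero] at this
    have hw := h.weights_le i
    gcongr
  have hfL : ∀ i : Fin n, MemLp (f i) 2 (gaussianReal 0 (M.σp i).toNNReal) := by
    intro i
    refine memLp_of_abs_le_linear (hfm i) (A := max |f i 0| C) (fun x => ?_) 0 _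
    have h1 := hL i x
    have h2 : |f i x| ≤ |f i x - f i 0| + |f i 0| := by
      simpa using abs_add_le (f i x - f i 0) (f i 0)
    have h3 := le_max_left |f i 0| C
    have h4 := mul_le_mul_of_nonneg_right (le_max_right |f i 0| C) (abs_nonneg x)
    linarith
  have hV : ∀ i : Fin n, ∫ x, (f i x - M.coordTarget i τ (θ i - m)) ^ 2
      ∂(gaussianReal 0 (M.σp i).toNNReal) ≤ C ^ 2 * C := by
    intro i
    -- The variance is at most the mean square about any constant; about `f i 0` the Lipschitz bound
    -- applies.
    have h1 := integral_sq_sub_integral_le (hfL i) (f i 0)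
    rw [show (∫ y, f i y ∂(gaussianReal 0 (M.σp i).toNNReal)) = M.coordTarget i τ (θ i - m) from
      integral_coordLoss hM i τ (θ i) m] at h1
    refine h1.trans ?_
    have hi : Integrable (fun x : ℝ => C ^ 2 * x ^ 2) (gaussianReal 0 (M.σp i).toNNReal) :=
      (integrable_pow_gaussianReal 0 _ 2).const_mul _
    refine (integral_mono_of_nonneg (ae_of_all _ fun x => sq_nonneg _) hi
      (ae_of_all _ fun x => ?_)).trans ?_
    · have := pow_le_pow_left₀ (abs_nonneg _) (hL i x) 2
      rwa [sq_abs, mul_pow, sq_abs] at this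
    · have h2 := integral_pow_gaussianReal (hM.σp_pos i).le 1
      norm_num at h2
      have h3 : ∫ z : ℝ, z ^ 2 ∂(gaussianReal 0 1) = 1 := integral_sq_gaussian
      rw [integral_const_mul, h2, h3, mul_one]
      gcongr
      exact h.σp_le i
  have h1 := integral_abs_mean_sub_le hn hfm hfL (fun i => integral_coordLoss hM i τ (θ i) m) hV
  have h2 := integral_abs_grandMean_le (σ := fun i : Fin n => M.σp i) hn
    (fun i => (hM.σp_pos i).le) fun i => h.σp_le i
  rw [integral_dataLaw]
  have hpt : ∀ y : Fin n → ℝ, |M.loss n θ (M.qG τ fun i => y i + θ i) - M.target n θ τ|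
      ≤ |(1 / (n : ℝ)) * ∑ i : Fin n, (f i (y i) - M.coordTarget i τ (θ i - m))|
        + C * |grandMean y| := by
    intro y
    have e : (1 / (n : ℝ)) * ∑ i : Fin n, (f i (y i) - M.coordTarget i τ (θ i - m))
        = M.loss n θ (fun i => M.shrinkTo i τ m (y i + θ i)) - M.target n θ τ := by
      rw [loss, target, ← mul_sub, ← Finset.sum_sub_distrib]
    have h3 : |M.loss n θ (M.qG τ fun i => y i + θ i)
        - M.loss n θ (fun i => M.shrinkTo i τ m (y i + θ i))| ≤ C * |grandMean y| := by
      refine (abs_loss_sub_le hM θ _ _).trans ?_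
      calc _ ≤ 1 / (n : ℝ) * ∑ _i : Fin n, C * |grandMean y| := by
            refine mul_le_mul_of_nonneg_left (Finset.sum_le_sum fun i _ => ?_) (by positivity)
            refine mul_le_mul (h.weights_le i) ?_ (abs_nonneg _) hC.le
            · rw [qG_eq]
              refine (abs_shrinkTo_sub_le hM _ _ _ _ _ _).trans ?_
              rw [grandMean_add, hm]
              simp
        _ = _ := by simp; field_simp
    rw [e]
    have := abs_add_le (M.loss n θ (M.qG τ fun i => y i + θ i)
      - M.loss n θ (fun i => M.shrinkTo i τ m (y i + θ i)))
      (M.loss n θ (fun i => M.shrinkTo i τ m (y i + θ i)) - M.target n θ τ)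
    rw [sub_add_sub_cancel] at this
    linarith
  have i1 : Integrable (fun y : Fin n → ℝ => |(1 / (n : ℝ))
      * ∑ i : Fin n, (f i (y i) - M.coordTarget i τ (θ i - m))|)
      (centeredLaw fun i : Fin n => M.σp i) := by
    refine ((integrable_finsetSum _ fun i _ => Integrable.sub ?_ (integrable_const _)).const_mul _).abs
    exact (measurePreserving_eval_centeredLaw (fun i : Fin n => M.σp i)
      i).integrable_comp_of_integrable ((hfL i).integrable (by norm_num))
  have i2 : Integrable (fun y : Fin n → ℝ => C * |grandMean y|)
      (centeredLaw fun i : Fin n => M.σp i) := by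
    refine (Integrable.const_mul (integrable_finsetSum _ fun i _ => ?_) _).abs.const_mul C
    exact (memLp_eval_centeredLaw (fun i : Fin n => M.σp i) i).integrable (by norm_num)
  refine (integral_mono_of_nonneg (ae_of_all _ fun y => abs_nonneg _) (i1.add i2)
    (ae_of_all _ hpt)).trans ?_
  simp only [Pi.add_apply]
  rw [integral_add i1 i2, integral_const_mul]
  have e : √(C ^ 2 * C / n) = C * √(C / n) := by
    rw [mul_div_assoc, Real.sqrt_mul (sq_nonneg C), Real.sqrt_sq hC.le]
  rw [e] at h1
  have := mul_le_mul_of_nonneg_left h2 hC.le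
  linarith

end Model

/-! ### The risk estimate under the law of the data -/

lemma integral_abs_gaussianReal_le {v : ℝ} (hv : 0 ≤ v) :
    ∫ x, |x| ∂(gaussianReal 0 v.toNNReal) ≤ √v := by
  have hm : MemLp (fun x : ℝ => |x|) 2 (gaussianReal 0 v.toNNReal) :=
    (memLp_id_gaussianReal' 2 (by norm_num)).abs
  refine Real.le_sqrt_of_sq_le ((sq_integral_le hm).trans ?_)
  simp only [sq_abs]
  have h2 := integral_pow_gaussianReal hv 1
  norm_num at h2
  have h3 : ∫ z : ℝ, z ^ 2 ∂(gaussianReal 0 1) = 1 := integral_sq_gaussian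
  rw [h2, h3, mul_one]

namespace Model

variable {M : Model} {c C : ℝ}

lemma abs_coefC_le (h : M.Bounded c C) (i : ℕ) (τ : ℝ≥0∞) : |M.coefC i τ| ≤ 2 * C := by
  have hM := h.positive
  have h0 := shrink_nonneg hM i τ
  have h1 := shrink_le_one hM i τ
  have hp := hM.σp_pos i
  have hf := hM.σf_pos i
  rw [coefC, abs_mul, abs_of_nonneg (Real.sqrt_nonneg _)]
  refine mul_le_mul ?_ (h.quantile_le i) (abs_nonneg _) (by norm_num)
  rw [Real.sqrt_le_left (by norm_num), div_le_iff₀ (by positivity)]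
  have := h.σp_le_σf i
  nlinarith [mul_le_of_le_one_left hp.le h1, mul_nonneg (sq_nonneg (M.shrink i τ)) hp.le]

lemma abs_coefD_le (h : M.Bounded c C) (i : ℕ) (τ : ℝ≥0∞) : |M.coefD i τ| ≤ √(1 / c) := by
  refine Real.abs_le_sqrt ((coefD_sq_le h.positive i τ).trans ?_)
  have := h.c_pos
  gcongr
  exact (h.σp_ge i).trans (h.σp_le_σf i)

/-- Scale of coordinate `i` in the risk estimate. -/
noncomputable def coordScale (M : Model) (i : ℕ) (τ : ℝ≥0∞) : ℝ :=
  (M.b i + M.h i) * √(M.σf i + M.σp i * M.shrink i τ ^ 2)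

lemma coordScale_nonneg (hM : M.Positive) (i : ℕ) (τ : ℝ≥0∞) : 0 ≤ M.coordScale i τ :=
  mul_nonneg (add_pos (hM.b_pos i) (hM.h_pos i)).le (Real.sqrt_nonneg _)

lemma coordScale_le (h : M.Bounded c C) (i : ℕ) (τ : ℝ≥0∞) :
    M.coordScale i τ ≤ C * √(2 * C) := by
  have hM := h.positive
  have h0 := shrink_nonneg hM i τ
  have h1 := shrink_le_one hM i τ
  refine mul_le_mul (h.weights_le i) (Real.sqrt_le_sqrt ?_) (Real.sqrt_nonneg _) h.C_pos.le
  have h2 := h.σf_le i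
  have h3 := h.σp_le i
  have h4 : M.shrink i τ ^ 2 ≤ 1 := pow_le_one₀ h0 h1
  nlinarith [mul_le_of_le_one_right (hM.σp_pos i).le h4]

/-- Constant in the linear growth of the summands of the risk estimate. -/
noncomputable def growthConst (c C T : ℝ) : ℝ :=
  2 * C + √(1 / c) * (2 * T + √C + 1) + 1

/-- Growth of order `n` is all that is available: bounded averages of `|θ i|` allow single
parameters of order `n`, and the estimate itself is truncated only at `n`. -/
lemma abs_coordT_add_le (h : M.Bounded c C) (γ : ℕ → ℝ) {n : ℕ} (hn : 0 < n) (i : ℕ) (τ : ℝ≥0∞)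
    {t T : ℝ} (hT : 0 ≤ T) (ht : |t| ≤ 2 * T * n) (y : ℝ) :
    |M.coordT γ n i τ (y + t)| ≤ growthConst c C T * n * (1 + |y|) := by
  have hn' : (1 : ℝ) ≤ n := Nat.one_le_cast.2 hn
  have h1 := abs_coordT_le h.positive γ n i τ (y + t)
  have hc := abs_coefC_le h i τ
  have hd := abs_coefD_le h i τ
  have hp : √(M.σp i) ≤ √C := Real.sqrt_le_sqrt (h.σp_le i)
  have hy := abs_nonneg y
  have hC := h.C_pos
  set D := √(1 / c) with hD
  have hD0 : 0 ≤ D := Real.sqrt_nonneg _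
  have hS0 : 0 ≤ √C := Real.sqrt_nonneg _
  have h2 : |M.coefD i τ| * |y + t| ≤ D * (|y| + 2 * T * n) := by
    gcongr
    exact (abs_add_le _ _).trans (by linarith)
  have h3 : |M.coefD i τ| * √(M.σp i) ≤ D * √C := by gcongr
  have k1 : 1 ≤ n * (1 + |y|) := by nlinarith
  have k2 : |y| ≤ n * (1 + |y|) := by nlinarith
  have k3 : (n : ℝ) ≤ n * (1 + |y|) := by nlinarith
  have e : growthConst c C T * n * (1 + |y|) = 2 * C * (n * (1 + |y|)) + D * (n * (1 + |y|))
      + D * (2 * T) * (n * (1 + |y|)) + D * √C * (n * (1 + |y|)) + n * (1 + |y|) := by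
    rw [growthConst, ← hD]; ring
  rw [e]
  have l1 := mul_le_mul_of_nonneg_left k1 (by positivity : 0 ≤ 2 * C)
  have l2 := mul_le_mul_of_nonneg_left k2 hD0
  have l3 := mul_le_mul_of_nonneg_left k3 (by positivity : 0 ≤ D * (2 * T))
  have l4 := mul_le_mul_of_nonneg_left k1 (by positivity : 0 ≤ D * √C)
  linarith

/-- Rate of convergence of the risk estimate for a fixed hyperparameter. -/
noncomputable def devRate (c C T g₀ : ℝ) (n : ℕ) : ℝ :=
  √(concConst c C (C * √(2 * C) * ((2 + √C) * growthConst c C T))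
    * ((C * √(2 * C)) ^ 2 * mseRate n + 1) / n) + C * √(2 * C) * biasRate g₀ n

lemma abs_sub_grandMean_le {n : ℕ} (hn : 0 < n) {θ : Fin n → ℝ} {T : ℝ}
    (hT : (1 / (n : ℝ)) * ∑ i, |θ i| ≤ T) (i : Fin n) : |θ i - grandMean θ| ≤ 2 * T * n := by
  have hn' : (1 : ℝ) ≤ n := Nat.one_le_cast.2 hn
  have hT0 : 0 ≤ T := le_trans (by positivity) hT
  have h1 : ∑ i, |θ i| ≤ T * n := by
    rw [one_div, inv_mul_le_iff₀ (by linarith)] at hT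
    linarith
  have h2 : |θ i| ≤ ∑ i, |θ i| :=
    Finset.single_le_sum (f := fun i => |θ i|) (fun i _ => abs_nonneg _) (Finset.mem_univ i)
  have h3 := (abs_grandMean_le θ).trans hT
  have h4 := abs_sub (θ i) (grandMean θ)
  nlinarith

/-- The summands are centered at their means under the nominal law of the noise, where no grand mean
is subtracted. The centered part is controlled by `integral_sq_mean_dev_le`, and what remains is the
deterministic average of the biases. -/
lemma integral_abs_AREG_sub_target_le (h : M.Bounded c C) {γ : ℕ → ℝ} {g₀ : ℝ} (hg₀ : 0 < g₀)
    (hγ₀ : ∀ i, g₀ ≤ γ i) (hγ : ∀ i, γ i < 1 / √(4 * Real.exp 1) - √(M.σp i / M.σf i)) {n : ℕ}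
    (hlog : 1 ≤ Real.log n) (hn : 16 * C / c ≤ n) {θ : ℕ → ℝ} {T : ℝ}
    (hT : (1 / (n : ℝ)) * ∑ i : Fin n, |θ i| ≤ T) {τ : ℝ≥0∞} (hτ : τ ≠ ∞) :
    Integrable (M.AREG γ n τ) (M.dataLaw n θ) ∧
      ∫ x, |M.AREG γ n τ x - M.target n θ τ| ∂(M.dataLaw n θ) ≤ devRate c C T g₀ n := by
  have hM := h.positive
  have hC := h.C_pos
  have hn0 : 0 < n := by
    rcases Nat.eq_zero_or_pos n with rfl | h0
    · norm_num at hlog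
    · exact h0
  have hn' : (0 : ℝ) < n := Nat.cast_pos.2 hn0
  have hT0 : 0 ≤ T := le_trans (by positivity) hT
  set m := grandMean fun i : Fin n => θ i with hm
  set t : Fin n → ℝ := fun i => θ i - m with ht
  have htn : ∀ i, |t i| ≤ 2 * T * n := fun i => abs_sub_grandMean_le hn0 hT i
  set μ : Fin n → ℝ := fun i =>
    ∫ y, M.coordT γ n i τ (y + t i) ∂(gaussianReal 0 (M.σp i).toNNReal) with hμ
  set g : Fin n → ℝ := fun i => G (M.coefC i τ + M.coefD i τ * t i) (M.ratio i) with hgd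
  set f : Fin n → ℝ → ℝ := fun i y => M.coordScale i τ * (M.coordT γ n i τ (y + t i) - μ i) with hf
  have hmom := fun i : Fin n => coordT_moments hM hg₀ hγ₀ hγ hlog i hτ (t i)
  have hfm : ∀ i, Measurable (f i) := fun i =>
    (((measurable_coordT γ n i τ).comp (measurable_id.add_const _)).sub_const _).const_mul _
  set B₀ := growthConst c C T with hB₀
  have hgr : ∀ (i : Fin n) (y : ℝ), |M.coordT γ n i τ (y + t i)| ≤ B₀ * n * (1 + |y|) := fun i =>
    abs_coordT_add_le h γ hn0 i τ hT0 (htn i)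
  have hB₀0 : 0 ≤ B₀ := by
    rw [hB₀, growthConst]; positivity
  have hμb : ∀ i, |μ i| ≤ B₀ * n * (1 + √C) := by
    intro i
    have hx := integrable_id_gaussianReal' 0 (M.σp i).toNNReal
    have hi : Integrable (fun y : ℝ => B₀ * n * (1 + |y|)) (gaussianReal 0 (M.σp i).toNNReal) :=
      ((integrable_const _).add hx.abs).const_mul _
    refine (abs_integral_le_integral_abs).trans ((integral_mono_of_nonneg
      (ae_of_all _ fun y => abs_nonneg _) hi (ae_of_all _ fun y => hgr i y)).trans ?_)
    rw [integral_const_mul, integral_add (integrable_const _) hx.abs, integral_const, probReal_univ,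
      one_smul]
    gcongr
    exact (integral_abs_gaussianReal_le (hM.σp_pos i).le).trans (Real.sqrt_le_sqrt (h.σp_le i))
  have hfb : ∀ i x, |f i x| ≤ C * √(2 * C) * ((2 + √C) * B₀) * n * (1 + |x|) := by
    intro i x
    have h1 : |M.coordT γ n i τ (x + t i) - μ i| ≤ (2 + √C) * B₀ * n * (1 + |x|) := by
      refine (abs_sub _ _).trans ?_
      have h2 := hgr i x
      have h3 := hμb i
      have h4 : B₀ * n * (1 + √C) ≤ B₀ * n * (1 + √C) * (1 + |x|) :=
        le_mul_of_one_le_right (by positivity) (by linarith [abs_nonneg x])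
      nlinarith
    rw [hf]
    simp only
    rw [abs_mul, abs_of_nonneg (coordScale_nonneg hM i τ)]
    calc _ ≤ C * √(2 * C) * ((2 + √C) * B₀ * n * (1 + |x|)) :=
          mul_le_mul (coordScale_le h i τ) h1 (abs_nonneg _) (by positivity)
      _ = _ := by ring
  have hiT : ∀ i : Fin n, Integrable (fun y => M.coordT γ n i τ (y + t i))
      (gaussianReal 0 (M.σp i).toNNReal) := fun i => (hmom i).1.integrable (by norm_num)
  have hz : ∀ i : Fin n, ∫ x, f i x ∂(gaussianReal 0 (M.σp i).toNNReal) = 0 := by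
    intro i
    rw [hf]
    simp only
    rw [integral_const_mul, integral_sub (hiT i) (integrable_const _)]
    simp [hμ]
  have hV : ∀ i : Fin n, ∫ x, f i x ^ 2 ∂(gaussianReal 0 (M.σp i).toNNReal)
      ≤ (C * √(2 * C)) ^ 2 * mseRate n := by
    intro i
    simp only [hf, mul_pow]
    rw [integral_const_mul]
    refine mul_le_mul ?_ ((integral_sq_sub_integral_le (hmom i).1 (g i)).trans (hmom i).2.2)
      (integral_nonneg fun x => sq_nonneg _) (by positivity)
    rw [← mul_pow]
    exact pow_le_pow_left₀ (coordScale_nonneg hM i τ) (coordScale_le h i τ) 2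
  have hσ0 : ∀ i : Fin n, 0 ≤ M.σp i := fun i => (hM.σp_pos i).le
  have hconc := integral_sq_mean_dev_le (σ := fun i : Fin n => M.σp i) h.c_pos hn hn0
    (fun i => h.σp_ge i) (fun i => h.σp_le i) hfm hfb hz hV
  have hmL : MemLp (fun y : Fin n → ℝ => (1 / (n : ℝ)) * ∑ i, f i (y i - grandMean y)) 2
      (centeredLaw fun i : Fin n => M.σp i) :=
    (memLp_finsetSum _ fun i _ => memLp_comp_dev hσ0 hfm hfb i).const_mul _
  have e : ∀ y : Fin n → ℝ, M.AREG γ n τ (fun i => y i + θ i) - M.target n θ τ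
      = (1 / (n : ℝ)) * ∑ i, f i (y i - grandMean y)
        + (1 / (n : ℝ)) * ∑ i : Fin n, M.coordScale i τ * (μ i - g i) := by
    intro y
    have e1 : ∀ i : Fin n, y i + θ i - grandMean (fun i : Fin n => y i + θ i)
        = y i - grandMean y + t i := by
      intro i
      rw [grandMean_add, ht, hm]; ring
    have e2 : M.target n θ τ = (1 / (n : ℝ)) * ∑ i : Fin n, M.coordScale i τ * g i := rfl
    have e3 : M.AREG γ n τ (fun i => y i + θ i)
        = (1 / (n : ℝ)) * ∑ i : Fin n, M.coordScale i τ
          * M.coordT γ n i τ (y i + θ i - grandMean (fun i : Fin n => y i + θ i)) := rfl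
    rw [e2, e3, ← mul_sub, ← mul_add, ← Finset.sum_sub_distrib, ← Finset.sum_add_distrib]
    simp_rw [e1, hf]
    congr 1
    refine Finset.sum_congr rfl fun i _ => ?_
    ring
  have hbias : |(1 / (n : ℝ)) * ∑ i : Fin n, M.coordScale i τ * (μ i - g i)|
      ≤ C * √(2 * C) * biasRate g₀ n := by
    rw [abs_mul, abs_of_nonneg (by positivity : (0 : ℝ) ≤ 1 / n)]
    calc _ ≤ 1 / (n : ℝ) * ∑ _i : Fin n, C * √(2 * C) * biasRate g₀ n := by
          refine mul_le_mul_of_nonneg_left ((Finset.abs_sum_le_sum_abs _ _).trans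
            (Finset.sum_le_sum fun i _ => ?_)) (by positivity)
          rw [abs_mul, abs_of_nonneg (coordScale_nonneg hM i τ)]
          exact mul_le_mul (coordScale_le h i τ) (hmom i).2.1 (abs_nonneg _) (by positivity)
      _ = _ := by simp; field_simp
  have hi := hmL.integrable (by norm_num)
  have hi2 : Integrable (fun y : Fin n → ℝ =>
      M.AREG γ n τ (fun i => y i + θ i) - M.target n θ τ) (centeredLaw fun i : Fin n => M.σp i) := by
    simp_rw [e]
    exact hi.add (integrable_const _)
  constructor
  · have hi3 : Integrable (fun y : Fin n → ℝ => M.AREG γ n τ (fun i => y i + θ i))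
        (centeredLaw fun i : Fin n => M.σp i) := by
      have := hi2.add (integrable_const (M.target n θ τ))
      refine this.congr (ae_of_all _ fun y => ?_)
      simp
    exact ((measurePreserving_shift n θ).integrable_comp_emb
      (measurableEmbedding_addRight (G := Fin n → ℝ) fun i : Fin n => θ i)).1 hi3
  · rw [integral_dataLaw]
    simp_rw [e]
    have hL1 : ∫ y : Fin n → ℝ, |(1 / (n : ℝ)) * ∑ i, f i (y i - grandMean y)|
        ∂(centeredLaw fun i : Fin n => M.σp i)
        ≤ √(concConst c C (C * √(2 * C) * ((2 + √C) * B₀))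
          * ((C * √(2 * C)) ^ 2 * mseRate n + 1) / n) := by
      have hm' : MemLp (fun y : Fin n → ℝ => |(1 / (n : ℝ)) * ∑ i, f i (y i - grandMean y)|) 2
        (centeredLaw fun i : Fin n => M.σp i) := hmL.abs
      refine Real.le_sqrt_of_sq_le ((sq_integral_le hm').trans ?_)
      simp only [sq_abs]
      exact hconc
    refine (integral_mono_of_nonneg (ae_of_all _ fun y => abs_nonneg _)
      (hi.abs.add (integrable_const (C * √(2 * C) * biasRate g₀ n)))
      (ae_of_all _ fun y => (abs_add_le _ _).trans (add_le_add le_rfl hbias))).trans ?_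
    simp only [Pi.add_apply]
    rw [integral_add hi.abs (integrable_const _), integral_const, probReal_univ, one_smul, devRate]
    exact add_le_add hL1 le_rfl

end Model

/-! ### The grid -/

/-- The coordinate `τ / (τ + 1)` of `[0, ∞]`. -/
noncomputable def unitCoord (τ : ℝ≥0∞) : ℝ := if τ = ∞ then 1 else τ.toReal / (τ.toReal + 1)

lemma unitCoord_nonneg (τ : ℝ≥0∞) : 0 ≤ unitCoord τ := by
  unfold unitCoord
  split_ifs
  · exact zero_le_one
  · positivity

lemma unitCoord_le_one (τ : ℝ≥0∞) : unitCoord τ ≤ 1 := by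
  unfold unitCoord
  split_ifs
  · exact le_rfl
  · rw [div_le_one (by positivity)]; linarith

/-- The point of the grid of mesh `δ` with number `j`. -/
noncomputable def gridPoint (δ : ℝ) (j : ℕ) : ℝ≥0∞ :=
  ENNReal.ofReal (j * δ) / ENNReal.ofReal (1 - j * δ)

lemma gridPoint_ne_top {δ : ℝ} {j : ℕ} (hj : j * δ < 1) : gridPoint δ j ≠ ∞ :=
  ENNReal.div_ne_top ENNReal.ofReal_ne_top (by simpa using hj)

lemma unitCoord_gridPoint {δ : ℝ} (hδ : 0 ≤ δ) {j : ℕ} (hj : j * δ < 1) :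
    unitCoord (gridPoint δ j) = j * δ := by
  rw [unitCoord, if_neg (gridPoint_ne_top hj), gridPoint, ENNReal.toReal_div,
    ENNReal.toReal_ofReal (by positivity), ENNReal.toReal_ofReal (by linarith)]
  have : 1 - j * δ ≠ 0 := by linarith
  field_simp
  ring

lemma mul_lt_one_of_lt_ceil {δ : ℝ} (hδ : 0 < δ) {j : ℕ} (hj : j < ⌈1 / δ⌉₊) : j * δ < 1 := by
  rw [← lt_div_iff₀ hδ]
  exact Nat.lt_ceil.1 hj

/-- Every point of `[0, 1]` is within `δ` of a point of the grid. -/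
lemma exists_grid_near {δ u : ℝ} (hδ : 0 < δ) (h0 : 0 ≤ u) (h1 : u ≤ 1) :
    ∃ j < ⌈1 / δ⌉₊, |j * δ - u| ≤ δ := by
  have hle : ⌈u / δ⌉₊ ≤ ⌈1 / δ⌉₊ := Nat.ceil_mono (by gcongr)
  have hp : 0 < ⌈1 / δ⌉₊ := Nat.ceil_pos.2 (by positivity)
  -- For `u > 0` this is the last grid point strictly below `u`, which covers `u = 1` although all
  -- grid points are below `1`. For `u = 0` the truncated subtraction gives the point `0`.
  refine ⟨⌈u / δ⌉₊ - 1, by omega, ?_⟩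
  rcases Nat.eq_zero_or_pos ⌈u / δ⌉₊ with h | h
  · have : u / δ ≤ 0 := Nat.ceil_eq_zero.1 h
    have hu : u = 0 := by
      have := div_nonneg h0 hδ.le
      have : u / δ = 0 := by linarith
      rcases div_eq_zero_iff.1 this with h | h
      · exact h
      · exact absurd h hδ.ne'
    simp [hu, hδ.le]
  · have h2 := Nat.le_ceil (u / δ)
    have h3 := Nat.ceil_lt_add_one (div_nonneg h0 hδ.le)
    rw [div_le_iff₀ hδ] at h2
    rw [← sub_lt_iff_lt_add, lt_div_iff₀ hδ] at h3
    rw [Nat.cast_sub h, Nat.cast_one, abs_le]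
    constructor <;> nlinarith

namespace Model

variable {M : Model} {c C : ℝ}

/-- In this coordinate `τ = ∞` is the ordinary endpoint `1`, and the denominator lies between `1`
and `σp`; hence the shrinkage factor is Lipschitz on the whole of `[0, ∞]`. -/
lemma shrink_eq_unitCoord (hM : M.Positive) (i : ℕ) (τ : ℝ≥0∞) :
    M.shrink i τ = unitCoord τ / (unitCoord τ + (1 - unitCoord τ) * M.σp i) := by
  unfold shrink unitCoord
  have := hM.σp_pos i
  split_ifs
  · simp
  · have h1 : τ.toReal + 1 ≠ 0 := by positivity
    have e : τ.toReal / (τ.toReal + 1) + (1 - τ.toReal / (τ.toReal + 1)) * M.σp i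
        = (τ.toReal + M.σp i) / (τ.toReal + 1) := by
      field_simp
      ring
    rw [e, div_div_div_cancel_right₀ h1]

/-- Lipschitz constant of the shrinkage factors. -/
noncomputable def shrinkConst (c C : ℝ) : ℝ := C / (min 1 c * min 1 c)

lemma abs_shrink_sub_le (h : M.Bounded c C) (i : ℕ) (τ τ' : ℝ≥0∞) :
    |M.shrink i τ - M.shrink i τ'| ≤ shrinkConst c C * |unitCoord τ - unitCoord τ'| := by
  have hM := h.positive
  have hc : 0 < min 1 c := lt_min one_pos h.c_pos
  have hσ := hM.σp_pos i
  have hle : ∀ u : ℝ, 0 ≤ u → u ≤ 1 → min 1 c ≤ u + (1 - u) * M.σp i := by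
    intro u h0 h1
    have a1 : min 1 c ≤ 1 := min_le_left _ _
    have a2 : min 1 c ≤ M.σp i := (min_le_right _ _).trans (h.σp_ge i)
    nlinarith [mul_le_mul_of_nonneg_left a1 h0, mul_le_mul_of_nonneg_left a2 (sub_nonneg.2 h1)]
  rw [shrink_eq_unitCoord hM, shrink_eq_unitCoord hM]
  have d1 := hle _ (unitCoord_nonneg τ) (unitCoord_le_one τ)
  have d2 := hle _ (unitCoord_nonneg τ') (unitCoord_le_one τ')
  generalize unitCoord τ = u at *
  generalize unitCoord τ' = u' at *
  have p1 : 0 < u + (1 - u) * M.σp i := hc.trans_le d1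
  have p2 : 0 < u' + (1 - u') * M.σp i := hc.trans_le d2
  have e : u / (u + (1 - u) * M.σp i) - u' / (u' + (1 - u') * M.σp i)
      = M.σp i * (u - u') / ((u + (1 - u) * M.σp i) * (u' + (1 - u') * M.σp i)) := by
    rw [div_sub_div _ _ p1.ne' p2.ne']
    congr 1
    ring
  rw [e, abs_div, abs_mul, abs_of_pos hσ, abs_of_pos (mul_pos p1 p2), shrinkConst,
    div_mul_eq_mul_div]
  have hC := h.C_pos
  gcongr
  exact h.σp_le i

lemma abs_sqrt_add_sub_le {a s x y : ℝ} (ha : 0 < a) (hs : 0 ≤ s) (hsa : s ≤ a) (hx : 0 ≤ x)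
    (hy : 0 ≤ y) : |√(a + x * s) - √(a + y * s)| ≤ √a * |x - y| := by
  have hsq : 0 < √a := Real.sqrt_pos.2 ha
  have h1 : √a ≤ √(a + x * s) := Real.sqrt_le_sqrt (by nlinarith)
  have h2 : 0 ≤ √(a + y * s) := Real.sqrt_nonneg _
  have e : (√(a + x * s) - √(a + y * s)) * (√(a + x * s) + √(a + y * s)) = (x - y) * s := by
    have e1 := Real.sq_sqrt (by positivity : 0 ≤ a + x * s)
    have e2 := Real.sq_sqrt (by positivity : 0 ≤ a + y * s)
    nlinarith
  have e' := congrArg abs e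
  rw [abs_mul, abs_mul, abs_of_nonneg (by linarith : 0 ≤ √(a + x * s) + √(a + y * s)),
    abs_of_nonneg hs] at e'
  have h3 : |√(a + x * s) - √(a + y * s)| * √a ≤ |x - y| * a := by
    calc _ ≤ |√(a + x * s) - √(a + y * s)| * (√(a + x * s) + √(a + y * s)) := by
          gcongr; linarith
      _ = |x - y| * s := e'
      _ ≤ _ := by gcongr
  refine le_of_mul_le_mul_right (h3.trans_eq ?_) hsq
  calc |x - y| * a = |x - y| * (√a * √a) := by rw [Real.mul_self_sqrt ha.le]
    _ = _ := by ring

lemma abs_shrinkTo_sub_le_shrink (h : M.Bounded c C) (i : ℕ) (τ τ' : ℝ≥0∞) (m x : ℝ) :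
    |M.shrinkTo i τ m x - M.shrinkTo i τ' m x|
      ≤ |M.shrink i τ - M.shrink i τ'| * (|x| + |m| + √C * C) := by
  have hM := h.positive
  have hC := h.C_pos
  have h3 := abs_sqrt_add_sub_le (hM.σf_pos i) (hM.σp_pos i).le (h.σp_le_σf i)
    (shrink_nonneg hM i τ) (shrink_nonneg hM i τ')
  set a := M.shrink i τ
  set a' := M.shrink i τ'
  set s := √(M.σf i + a * M.σp i) with hs
  set s' := √(M.σf i + a' * M.σp i) with hs'
  have e : M.shrinkTo i τ m x - M.shrinkTo i τ' m x
      = (a - a') * (x - m) + (s - s') * stdQuantile (M.ratio i) := by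
    unfold shrinkTo; ring
  rw [e]
  have h1 : |(a - a') * (x - m)| ≤ |a - a'| * (|x| + |m|) := by
    rw [abs_mul]
    gcongr
    exact abs_sub _ _
  have h2 : |(s - s') * stdQuantile (M.ratio i)| ≤ |a - a'| * (√C * C) := by
    rw [abs_mul]
    calc _ ≤ (√(M.σf i) * |a - a'|) * C :=
          mul_le_mul h3 (h.quantile_le i) (abs_nonneg _) (by positivity)
      _ ≤ (√C * |a - a'|) * C := by
          gcongr
          exact h.σf_le i
      _ = _ := by ring
  calc _ ≤ _ := abs_add_le _ _
    _ ≤ |a - a'| * (|x| + |m|) + |a - a'| * (√C * C) := add_le_add h1 h2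
    _ = _ := by ring

/-- The loss is a Lipschitz function of the hyperparameter. -/
lemma abs_loss_qG_sub_le (h : M.Bounded c C) {n : ℕ} (hn : 0 < n) (θ : ℕ → ℝ) (τ τ' : ℝ≥0∞)
    (x : Fin n → ℝ) :
    |M.loss n θ (M.qG τ x) - M.loss n θ (M.qG τ' x)|
      ≤ |unitCoord τ - unitCoord τ'| * (C * shrinkConst c C
        * (2 * ((1 / (n : ℝ)) * ∑ i, |x i|) + √C * C)) := by
  have hC := h.C_pos
  have hn' : (0 : ℝ) < n := Nat.cast_pos.2 hn
  have hs : 0 ≤ shrinkConst c C := by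
    have := lt_min one_pos h.c_pos
    unfold shrinkConst; positivity
  set Δ := |unitCoord τ - unitCoord τ'| with hΔ
  have hΔ0 : 0 ≤ Δ := abs_nonneg _
  set m := (1 / (n : ℝ)) * ∑ i, |x i| with hm
  have hgm : |grandMean x| ≤ m := abs_grandMean_le x
  refine (abs_loss_sub_le h.positive θ _ _).trans ?_
  calc _ ≤ (1 / (n : ℝ)) * ∑ i : Fin n, C * (shrinkConst c C * Δ * (|x i| + m + √C * C)) := by
        refine mul_le_mul_of_nonneg_left (Finset.sum_le_sum fun i _ => ?_) (by positivity)
        refine mul_le_mul (h.weights_le i) ?_ (abs_nonneg _) hC.le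
        refine (abs_shrinkTo_sub_le_shrink h i τ τ' (grandMean x) (x i)).trans ?_
        refine mul_le_mul (abs_shrink_sub_le h i τ τ') (by linarith) (by positivity) (by positivity)
    _ = Δ * (C * shrinkConst c C * ((1 / (n : ℝ)) * ∑ i : Fin n, (|x i| + m + √C * C))) := by
        simp_rw [← Finset.mul_sum]
        ring
    _ = _ := by
        have e : (1 / (n : ℝ)) * ∑ i : Fin n, (|x i| + m + √C * C) = 2 * m + √C * C := by
          simp only [Finset.sum_add_distrib, Finset.sum_const, Finset.card_univ, Fintype.card_fin,
            nsmul_eq_mul]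
          rw [mul_add, mul_add, ← hm]
          field_simp
          ring
        rw [e]

end Model

/-! ### Rates -/

lemma tendsto_log_natCast : Tendsto (fun n : ℕ => Real.log n) atTop atTop :=
  Real.tendsto_log_atTop.comp tendsto_natCast_atTop_atTop

lemma tendsto_log_log_natCast : Tendsto (fun n : ℕ => Real.log (Real.log n)) atTop atTop :=
  Real.tendsto_log_atTop.comp tendsto_log_natCast

/-- The eighth power gives `log⁴ n ≤ √n`, which absorbs the factor `log² n √(2 log n)` of the
truncation error. -/
lemma eventually_log_pow_le : ∀ᶠ n : ℕ in atTop, Real.log n ^ 8 ≤ n := by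
  have h := (Real.isLittleO_pow_log_id_atTop (n := 8)).bound one_pos
  filter_upwards [tendsto_natCast_atTop_atTop.eventually h] with n hn
  simp only [Real.norm_eq_abs, id_eq, one_mul] at hn
  rw [abs_of_nonneg (by positivity : (0 : ℝ) ≤ n)] at hn
  exact (le_abs_self _).trans hn

lemma log_sq_mul_sqrt_div_le {n : ℕ} (h1 : 2 ≤ Real.log n) (h2 : Real.log n ^ 8 ≤ n) :
    Real.log n ^ 2 * √n / n ≤ 1 / √(2 * Real.log n) := by
  set l := Real.log n with hl
  have hn : (0 : ℝ) < n := lt_of_lt_of_le (by positivity) h2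
  have h3 : l ^ 4 ≤ √n := Real.le_sqrt_of_sq_le (by rw [← pow_mul]; exact h2)
  have h4 : √(2 * l) ≤ l := by
    rw [Real.sqrt_le_left (by linarith)]
    nlinarith
  have hs : 0 < √(n : ℝ) := Real.sqrt_pos.2 hn
  have hq : 0 < √(2 * l) := Real.sqrt_pos.2 (by linarith)
  have e : l ^ 2 * √n / n = l ^ 2 / √n := by
    nth_rewrite 2 [← Real.mul_self_sqrt hn.le]
    field_simp
  rw [e, div_le_div_iff₀ hs hq, one_mul]
  calc l ^ 2 * √(2 * l) ≤ l ^ 2 * l ^ 2 := by gcongr; nlinarith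
    _ = l ^ 4 := by ring
    _ ≤ √n := h3

lemma log_div_le {n : ℕ} (h1 : 2 ≤ Real.log n) (h2 : Real.log n ^ 8 ≤ n) :
    Real.log n / n ≤ 1 / √(2 * Real.log n) := by
  set l := Real.log n with hl
  have hn : (0 : ℝ) < n := lt_of_lt_of_le (by positivity) h2
  have h4 : √(2 * l) ≤ l := by
    rw [Real.sqrt_le_left (by linarith)]
    nlinarith
  have hq : 0 < √(2 * l) := Real.sqrt_pos.2 (by linarith)
  rw [div_le_div_iff₀ hn hq, one_mul]
  have h5 : l ^ 2 ≤ l ^ 8 := pow_le_pow_right₀ (by linarith) (by norm_num)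
  nlinarith

lemma mseRate_div_le {n : ℕ} (h1 : 2 ≤ Real.log n) (h2 : Real.log n ^ 8 ≤ n) :
    mseRate n / n ≤ 132 * (1 / √(2 * Real.log n)) := by
  have hn : (0 : ℝ) < n := lt_of_lt_of_le (by positivity) h2
  have a1 := log_sq_mul_sqrt_div_le h1 h2
  have a2 := log_div_le h1 h2
  have a3 : 1 / (n : ℝ) ≤ Real.log n / n / 2 := by
    rw [div_div, div_le_div_iff₀ hn (by positivity)]
    nlinarith
  have e : mseRate n / n = 24 * (1 / (n : ℝ)) + 4 * (Real.log n / n)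
      + 114 * (Real.log n ^ 2 * √n / n) + 2 * (1 / √(2 * Real.log n)) := by
    rw [mseRate]
    field_simp
  rw [e]
  linarith

lemma biasRate_le {g₀ : ℝ} (hg₀ : 0 < g₀) {n : ℕ} (h1 : 2 ≤ Real.log n)
    (h2 : Real.log n ^ 8 ≤ n) :
    biasRate g₀ n ≤ (3 / g₀ + 12 / g₀ ^ 2 + 59) * (1 / √(2 * Real.log n)) := by
  have a1 := log_sq_mul_sqrt_div_le h1 h2
  have hq : 1 ≤ √(2 * Real.log n) := by rw [Real.one_le_sqrt]; linarith
  set q := √(2 * Real.log n) with hqd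
  have hq0 : 0 < q := by linarith
  have a2 : 1 / (g₀ * q) ^ 2 ≤ 1 / g₀ ^ 2 * (1 / q) := by
    rw [mul_pow, ← one_div_mul_one_div]
    gcongr
    nlinarith
  have e : biasRate g₀ n = 3 / g₀ * (1 / q) + 12 * (1 / (g₀ * q) ^ 2)
      + 57 * (Real.log n ^ 2 * √n / n) + 2 * (1 / q) := by
    rw [biasRate, ← hqd]
    field_simp
    ring
  rw [e]
  have : (3 / g₀ + 12 / g₀ ^ 2 + 59) * (1 / q)
      = 3 / g₀ * (1 / q) + 12 * (1 / g₀ ^ 2 * (1 / q)) + 57 * (1 / q) + 2 * (1 / q) := by ring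
  rw [this]
  linarith

/-- Common rate of the errors. -/
noncomputable def errRate (n : ℕ) : ℝ := √(1 / √(2 * Real.log n))

/-- The dominant contribution to the mean squared error divided by `n` is of order `1/√log n`; its
square root is `errRate`, and all other errors are no larger in order. -/
lemma devRate_le {c C T g₀ : ℝ} (hC : 0 ≤ C) (hg₀ : 0 < g₀) :
    ∃ K, ∀ᶠ n : ℕ in atTop, Model.devRate c C T g₀ n + 2 * C * √(C / n) ≤ K * errRate n := by
  -- The absolute value dispenses with the sign of the constant.
  set A := |concConst c C (C * √(2 * C) * ((2 + √C) * Model.growthConst c C T))| with hA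
  refine ⟨√(A * ((C * √(2 * C)) ^ 2 * 132 + 1))
    + C * √(2 * C) * (3 / g₀ + 12 / g₀ ^ 2 + 59) + 2 * C * √C, ?_⟩
  filter_upwards [tendsto_log_natCast.eventually_ge_atTop 2, eventually_log_pow_le] with n h1 h2
  have hn : (0 : ℝ) < n := lt_of_lt_of_le (by positivity) h2
  have hq : 1 ≤ √(2 * Real.log n) := by rw [Real.one_le_sqrt]; linarith
  have b1 := mseRate_div_le h1 h2
  have b2 := biasRate_le hg₀ h1 h2
  have b3 := log_div_le h1 h2
  rw [Model.devRate, errRate]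
  set q := √(2 * Real.log n) with hqd
  have hq0 : 0 < q := by linarith
  have hq1 : 1 / q ≤ 1 := by rw [div_le_one hq0]; exact hq
  have hqq : 1 / q ≤ √(1 / q) := Real.le_sqrt_of_sq_le (by
    have : 0 ≤ 1 / q := by positivity
    nlinarith)
  have b4 : 1 / (n : ℝ) ≤ 1 / q := by
    refine le_trans ?_ b3
    gcongr
    linarith
  have c1 : √(concConst c C (C * √(2 * C) * ((2 + √C) * Model.growthConst c C T))
      * ((C * √(2 * C)) ^ 2 * mseRate n + 1) / n)
      ≤ √(A * ((C * √(2 * C)) ^ 2 * 132 + 1)) * √(1 / q) := by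
    rw [← Real.sqrt_mul (by positivity)]
    refine Real.sqrt_le_sqrt ?_
    have m0 : 0 ≤ mseRate n := by
      have : 0 ≤ Real.log n := by linarith
      rw [mseRate]; positivity
    calc _ ≤ A * ((C * √(2 * C)) ^ 2 * mseRate n + 1) / n := by
          gcongr
          exact le_abs_self _
      _ = A * ((C * √(2 * C)) ^ 2 * (mseRate n / n) + 1 / n) := by ring
      _ ≤ A * ((C * √(2 * C)) ^ 2 * (132 * (1 / q)) + 1 / q) := by gcongr
      _ = _ := by ring
  have c2 : C * √(2 * C) * biasRate g₀ n
      ≤ C * √(2 * C) * (3 / g₀ + 12 / g₀ ^ 2 + 59) * √(1 / q) := by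
    rw [mul_assoc (C * √(2 * C))]
    gcongr
    refine b2.trans ?_
    gcongr
  have c3 : 2 * C * √(C / n) ≤ 2 * C * √C * √(1 / q) := by
    rw [mul_assoc (2 * C), ← Real.sqrt_mul hC, div_eq_mul_one_div]
    gcongr
  linarith

/-- `1/mesh` is of the form in parentheses, and `log log n` is negligible against `(log n)^(1/4)`.
-/
lemma tendsto_log_log_mul_errRate (K₀ K₁ K₂ : ℝ) :
    Tendsto (fun n : ℕ => (K₀ + K₁ * √(Real.log (Real.log n)) + K₂ * Real.log (Real.log n))
      * errRate n) atTop (𝓝 0) := by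
  have h1 : Tendsto (fun x : ℝ => Real.log x / x ^ (1 / 4 : ℝ)) atTop (𝓝 0) :=
    (isLittleO_log_rpow_atTop (by norm_num)).tendsto_div_nhds_zero
  have h2 : Tendsto (fun n : ℕ => Real.log (Real.log n) / (Real.log n) ^ (1 / 4 : ℝ)) atTop (𝓝 0) :=
    h1.comp tendsto_log_natCast
  have h3 := h2.const_mul (|K₀| + |K₁| + |K₂|)
  rw [mul_zero] at h3
  refine squeeze_zero_norm' ?_ h3
  filter_upwards [tendsto_log_natCast.eventually_ge_atTop 2,
    tendsto_log_log_natCast.eventually_ge_atTop 1] with n hl ha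
  set l := Real.log n with hld
  set a := Real.log l with had
  have hl0 : 0 < l := by linarith
  have hp : 0 < l ^ (1 / 4 : ℝ) := Real.rpow_pos_of_pos hl0 _
  have hsa : √a ≤ a := by
    rw [Real.sqrt_le_left (by linarith)]
    nlinarith
  have he : errRate n ≤ 1 / l ^ (1 / 4 : ℝ) := by
    have e : l ^ (1 / 4 : ℝ) = √(√l) := by
      rw [Real.sqrt_eq_rpow, Real.sqrt_eq_rpow, ← Real.rpow_mul hl0.le]
      norm_num
    rw [errRate, ← hld, Real.sqrt_div zero_le_one, Real.sqrt_one, e]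
    have : 0 < √(√l) := Real.sqrt_pos.2 (Real.sqrt_pos.2 hl0)
    gcongr
    linarith
  have he0 : 0 ≤ errRate n := Real.sqrt_nonneg _
  have hb : |K₀ + K₁ * √a + K₂ * a| ≤ (|K₀| + |K₁| + |K₂|) * a := by
    have := abs_add_three K₀ (K₁ * √a) (K₂ * a)
    rw [abs_mul, abs_mul, abs_of_nonneg (Real.sqrt_nonneg a), abs_of_nonneg (by linarith : 0 ≤ a)]
      at this
    have p0 := mul_le_mul_of_nonneg_left ha (abs_nonneg K₀)
    have p1 := mul_le_mul_of_nonneg_left hsa (abs_nonneg K₁)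
    linarith
  rw [Real.norm_eq_abs, abs_mul, abs_of_nonneg he0]
  calc _ ≤ ((|K₀| + |K₁| + |K₂|) * a) * (1 / l ^ (1 / 4 : ℝ)) := by gcongr
    _ = _ := by ring

lemma tendsto_mesh {C₁ C₂ : ℝ} (h1 : 0 < C₁) (h2 : 0 < C₂) (C₃ C₄ : ℝ) :
    Tendsto (mesh C₁ C₂ C₃ C₄) atTop (𝓝 0) := by
  have ha := tendsto_log_log_natCast
  have hs : Tendsto (fun n : ℕ => √(Real.log (Real.log n))) atTop atTop :=
    Real.tendsto_sqrt_atTop.comp ha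
  have h3 : Tendsto (fun n : ℕ => √(Real.log (Real.log n)) * C₄ + Real.log (Real.log n))
      atTop atTop := by
    -- With `a = log log n`, the expression is `√a (√a + C₄)`, which diverges whatever the sign of
    -- `C₄`.
    have h4 := hs.atTop_mul_atTop₀ (tendsto_atTop_add_const_right _ C₄ hs)
    refine h4.congr' ?_
    filter_upwards [ha.eventually_ge_atTop 0] with n hn
    nlinarith [Real.mul_self_sqrt hn]
  have h5 := (tendsto_atTop_add_const_left _ (2 * stdPDF 0 + C₃) h3).const_mul_atTop
    (by positivity : 0 < 2 * C₁ * C₂)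
  refine (tendsto_inv_atTop_zero.comp h5).congr fun n => ?_
  simp only [Function.comp_def, mesh]
  congr 2
  ring

lemma tendsto_ceil_mesh_mul_errRate {C₁ C₂ C₃ C₄ : ℝ} (hm : ∀ n, 0 < mesh C₁ C₂ C₃ C₄ n) :
    Tendsto (fun n : ℕ => (⌈1 / mesh C₁ C₂ C₃ C₄ n⌉₊ : ℝ) * errRate n) atTop (𝓝 0) := by
  refine squeeze_zero (fun n => mul_nonneg (Nat.cast_nonneg _) (Real.sqrt_nonneg _)) (fun n => ?_)
    (tendsto_log_log_mul_errRate (2 * C₁ * C₂ * (2 * stdPDF 0 + C₃) + 1) (2 * C₁ * C₂ * C₄)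
      (2 * C₁ * C₂))
  refine mul_le_mul_of_nonneg_right ?_ (Real.sqrt_nonneg _)
  have h := (Nat.ceil_lt_add_one (one_div_pos.2 (hm n)).le).le
  refine h.trans_eq ?_
  rw [mesh, one_div, inv_inv]
  ring

/-! ### Comparison of the losses -/

namespace Model

variable {M : Model} {c C : ℝ}

lemma exists_bounded (hM : M.Positive) (hA1 : M.A1) (hA3 : M.A3) {θ : ℕ → ℝ} {C₁ C₂ C₃ C₄ : ℝ}
    (hC : M.GridConstants θ C₁ C₂ C₃ C₄) : ∃ c C, M.Bounded c C := by
  obtain ⟨⟨r, hr, hrle⟩, ⟨Cf, hCf⟩, c, hc, hcle⟩ := hA3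
  obtain ⟨-, -, Cw, hCw⟩ := hA1
  -- The quantiles are bounded by fixing the coordinate `0` in the variance ratio of the condition
  -- `quantiles`.
  refine ⟨c, max (max Cf Cw) (C₃ / (M.σp 0 / M.σf 0)), hM, hc, hcle, fun i => ?_,
    fun i => (hCf i).trans ((le_max_left _ _).trans (le_max_left _ _)),
    fun i => (hCw i).trans ((le_max_right _ _).trans (le_max_left _ _)),
    fun i => le_trans ?_ (le_max_right _ _)⟩
  · have h1 : 1 / (4 * Real.exp 1) ≤ 1 := by
      rw [div_le_one (by positivity)]
      have := Real.add_one_le_exp (1 : ℝ)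
      linarith
    have h2 := (hrle i).trans (hr.le.trans h1)
    rwa [div_le_one (hM.σf_pos i)] at h2
  · rw [le_div_iff₀ (div_pos (hM.σp_pos 0) (hM.σf_pos 0)), mul_comm]
    exact hC.quantiles 0 i

lemma integral_abs_eval_dataLaw_le (h : M.Bounded c C) (n : ℕ) (θ : ℕ → ℝ) (i : Fin n) :
    ∫ x : Fin n → ℝ, |x i| ∂(M.dataLaw n θ) ≤ |θ i| + √C := by
  have hM := h.positive
  have hx : Integrable (fun y : Fin n → ℝ => y i) (centeredLaw fun i : Fin n => M.σp i) :=
    (memLp_eval_centeredLaw (fun i : Fin n => M.σp i) i).integrable (by norm_num)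
  rw [integral_dataLaw]
  refine (integral_mono_of_nonneg (ae_of_all _ fun y => abs_nonneg _)
    (hx.abs.add (integrable_const |θ i|)) (ae_of_all _ fun y => abs_add_le _ _)).trans ?_
  simp only [Pi.add_apply]
  rw [integral_add hx.abs (integrable_const _), integral_const, probReal_univ, one_smul,
    integral_eval_centeredLaw (fun i : Fin n => M.σp i) i (f := fun x => |x|) (by fun_prop)]
  have h1 := (integral_abs_gaussianReal_le (hM.σp_pos i).le).trans
    (Real.sqrt_le_sqrt (h.σp_le i))
  linarith

/-- Error of the risk estimate and of the loss at a point of the grid. -/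
noncomputable def pointErr (M : Model) (γ : ℕ → ℝ) (n : ℕ) (θ : ℕ → ℝ) (τ : ℝ≥0∞)
    (x : Fin n → ℝ) : ℝ :=
  |M.AREG γ n τ x - M.target n θ τ| + |M.loss n θ (M.qG τ x) - M.target n θ τ|

/-- Bound for the excess loss of the minimizer of the risk estimate over the grid of mesh `δ`. -/
noncomputable def excess (M : Model) (c C : ℝ) (γ : ℕ → ℝ) (n : ℕ) (θ : ℕ → ℝ) (δ : ℝ)
    (x : Fin n → ℝ) : ℝ :=
  2 * (∑ j ∈ Finset.range ⌈1 / δ⌉₊, M.pointErr γ n θ (gridPoint δ j) x)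
    + δ * (C * shrinkConst c C * (2 * ((1 / (n : ℝ)) * ∑ i, |x i|) + √C * C))

lemma pointErr_nonneg (γ : ℕ → ℝ) (n : ℕ) (θ : ℕ → ℝ) (τ : ℝ≥0∞) (x : Fin n → ℝ) :
    0 ≤ M.pointErr γ n θ τ x := add_nonneg (abs_nonneg _) (abs_nonneg _)

lemma shrinkConst_nonneg (h : M.Bounded c C) : 0 ≤ shrinkConst c C := by
  have := lt_min one_pos h.c_pos
  have := h.C_pos
  unfold shrinkConst; positivity

lemma excess_nonneg (h : M.Bounded c C) (γ : ℕ → ℝ) (n : ℕ) (θ : ℕ → ℝ) {δ : ℝ} (hδ : 0 < δ)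
    (x : Fin n → ℝ) : 0 ≤ M.excess c C γ n θ δ x := by
  have h1 := Finset.sum_nonneg fun j (_ : j ∈ Finset.range ⌈1 / δ⌉₊) =>
    pointErr_nonneg (M := M) γ n θ (gridPoint δ j) x
  have h2 := shrinkConst_nonneg h
  have h3 := h.C_pos
  unfold excess
  positivity

/-- Pass from the chosen grid point to the one nearest to `τ`: loss to target to risk estimate,
across by minimality, and back to the loss. The two `pointErr` are each at most the sum over the
grid, hence the factor `2`; the last step to `τ` costs the mesh times the Lipschitz constant. -/
lemma loss_le_add_excess (h : M.Bounded c C) (γ : ℕ → ℝ) {n : ℕ} (hn : 0 < n) (θ : ℕ → ℝ) {δ : ℝ}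
    (hδ : 0 < δ) {x : Fin n → ℝ} {k : ℕ} (hk : k < ⌈1 / δ⌉₊)
    (hmin : ∀ j < ⌈1 / δ⌉₊, M.AREG γ n (gridPoint δ k) x ≤ M.AREG γ n (gridPoint δ j) x)
    (τ : ℝ≥0∞) :
    M.loss n θ (M.qG (gridPoint δ k) x) ≤ M.loss n θ (M.qG τ x) + M.excess c C γ n θ δ x := by
  obtain ⟨j, hj, hnear⟩ := exists_grid_near hδ (unitCoord_nonneg τ) (unitCoord_le_one τ)
  have hle : ∀ j < ⌈1 / δ⌉₊, M.pointErr γ n θ (gridPoint δ j) x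
      ≤ ∑ j ∈ Finset.range ⌈1 / δ⌉₊, M.pointErr γ n θ (gridPoint δ j) x := fun j hj =>
    Finset.single_le_sum (f := fun j => M.pointErr γ n θ (gridPoint δ j) x)
      (fun j _ => pointErr_nonneg γ n θ _ x) (Finset.mem_range.2 hj)
  have e1 := hle k hk
  have e2 := hle j hj
  have e3 := hmin j hj
  have e4 := (le_abs_self _).trans (abs_loss_qG_sub_le h hn θ (gridPoint δ j) τ x)
  rw [unitCoord_gridPoint hδ.le (mul_lt_one_of_lt_ceil hδ hj)] at e4
  have hK : 0 ≤ C * shrinkConst c C * (2 * ((1 / (n : ℝ)) * ∑ i, |x i|) + √C * C) := by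
    have h2 := shrinkConst_nonneg h
    have h3 := h.C_pos
    positivity
  have e5 := mul_le_mul_of_nonneg_right hnear hK
  unfold pointErr at e1 e2
  unfold excess pointErr
  have a1 := neg_abs_le (M.AREG γ n (gridPoint δ k) x - M.target n θ (gridPoint δ k))
  have a2 := le_abs_self (M.loss n θ (M.qG (gridPoint δ k) x) - M.target n θ (gridPoint δ k))
  have a3 := le_abs_self (M.AREG γ n (gridPoint δ j) x - M.target n θ (gridPoint δ j))
  have a4 := neg_abs_le (M.loss n θ (M.qG (gridPoint δ j) x) - M.target n θ (gridPoint δ j))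
  linarith

lemma integral_excess_le (h : M.Bounded c C) {γ : ℕ → ℝ} {g₀ : ℝ} (hg₀ : 0 < g₀)
    (hγ₀ : ∀ i, g₀ ≤ γ i) (hγ : ∀ i, γ i < 1 / √(4 * Real.exp 1) - √(M.σp i / M.σf i)) {n : ℕ}
    (hlog : 1 ≤ Real.log n) (hn : 16 * C / c ≤ n) {θ : ℕ → ℝ} {T : ℝ}
    (hT : (1 / (n : ℝ)) * ∑ i : Fin n, |θ i| ≤ T) {δ : ℝ} (hδ : 0 < δ) :
    Integrable (M.excess c C γ n θ δ) (M.dataLaw n θ) ∧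
      ∫ x, M.excess c C γ n θ δ x ∂(M.dataLaw n θ)
        ≤ 2 * (⌈1 / δ⌉₊ * (devRate c C T g₀ n + 2 * C * √(C / n)))
          + δ * (C * shrinkConst c C * (2 * (T + √C) + √C * C)) := by
  have hM := h.positive
  have hC := h.C_pos
  have hs := shrinkConst_nonneg h
  have hn0 : 0 < n := by
    rcases Nat.eq_zero_or_pos n with rfl | h0
    · norm_num at hlog
    · exact h0
  have hn' : (0 : ℝ) < n := Nat.cast_pos.2 hn0
  have hp : ∀ j ∈ Finset.range ⌈1 / δ⌉₊,
      Integrable (M.pointErr γ n θ (gridPoint δ j)) (M.dataLaw n θ) ∧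
      ∫ x, M.pointErr γ n θ (gridPoint δ j) x ∂(M.dataLaw n θ)
        ≤ devRate c C T g₀ n + 2 * C * √(C / n) := by
    intro j hj
    have hτ := gridPoint_ne_top (mul_lt_one_of_lt_ceil hδ (Finset.mem_range.1 hj))
    obtain ⟨hi, hle⟩ := integral_abs_AREG_sub_target_le h hg₀ hγ₀ hγ hlog hn hT hτ
    have i1 := (hi.sub (integrable_const (M.target n θ (gridPoint δ j)))).abs
    have i2 := ((integrable_loss_qG hM n θ (τ := fun _ => gridPoint δ j) measurable_const).sub
      (integrable_const (M.target n θ (gridPoint δ j)))).abs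
    simp only [Pi.sub_apply] at i1 i2
    refine ⟨i1.add i2, ?_⟩
    unfold pointErr
    rw [integral_add i1 i2]
    exact add_le_add hle (integral_abs_loss_sub_target_le h hn0 θ _)
  have hsum := integrable_finsetSum _ fun j hj => (hp j hj).1
  have hx : ∀ i ∈ (Finset.univ : Finset (Fin n)),
      Integrable (fun x : Fin n → ℝ => |x i|) (M.dataLaw n θ) :=
    fun i _ => (integrable_eval_dataLaw n θ i).abs
  have hxs : Integrable (fun x : Fin n → ℝ => 2 * ((1 / (n : ℝ)) * ∑ i, |x i|)) (M.dataLaw n θ) :=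
    ((integrable_finsetSum _ hx).const_mul _).const_mul _
  have hd : Integrable (fun x : Fin n → ℝ =>
      δ * (C * shrinkConst c C * (2 * ((1 / (n : ℝ)) * ∑ i, |x i|) + √C * C))) (M.dataLaw n θ) :=
    ((hxs.add (integrable_const _)).const_mul _).const_mul _
  refine ⟨(hsum.const_mul 2).add hd, ?_⟩
  unfold excess
  rw [integral_add (hsum.const_mul 2) hd, integral_const_mul, integral_const_mul,
    integral_const_mul, integral_add hxs (integrable_const _), integral_const_mul,
    integral_const_mul, integral_finsetSum _ fun j hj => (hp j hj).1, integral_finsetSum _ hx,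
    integral_const, probReal_univ, one_smul]
  have b1 : ∑ j ∈ Finset.range ⌈1 / δ⌉₊, ∫ x, M.pointErr γ n θ (gridPoint δ j) x ∂(M.dataLaw n θ)
      ≤ ⌈1 / δ⌉₊ * (devRate c C T g₀ n + 2 * C * √(C / n)) := by
    refine (Finset.sum_le_sum fun j hj => (hp j hj).2).trans_eq ?_
    rw [Finset.sum_const, Finset.card_range, nsmul_eq_mul]
  have b2 : (1 / (n : ℝ)) * ∑ i : Fin n, ∫ x : Fin n → ℝ, |x i| ∂(M.dataLaw n θ) ≤ T + √C := by
    calc _ ≤ (1 / (n : ℝ)) * ∑ i : Fin n, (|θ i| + √C) := by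
          gcongr with i _
          exact integral_abs_eval_dataLaw_le h n θ i
      _ = (1 / (n : ℝ)) * ∑ i : Fin n, |θ i| + √C := by
          rw [Finset.sum_add_distrib, mul_add]
          simp
          field_simp
      _ ≤ _ := by linarith
  gcongr

end Model

/-- A nonempty grid forces a positive mesh. This also covers small `n`, where `log (log n)` may be
negative. -/
lemma mesh_pos_of_mem_grid {C₁ C₂ C₃ C₄ : ℝ} {n : ℕ} {τ : ℝ≥0∞} (h : τ ∈ grid C₁ C₂ C₃ C₄ n) :
    0 < mesh C₁ C₂ C₃ C₄ n := by
  obtain ⟨j, hj, -⟩ := h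
  exact one_div_pos.1 (Nat.ceil_pos.1 (by omega))

/-- The excess loss of the minimizer of the risk estimate tends to `0` in the mean, uniformly over
the competing hyperparameters. -/
theorem exists_excess {M : Model} (hM : M.Positive) (hA1 : M.A1) (hA3 : M.A3) {θ : ℕ → ℝ}
    (hA2 : A2 θ) {γ : ℕ → ℝ} (hγ : M.AdmissibleGamma γ) {C₁ C₂ C₃ C₄ : ℝ}
    (hC : M.GridConstants θ C₁ C₂ C₃ C₄) {τARE : (n : ℕ) → (Fin n → ℝ) → ℝ≥0∞}
    (hτARE : ∀ n x, IsArgmin (fun τ => M.AREG γ n τ x) (grid C₁ C₂ C₃ C₄ n) (τARE n x)) :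
    ∃ R : (n : ℕ) → (Fin n → ℝ) → ℝ,
      (∀ᶠ n in atTop, (∀ x, 0 ≤ R n x) ∧ Integrable (R n) (M.dataLaw n θ) ∧
        ∀ x τ, M.loss n θ (M.qG (τARE n x) x) ≤ M.loss n θ (M.qG τ x) + R n x) ∧
      Tendsto (fun n => ∫ x, R n x ∂(M.dataLaw n θ)) atTop (𝓝 0) := by
  obtain ⟨c, C, h⟩ := M.exists_bounded hM hA1 hA3 hC
  obtain ⟨⟨g₀, hg₀, hγ₀⟩, hγ'⟩ := hγ
  obtain ⟨T, hT⟩ := hA2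
  rw [eventually_map] at hT
  have hC₁ : 0 < C₁ := (add_pos (hM.b_pos 0) (hM.h_pos 0)).trans_le (hC.weights 0)
  have hC₂ : 0 < C₂ := (hM.σp_pos 0).trans_le ((le_max_left _ _).trans (hC.variances 0))
  have hm : ∀ n, 0 < mesh C₁ C₂ C₃ C₄ n := fun n => mesh_pos_of_mem_grid (hτARE n 0).1
  have hm0 := tendsto_mesh hC₁ hC₂ C₃ C₄
  obtain ⟨K, hK⟩ := devRate_le (c := c) (T := T) h.C_pos.le hg₀
  have hbig : ∀ᶠ n : ℕ in atTop, 1 ≤ Real.log n ∧ 16 * C / c ≤ n :=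
    (tendsto_log_natCast.eventually_ge_atTop 1).and
      (tendsto_natCast_atTop_atTop.eventually_ge_atTop _)
  -- The bound does not involve the competitor, so it serves data-dependent competitors as well.
  refine ⟨fun n => M.excess c C γ n θ (mesh C₁ C₂ C₃ C₄ n), ?_, ?_⟩
  · filter_upwards [hT, hbig, eventually_gt_atTop 0] with n hTn hn hn0
    refine ⟨fun x => Model.excess_nonneg h γ n θ (hm n) x,
      (Model.integral_excess_le h hg₀ hγ₀ hγ' hn.1 hn.2 hTn (hm n)).1, fun x τ => ?_⟩
    obtain ⟨⟨k, hk, hτ⟩, hmin⟩ := hτARE n x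
    rw [hτ] at hmin ⊢
    exact Model.loss_le_add_excess h γ hn0 θ (hm n) hk (fun j hj => hmin _ ⟨j, hj, rfl⟩) τ
  · set K' := C * Model.shrinkConst c C * (2 * (T + √C) + √C * C) with hK'
    have hlim : Tendsto (fun n => 2 * K * ((⌈1 / mesh C₁ C₂ C₃ C₄ n⌉₊ : ℝ) * errRate n)
        + mesh C₁ C₂ C₃ C₄ n * K') atTop (𝓝 0) := by
      simpa using ((tendsto_ceil_mesh_mul_errRate hm).const_mul (2 * K)).add (hm0.mul_const K')
    refine squeeze_zero' (Eventually.of_forall fun n => integral_nonneg fun x =>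
      Model.excess_nonneg h γ n θ (hm n) x) ?_ hlim
    filter_upwards [hT, hbig, hK] with n hTn hn hKn
    refine (Model.integral_excess_le h hg₀ hγ₀ hγ' hn.1 hn.2 hTn (hm n)).2.trans ?_
    have := mul_le_mul_of_nonneg_left hKn
      (Nat.cast_nonneg (α := ℝ) ⌈1 / mesh C₁ C₂ C₃ C₄ n⌉₊)
    linarith

/-- Markov's inequality for a sequence of dominated differences. -/
lemma tendsto_measure_of_le_add {Ω : ℕ → Type*} {mΩ : ∀ n, MeasurableSpace (Ω n)}
    {μ : ∀ n, Measure (Ω n)} [∀ n, IsProbabilityMeasure (μ n)] {f g R : ∀ n, Ω n → ℝ}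
    (hR : ∀ᶠ n in atTop, (∀ x, 0 ≤ R n x) ∧ Integrable (R n) (μ n) ∧ ∀ x, f n x ≤ g n x + R n x)
    (hlim : Tendsto (fun n => ∫ x, R n x ∂(μ n)) atTop (𝓝 0)) {ε : ℝ} (hε : 0 < ε) :
    Tendsto (fun n => μ n {x | f n x ≥ g n x + ε}) atTop (𝓝 0) := by
  have h1 : Tendsto (fun n => ENNReal.ofReal ((∫ x, R n x ∂(μ n)) / ε)) atTop (𝓝 0) := by
    have := ENNReal.tendsto_ofReal (hlim.div_const ε)
    simpa using this
  refine tendsto_of_tendsto_of_tendsto_of_le_of_le' tendsto_const_nhds h1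
    (Eventually.of_forall fun n => zero_le) ?_
  filter_upwards [hR] with n hn
  obtain ⟨h0, hi, hle⟩ := hn
  have h2 := mul_meas_ge_le_integral_of_nonneg (ae_of_all _ h0) hi ε
  have h3 : (μ n).real {x | ε ≤ R n x} ≤ (∫ x, R n x ∂(μ n)) / ε := by
    rw [le_div_iff₀ hε]; linarith
  calc μ n {x | f n x ≥ g n x + ε} ≤ μ n {x | ε ≤ R n x} := by
        refine measure_mono fun x hx => ?_
        have := hle x
        simp only [Set.mem_ofPred_eq] at hx ⊢
        linarith
    _ = ENNReal.ofReal ((μ n).real {x | ε ≤ R n x}) := (ofReal_measureReal).symm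
    _ ≤ _ := ENNReal.ofReal_le_ofReal h3

lemma integral_sub_le_of_le_add {Ω : Type*} {mΩ : MeasurableSpace Ω} {μ : Measure Ω}
    {f g R : Ω → ℝ} (hf : Integrable f μ) (hg : Integrable g μ) (hR : Integrable R μ)
    (hle : ∀ x, f x ≤ g x + R x) : (∫ x, f x ∂μ) - ∫ x, g x ∂μ ≤ ∫ x, R x ∂μ := by
  have := integral_mono hf (hg.fun_add hR) hle
  rw [integral_add hg hR] at this
  linarith

end CheckLoss

theorem mainTheorem12 (M : Model) (hM : M.Positive) (hA1 : M.A1) (hA3 : M.A3)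
    (θ : ℕ → ℝ) (hA2 : A2 θ)
    (γ : ℕ → ℝ) (hγ : M.AdmissibleGamma γ)
    (C₁ C₂ C₃ C₄ : ℝ) (hC : M.GridConstants θ C₁ C₂ C₃ C₄)
    (τARE : (n : ℕ) → (Fin n → ℝ) → ℝ≥0∞) (hτARE_meas : ∀ n, Measurable (τARE n))
    (hτARE : ∀ n x, IsArgmin (fun τ => M.AREG γ n τ x) (grid C₁ C₂ C₃ C₄ n) (τARE n x))
    (τGOR : (n : ℕ) → (Fin n → ℝ) → ℝ≥0∞)
    (hτGOR : ∀ n x, IsArgmin (fun τ => M.loss n θ (M.qG τ x)) Set.univ (τGOR n x)) :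
    -- all expectations below are finite
    ((∀ n, Integrable (fun x => M.loss n θ (M.qG (τARE n x) x)) (M.dataLaw n θ)) ∧
      (∀ n, Integrable (fun x => M.loss n θ (M.qG (τGOR n x) x)) (M.dataLaw n θ))) ∧
    -- comparison with the oracle, in loss and in risk
    ((∀ ε : ℝ, 0 < ε →
        Tendsto (fun n => M.dataLaw n θ
          {x | M.loss n θ (M.qG (τARE n x) x) ≥ M.loss n θ (M.qG (τGOR n x) x) + ε})
          atTop (𝓝 0)) ∧
      Tendsto (fun n => M.risk n θ (fun x => M.qG (τARE n x) x)
          - ∫ x, M.loss n θ (M.qG (τGOR n x) x) ∂(M.dataLaw n θ)) atTop (𝓝 0)) ∧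
    -- comparison with an arbitrary estimate of the hyperparameter, in loss and in risk
    (∀ τhat : (n : ℕ) → (Fin n → ℝ) → ℝ≥0∞, (∀ n, Measurable (τhat n)) →
      (∀ n, Integrable (fun x => M.loss n θ (M.qG (τhat n x) x)) (M.dataLaw n θ)) ∧
      (∀ ε : ℝ, 0 < ε →
        Tendsto (fun n => M.dataLaw n θ
          {x | M.loss n θ (M.qG (τARE n x) x) ≥ M.loss n θ (M.qG (τhat n x) x) + ε})
          atTop (𝓝 0)) ∧
      limsup (fun n => ((M.risk n θ (fun x => M.qG (τARE n x) x)
          - M.risk n θ (fun x => M.qG (τhat n x) x) : ℝ) : EReal)) atTop ≤ 0) := by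
  have hoM := fun n => Model.integrable_loss_qG hM n θ (hτARE_meas n)
  have hoG := fun n => Model.integrable_loss_oracle hM θ (hτGOR n)
  obtain ⟨R, hR, hlim⟩ := exists_excess hM hA1 hA3 hA2 hγ hC hτARE
  refine ⟨⟨hoM, hoG⟩, ⟨fun ε hε => ?_, ?_⟩, fun τhat hτhat => ?_⟩
  · refine tendsto_measure_of_le_add ?_ hlim hε
    filter_upwards [hR] with n hn
    exact ⟨hn.1, hn.2.1, fun x => hn.2.2 x _⟩
  -- The difference is nonnegative because the oracle minimizes the loss pointwise, and at most the
  -- mean excess.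
  · refine squeeze_zero' (Eventually.of_forall fun n => ?_) ?_ hlim
    · exact sub_nonneg.2 (integral_mono (hoG n) (hoM n) fun x => (hτGOR n x).2 _ (Set.mem_univ _))
    · filter_upwards [hR] with n hn
      exact integral_sub_le_of_le_add (hoM n) (hoG n) hn.2.1 fun x => hn.2.2 x _
  · have hoH := fun n => Model.integrable_loss_qG hM n θ (hτhat n)
    refine ⟨hoH, fun ε hε => ?_, ?_⟩
    · refine tendsto_measure_of_le_add ?_ hlim hε
      filter_upwards [hR] with n hn
      exact ⟨hn.1, hn.2.1, fun x => hn.2.2 x _⟩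
    -- In the extended reals the upper limit is meaningful without a lower bound on the differences
    -- of the risks.
    · have hlim' : Tendsto (fun n => ((∫ x, R n x ∂(M.dataLaw n θ) : ℝ) : EReal)) atTop (𝓝 0) := by
        exact_mod_cast (continuous_coe_real_ereal.tendsto 0).comp hlim
      rw [← hlim'.limsup_eq]
      refine limsup_le_limsup ?_
      filter_upwards [hR] with n hn
      exact EReal.coe_le_coe_iff.2
        (integral_sub_le_of_le_add (hoM n) (hoH n) hn.2.1 fun x => hn.2.2 x _)
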